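/- **Preservation for Elevator.** *Modes.* Fix a set of modes with a preorder $\ge$ and a map $\mathcal S$ from modes to subsets of $\{\mathtt C,\mathtt W\}$ (contraction, weakening) such that $m\ge k$ implies $\mathcal S(m)\supseteq\mathcal S(k)$; $k>l$ means $k\ge l$ and not $l\ge k$. *Syntax* (up to renaming of bound variables; type variables $\alpha$, term variables $x$; a subscript is a mode; $\hat\Psi$ is the list of names of $\Psi$; terms carry elaborated mode annotations and `force` carries the erased domain $\delta$ of its substitution): - kinds $K ::= \mathsf{Type}_k \mid {\uparrow}^k_l(\Psi\vdash K_l)$, where $\mathsf{Type}_k$ and ${\uparrow}_l^k(\Psi\vdash K_l)$ have mode $k$; - normal types $A,B ::= 1_k \mid P \mid \hat\Psi.A \mid {\uparrow}^k_l(\Psi\vdash A) \mid {\downarrow}^m_kA \mid \forall\alpha{:}K.A \mid A\to B$, and neutral types $P::=\alpha\mid \mathsf{force}\,P\,\sigma$; - terms $e,f ::= x\mid \mathsf{one}\mid \mathsf{susp}^k_l\,\hat\Psi.e\mid \mathsf{force}^m_k\,e\,\sigma_\delta\mid\mathsf{store}^m_k\,e\mid \mathsf{load}^m_n\,x=e\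 \mathsf{in}\ f\mid\Lambda\alpha{:}K.e\mid e\,A\mid\lambda x{:}A_k.e\mid e\,f$; - contexts $\Gamma,\Psi ::= \cdot\mid\Gamma,\alpha{:}K\mid\Gamma,x{:}A_k$; substitutions $\sigma::=\cdot\mid\sigma,\alpha\mapsto A\mid\sigma,x\mapsto_k e$. *Erasure.* $K^-,\Psi^-$ erase the types of term variables: $(\mathsf{Type}_k)^-=\mathsf{Type}_k$, $({\uparrow}^k_l(\Psi\vdash K))^-={\uparrow}^k_l(\Psi^-\vdash K^-)$, $(\Gamma,\alpha{:}K)^-=\Gamma^-,\alpha{:}K^-$, $(\Gamma,x{:}A)^-=\Gamma^-,x$. *Substitution.* $[\sigma]_\gamma$ (partial) is the simultaneous, capture-avoiding substitution on kinds, types, contexts, substitutions and terms that commutes with every constructor except on neutral types, where it is hereditary. There $[\sigma]_\gamma\alpha$ is $A$ with kind $\kappa$ if $\alpha\mapsto A\in\sigma$ and $\alpha{:}\kappa\in\gamma$, and is $\alpha$ if $\alpha$ is not in the domain of $\sigma$. If $[\sigma]_\gamma P$ is $\hat\Psi.A$ with kind ${\uparrow}^m_l(\psi\vdash\kappa)$,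 then $[\sigma]_\gamma(\mathsf{force}\,P\,\tau)$ is $[[\sigma]_\gamma\tau]_\psi A$ with kind $\kappa$; if $[\sigma]_\gamma P$ is a neutral type $P'$, it is $\mathsf{force}\,P'\,([\sigma]_\gamma\tau)$. *Context split.* $\Gamma=\Gamma_1\bowtie\Gamma_2$ means that each declaration of $\Gamma$ occurs, in the order of $\Gamma$, in $\Gamma_1$, in $\Gamma_2$ or in both, and nothing else occurs in them; a term variable of mode $k$ may occur in both only if $\mathtt C\in\mathcal S(k)$. $\Gamma\ge k$ means that every declaration of $\Gamma$ has mode $\ge k$; $k>\Psi\ge l$ means that $k\ge l$ and every declaration of $\Psi$ has a mode $j$ with $k>j\ge l$. $\Gamma_W$ denotes a context whose term variables all have modes with $\mathtt W$ (type variables of any mode are allowed). $|\Gamma|$ is the sub-context of the type variables of $\Gamma$. *Judgements.* The following judgements are defined by simultaneous induction. Every judgement in a derivation is required to satisfy its presuppositions: $\Gamma\vdash K$ kind presupposes $\vdash\Gamma$ ctx and $\Gamma\ge k$ ($k$ the mode of $K$); $\Gamma\vdash A:K$ presupposes these and $\Gamma\vdash K$ kind; $\Gamma\vdash e:A_k$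 presupposes $\vdash\Gamma$ ctx, $\Gamma\ge k$, $\Gamma\vdash A:\mathsf{Type}_k$; $\Gamma\vdash\sigma:\Psi$ presupposes $\vdash\Gamma,\Psi$ ctx. The rules are: - $\vdash\cdot$ ctx. If $\vdash\Gamma_1\bowtie\Gamma_2$ ctx, $\vdash\Gamma_1$ ctx, $\Gamma_1\ge k$, and $\Gamma_1\vdash K_k$ kind (resp. $\Gamma_1\vdash A:\mathsf{Type}_k$), then $\vdash(\Gamma_1\bowtie\Gamma_2),\alpha{:}K_k$ ctx (resp. $\vdash(\Gamma_1\bowtie\Gamma_2),x{:}A_k$ ctx). - $\Gamma\vdash\mathsf{Type}_k$ kind. If $k>\Psi\ge l$, $\vdash\Gamma,\Psi$ ctx and $\Gamma,\Psi\vdash K_l$ kind, then $\Gamma\vdash{\uparrow}^k_l(\Psi\vdash K_l)$ kind. - $\Gamma\vdash\alpha:K$ if $\alpha{:}K\in\Gamma$. $\Gamma\vdash 1_k:\mathsf{Type}_k$. If $\Gamma,\Psi\vdash A:K_l$ then $\Gamma\vdash\hat\Psi.A:{\uparrow}^k_l(\Psi\vdash K_l)$. If $k>\Psi\ge l$, $\vdash\Gamma,\Psi$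 ctx and $\Gamma,\Psi\vdash A:\mathsf{Type}_l$ then $\Gamma\vdash{\uparrow}^k_l(\Psi\vdash A):\mathsf{Type}_k$. If $\Gamma\vdash A,B:\mathsf{Type}_k$ then $\Gamma\vdash A\to B:\mathsf{Type}_k$. - If $\Gamma_1\ge m\ge k$, $\vdash\Gamma_1$ ctx and $\Gamma_1\vdash A:\mathsf{Type}_m$ then $\Gamma_1\bowtie\Gamma_2\vdash{\downarrow}^m_kA:\mathsf{Type}_k$. If $\Gamma_1\ge m\ge k$, $\vdash\Gamma_1$ ctx, $\Gamma_1\vdash K_m$ kind and $(\Gamma_1\bowtie\Gamma_2),\alpha{:}K_m\vdash A:\mathsf{Type}_k$ then $\Gamma_1\bowtie\Gamma_2\vdash\forall\alpha{:}K_m.A:\mathsf{Type}_k$. - If $\Gamma=\Gamma_1\bowtie\Gamma_2$, $\Gamma_1\ge m$, $\vdash\Gamma_1$ ctx, $\vdash\Gamma,\Psi$ ctx, $\Gamma_1\vdash{\uparrow}^m_k(\Psi\vdash K)$ kind, $\Gamma_1\vdash P:{\uparrow}^m_k(\Psi\vdash K)$ and $|\Gamma|\vdash\sigma:\Psi$,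 then $\Gamma\vdash\mathsf{force}\,P\,\sigma:[\sigma]_{\Psi^-}K$. (Types, kinds and contexts cannot refer to the term variables in scope and do not consume them.) - $(x{:}A_k)\bowtie\Gamma_W\vdash x:A_k$. $\Gamma_W\vdash\mathsf{one}:1_k$. If $\Gamma,\Psi\vdash e:A_l$ then $\Gamma\vdash\mathsf{susp}^k_l\,\hat\Psi.e:{\uparrow}^k_l(\Psi\vdash A_l)$. If $\Gamma\ge m$, $\vdash\Gamma$ ctx and $\Gamma\vdash e:A_m$ then $\Gamma\bowtie\Gamma_W\vdash\mathsf{store}^m_k\,e:{\downarrow}^m_kA_m$. - If $\Gamma,\alpha{:}K\vdash e:A_k$ then $\Gamma\vdash\Lambda\alpha{:}K.e:\forall\alpha{:}K.A_k$. If $\Gamma,x{:}A_k\vdash e:B_k$ then $\Gamma\vdash\lambda x{:}A_k.e:A_k\to B_k$. - If $\vdash\Gamma_1$ ctx, $\Gamma_1\ge m$, $\vdash\Gamma_2,\Psi$ ctx, $\Gamma_1\vdash{\uparrow}^m_k(\Psi\vdash A_k):\mathsf{Type}_m$, $\Gamma_1\vdash e:{\uparrow}^m_k(\Psi\vdash A_k)$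 and $\Gamma_2\vdash\sigma:\Psi$, then $\Gamma_1\bowtie\Gamma_2\vdash\mathsf{force}^m_k\,e\,\sigma_{\Psi^-}:[\sigma]_{\Psi^-}A_k$. - If $\vdash\Gamma_1$ ctx, $\Gamma_1\ge n\ge k$, $\vdash\Gamma_2,x{:}A_m$ ctx, $\Gamma_1\vdash{\downarrow}^m_nA_m:\mathsf{Type}_n$, $\Gamma_1\vdash e:{\downarrow}^m_nA_m$ and $\Gamma_2,x{:}A_m\vdash f:B_k$ (with $x$ not in $B$), then $\Gamma_1\bowtie\Gamma_2\vdash\mathsf{load}^m_n\,x=e\ \mathsf{in}\ f:B_k$. - If $\vdash\Gamma_1$ ctx, $\Gamma_1\ge m\ge k$, $\Gamma_1\bowtie\Gamma_2\vdash\forall\alpha{:}K_m.B_k:\mathsf{Type}_k$, $\Gamma_1\bowtie\Gamma_2\vdash e:\forall\alpha{:}K_m.B_k$, $\Gamma_1\vdash K_m$ kind and $\Gamma_1\vdash A:K_m$, then $\Gamma_1\bowtie\Gamma_2\vdash e\,A:[\alpha\mapsto A]_{\alpha:K_m^-}B_k$. - If $\vdash\Gamma_1$ ctx, $\vdash\Gamma_2$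 ctx, $\Gamma_1\vdash A_k\to B_k:\mathsf{Type}_k$, $\Gamma_1\vdash e:A_k\to B_k$, $\Gamma_2\vdash A_k:\mathsf{Type}_k$ and $\Gamma_2\vdash f:A_k$, then $\Gamma_1\bowtie\Gamma_2\vdash e\,f:B_k$. - $\Gamma_W\vdash\cdot:\cdot$. If $\Gamma_1\ge k$, $\Gamma_1\bowtie\Gamma_2\vdash\sigma:\Psi$, $\vdash\Gamma_1$ ctx, $\Gamma_1\vdash[\sigma]_{\Psi^-}K_k$ kind and $\Gamma_1\vdash A:[\sigma]_{\Psi^-}K_k$, then $\Gamma_1\bowtie\Gamma_2\vdash(\sigma,\alpha\mapsto A):(\Psi,\alpha{:}K_k)$. If $\Gamma_1\ge k$, $\vdash\Gamma_2$ ctx, $\Gamma_2\vdash\sigma:\Psi$, $\vdash\Gamma_1$ ctx, $\Gamma_1\vdash[\sigma]_{\Psi^-}A_k:\mathsf{Type}_k$ and $\Gamma_1\vdash e:[\sigma]_{\Psi^-}A_k$, then $\Gamma_1\bowtie\Gamma_2\vdash(\sigma,x\mapsto_ke):(\Psi,x{:}A_k)$. *Results.* Weak normal forms $v,u$, weak neutral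 forms $q$ and normal templates $a^k,b^k$ in mode $k$ ($l_0,l_1,l,m,n$ range over all modes) are - $v::=\mathsf{susp}^k_l\hat\Psi.a^k\mid\mathsf{store}^m_k v\mid\Lambda\alpha{:}K.e\mid\lambda x{:}A.e\mid\mathsf{one}\mid q$; - $q::=x\mid\mathsf{force}^m_n\,q\,\sigma\mid\mathsf{load}^m_n\,x=q\ \mathsf{in}\ e\mid q\,A\mid q\,v$; - $a^k::=x\mid\mathsf{one}\mid\mathsf{susp}^{l_0}_{l_1}\hat\Psi.a^k\mid\Lambda\alpha{:}K.a^k\mid a^k\,A\mid\lambda x{:}A.a^k\mid a^k\,b^k$, and $\mathsf{force}^{l_0}_{l_1}a^k\sigma$, $\mathsf{store}^{l_0}_{l_1}a^k$ if $l_0\not\ge k$, and $\mathsf{force}^{l_0}_{l_1}q\,\sigma$, $\mathsf{store}^{l_0}_{l_1}v$ if $l_0\ge k$, and $\mathsf{load}^{l_0}_{l_1}x=a^k\ \mathsf{in}\ b^k$ if $l_1\not\ge k$, and $\mathsf{load}^{l_0}_{l_1}x=v\ \mathsf{in}\ b^k$ if $l_1\ge k$. *Semantics.* Evaluation $e\longrightarrow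 e'$ and template reduction $e\Longrightarrow_me'$ are defined by simultaneous induction. Evaluation has the reductions $$\mathsf{force}^m_k(\mathsf{susp}^m_k\hat\Psi.a^m)\,\sigma_\delta\longrightarrow[\sigma]_\delta a^m,\quad \mathsf{load}^m_n\,x=\mathsf{store}^m_nv\ \mathsf{in}\ e\longrightarrow[x\mapsto_mv]e,$$ $$(\Lambda\alpha{:}K.e)\,A\longrightarrow[\alpha\mapsto A]_{\alpha:K^-}e,\quad(\lambda x{:}A_k.e)\,u\longrightarrow[x\mapsto_ku]e,$$ applies $\longrightarrow$ in the positions $\mathsf{force}\,\square\,\sigma$, $\mathsf{store}\,\square$, $\mathsf{load}\,x=\square\ \mathsf{in}\ f$, $\square\,A$, $\square\,f$, $v\,\square$, and satisfies $\mathsf{susp}^k_l\hat\Psi.e\longrightarrow\mathsf{susp}^k_l\hat\Psi.e'$ whenever $e\Longrightarrow_ke'$. Template reduction has the reduction $\mathsf{force}^n_k(\mathsf{susp}^n_k\hat\Psi.a^n)\,\sigma_\delta\Longrightarrow_m[\sigma]_\delta a^n$ for $n\ge m$; it applies $\Longrightarrow_m$ in the positions $\mathsf{susp}^k_l\hat\Psi.\square$,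 $\Lambda\alpha{:}K.\square$, $\square\,A$, $\lambda x{:}A.\square$, $\square\,f$, $a^m\,\square$; in the positions $\mathsf{force}^n_k\,\square\,\sigma$, $\mathsf{store}^n_k\,\square$ and $\mathsf{load}^l_n\,x=\square\ \mathsf{in}\ f$ it applies $\Longrightarrow_m$ if $n\not\ge m$ and $\longrightarrow$ if $n\ge m$; and it applies $\Longrightarrow_m$ in $\mathsf{load}^l_n\,x=a^m\ \mathsf{in}\ \square$ if $n\not\ge m$ and in $\mathsf{load}^l_n\,x=v\ \mathsf{in}\ \square$ if $n\ge m$. **Theorem (Preservation).** Let $\Gamma\vdash e:A_k$. 1. If $e\longrightarrow e'$, then $\Gamma\vdash e':A_k$. 2. If $e\Longrightarrow_me'$ for some mode $m$, then $\Gamma\vdash e':A_k$. -/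

import Mathlib

namespace Elevator

universe u

/-! ## Mode specifications -/

/-- The two structural rules a mode may admit. -/
inductive Rule where
  | C : Rule
  | W : Rule

/-- A mode specification on a preordered set of modes: a signature operation that is
monotone, that is, higher modes admit at least the structural rules of lower modes. -/
structure ModeSpec (M : Type u) [Preorder M] where
  sig : M → Set Rule
  mono : ∀ {m k : M}, k ≤ m → sig k ⊆ sig m

/-! ## Raw expressions

Variables are de Bruijn indices: there is one index space for type variables and term variables,
and index `0` is the most recent declaration.  An erased context (a list of names) is therefore
represented by its length. -/

mutual
/-- Dependency-free kinds. -/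
inductive SKind (M : Type u) : Type u where
  | type : M → SKind M
  /-- `up k l ψ κ` is the contextual kind with upper mode `k`, lower mode `l`. -/
  | up : M → M → SCtx M → SKind M → SKind M
/-- Dependency-free contexts. -/
inductive SCtx (M : Type u) : Type u where
  | nil : SCtx M
  | consTy : SCtx M → SKind M → SCtx M
  | consTm : SCtx M → SCtx M
end

mutual
inductive Kind (M : Type u) : Type u where
  | type : M → Kind M
  /-- `up k l Ψ K`: the contextual kind with upper mode `k` and lower mode `l`;
  `K` lives under the declarations of `Ψ`. -/
  | up : M → M → Ctx M → Kind M → Kind M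
/-- Normal types. -/
inductive Ty (M : Type u) : Type u where
  | one : M → Ty M
  | neu : Neu M → Ty M
  /-- `thunk n A`: a type template; `A` lives under `n` further variables. -/
  | thunk : ℕ → Ty M → Ty M
  /-- `up k l Ψ A`: contextual up-shift from mode `l` to mode `k`. -/
  | up : M → M → Ctx M → Ty M → Ty M
  /-- `down m k A`: down-shift from mode `m` to mode `k`. -/
  | down : M → M → Ty M → Ty M
  | all : Kind M → Ty M → Ty M
  | arr : Ty M → Ty M → Ty M
/-- Neutral types. -/
inductive Neu (M : Type u) : Type u where
  | var : ℕ → Neu M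
  | force : Neu M → Sbst M → Neu M
/-- Terms, elaborated with the modes (and, for `force`, with the erased domain of the
substitution) that the operational semantics refers to. -/
inductive Tm (M : Type u) : Type u where
  | var : ℕ → Tm M
  | one : Tm M
  /-- `susp k l n e`: template with upper mode `k` and lower mode `l`, binding `n` variables. -/
  | susp : M → M → ℕ → Tm M → Tm M
  /-- `force m k e δ σ`. -/
  | force : M → M → Tm M → SCtx M → Sbst M → Tm M
  /-- `store m k e`: a pointer in mode `k` to `e` in mode `m`. -/
  | store : M → M → Tm M → Tm M
  /-- `load m n e f`: `load x = e in f`, where `e` is a pointer in mode `n` to mode `m`;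
  binds one variable in `f`. -/
  | load : M → M → Tm M → Tm M → Tm M
  | tlam : Kind M → Tm M → Tm M
  | tapp : Tm M → Ty M → Tm M
  /-- `lam k A e`: abstraction over a variable of type `A` of mode `k`. -/
  | lam : M → Ty M → Tm M → Tm M
  | app : Tm M → Tm M → Tm M
/-- Contexts as they occur inside kinds and types; each declaration lives under the
earlier ones. -/
inductive Ctx (M : Type u) : Type u where
  | nil : Ctx M
  | consTy : Ctx M → Kind M → Ctx M
  | consTm : Ctx M → M → Ty M → Ctx M
/-- Substitutions. -/
inductive Sbst (M : Type u) : Type u where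
  | nil : Sbst M
  | consTy : Sbst M → Ty M → Sbst M
  | consTm : Sbst M → M → Tm M → Sbst M
end

variable {M : Type u}

/-- The mode of a kind. -/
def Kind.mode : Kind M → M
  | .type k => k
  | .up k _ _ _ => k

def Ctx.len : Ctx M → ℕ
  | .nil => 0
  | .consTy Ψ _ => Ψ.len + 1
  | .consTm Ψ _ _ => Ψ.len + 1

def Sbst.len : Sbst M → ℕ
  | .nil => 0
  | .consTy σ _ => σ.len + 1
  | .consTm σ _ _ => σ.len + 1

/-! ## Dependency erasure -/

mutual
def Kind.erase : Kind M → SKind M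
  | .type k => .type k
  | .up k l Ψ K => .up k l Ψ.erase K.erase
def Ctx.erase : Ctx M → SCtx M
  | .nil => .nil
  | .consTy Ψ K => .consTy Ψ.erase K.erase
  | .consTm Ψ _ _ => .consTm Ψ.erase
end

/-! ## Shifting: `X.shift n d` renames every index `i ≥ d` to `i + n` -/

mutual
def Kind.shift (n : ℕ) : ℕ → Kind M → Kind M
  | _, .type k => .type k
  | d, .up k l Ψ K => .up k l (Ctx.shift n d Ψ) (Kind.shift n (d + Ψ.len) K)
def Ty.shift (n : ℕ) : ℕ → Ty M → Ty M
  | _, .one k => .one k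
  | d, .neu P => .neu (Neu.shift n d P)
  | d, .thunk b A => .thunk b (Ty.shift n (d + b) A)
  | d, .up k l Ψ A => .up k l (Ctx.shift n d Ψ) (Ty.shift n (d + Ψ.len) A)
  | d, .down m k A => .down m k (Ty.shift n d A)
  | d, .all K A => .all (Kind.shift n d K) (Ty.shift n (d + 1) A)
  | d, .arr A B => .arr (Ty.shift n d A) (Ty.shift n d B)
def Neu.shift (n : ℕ) : ℕ → Neu M → Neu M
  | d, .var i => .var (if i < d then i else i + n)
  | d, .force P σ => .force (Neu.shift n d P) (Sbst.shift n d σ)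
def Tm.shift (n : ℕ) : ℕ → Tm M → Tm M
  | d, .var i => .var (if i < d then i else i + n)
  | _, .one => .one
  | d, .susp k l b e => .susp k l b (Tm.shift n (d + b) e)
  | d, .force m k e δ σ => .force m k (Tm.shift n d e) δ (Sbst.shift n d σ)
  | d, .store m k e => .store m k (Tm.shift n d e)
  | d, .load m k e f => .load m k (Tm.shift n d e) (Tm.shift n (d + 1) f)
  | d, .tlam K e => .tlam (Kind.shift n d K) (Tm.shift n (d + 1) e)
  | d, .tapp e A => .tapp (Tm.shift n d e) (Ty.shift n d A)
  | d, .lam k A e => .lam k (Ty.shift n d A) (Tm.shift n (d + 1) e)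
  | d, .app e f => .app (Tm.shift n d e) (Tm.shift n d f)
def Ctx.shift (n : ℕ) : ℕ → Ctx M → Ctx M
  | _, .nil => .nil
  | d, .consTy Ψ K => .consTy (Ctx.shift n d Ψ) (Kind.shift n (d + Ψ.len) K)
  | d, .consTm Ψ k A => .consTm (Ctx.shift n d Ψ) k (Ty.shift n (d + Ψ.len) A)
def Sbst.shift (n : ℕ) : ℕ → Sbst M → Sbst M
  | _, .nil => .nil
  | d, .consTy σ A => .consTy (Sbst.shift n d σ) (Ty.shift n d A)
  | d, .consTm σ k e => .consTm (Sbst.shift n d σ) k (Tm.shift n d e)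
end

/-! ## Hereditary substitution -/

/-- The type that `σ` assigns to its `i`-th variable, if that is a type variable. -/
def Sbst.getTy : Sbst M → ℕ → Option (Ty M)
  | .nil, _ => none
  | .consTy _ A, 0 => some A
  | .consTm _ _ _, 0 => none
  | .consTy σ _, i + 1 => σ.getTy i
  | .consTm σ _ _, i + 1 => σ.getTy i

/-- The term that `σ` assigns to its `i`-th variable, if that is a term variable. -/
def Sbst.getTm : Sbst M → ℕ → Option (Tm M)
  | .nil, _ => none
  | .consTy _ _, 0 => none
  | .consTm _ _ e, 0 => some e
  | .consTy σ _, i + 1 => σ.getTm i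
  | .consTm σ _ _, i + 1 => σ.getTm i

/-- The dependency-free kind of the `i`-th variable of `γ`, if that is a type variable. -/
def SCtx.getKind : SCtx M → ℕ → Option (SKind M)
  | .nil, _ => none
  | .consTy _ κ, 0 => some κ
  | .consTm _, 0 => none
  | .consTy γ _, i + 1 => γ.getKind i
  | .consTm γ, i + 1 => γ.getKind i

/-- The outcome of substituting into a neutral type: either again a neutral type, or a
normal type together with the dependency-free kind that drives further reductions. -/
inductive NeuRes (M : Type u) : Type u where
  | neu : Neu M → NeuRes M
  | red : Ty M → SKind M → NeuRes M

/-- The normal type underlying an outcome. -/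
def NeuRes.toTy : NeuRes M → Ty M
  | .neu Q => .neu Q
  | .red A _ => A

/- Each judgement below says that substituting `σ` (with erased domain `γ`) in the fourth argument
yields the fifth.  The third argument `d` is the number of binders already passed: an index `i < d`
is bound and stays, an index `d + i` with `i < σ.len` is replaced by the `i`-th entry of `σ`
(shifted by `d`), and the remaining indices drop by `σ.len`.  The operation is partial, hence
presented as an inductive relation. -/
mutual
inductive SubKind : SCtx M → Sbst M → ℕ → Kind M → Kind M → Prop where
  | type {γ σ d k} : SubKind γ σ d (.type k) (.type k)
  | up {γ σ d k l Ψ Ψ' K K'} :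
      SubCtx γ σ d Ψ Ψ' → SubKind γ σ (d + Ψ.len) K K' →
      SubKind γ σ d (.up k l Ψ K) (.up k l Ψ' K')
inductive SubTy : SCtx M → Sbst M → ℕ → Ty M → Ty M → Prop where
  | one {γ σ d k} : SubTy γ σ d (.one k) (.one k)
  | neu {γ σ d P R} : SubNeu γ σ d P R → SubTy γ σ d (.neu P) R.toTy
  | thunk {γ σ d b A A'} :
      SubTy γ σ (d + b) A A' → SubTy γ σ d (.thunk b A) (.thunk b A')
  | up {γ σ d k l Ψ Ψ' A A'} :
      SubCtx γ σ d Ψ Ψ' → SubTy γ σ (d + Ψ.len) A A' →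
      SubTy γ σ d (.up k l Ψ A) (.up k l Ψ' A')
  | down {γ σ d m k A A'} :
      SubTy γ σ d A A' → SubTy γ σ d (.down m k A) (.down m k A')
  | all {γ σ d K K' A A'} :
      SubKind γ σ d K K' → SubTy γ σ (d + 1) A A' →
      SubTy γ σ d (.all K A) (.all K' A')
  | arr {γ σ d A A' B B'} :
      SubTy γ σ d A A' → SubTy γ σ d B B' → SubTy γ σ d (.arr A B) (.arr A' B')
inductive SubNeu : SCtx M → Sbst M → ℕ → Neu M → NeuRes M → Prop where
  | bound {γ σ d i} : i < d → SubNeu γ σ d (.var i) (.neu (.var i))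
  | hit {γ σ d i A κ} : d ≤ i → σ.getTy (i - d) = some A → γ.getKind (i - d) = some κ →
      SubNeu γ σ d (.var i) (.red (A.shift d 0) κ)
  | free {γ σ d i} : d + σ.len ≤ i → SubNeu γ σ d (.var i) (.neu (.var (i - σ.len)))
  /-- The head became a template: splice it hereditarily. -/
  | splice {γ σ d P b A m l ψ κ τ τ' A'} :
      SubNeu γ σ d P (.red (.thunk b A) (.up m l ψ κ)) → SubSbst γ σ d τ τ' →
      SubTy ψ τ' 0 A A' →
      SubNeu γ σ d (.force P τ) (.red A' κ)
  /-- The head remains, or is replaced by, a neutral type. -/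
  | stuck {γ σ d P R P' τ τ'} :
      SubNeu γ σ d P R → R.toTy = .neu P' → SubSbst γ σ d τ τ' →
      SubNeu γ σ d (.force P τ) (.neu (.force P' τ'))
inductive SubCtx : SCtx M → Sbst M → ℕ → Ctx M → Ctx M → Prop where
  | nil {γ σ d} : SubCtx γ σ d .nil .nil
  | consTy {γ σ d Ψ Ψ' K K'} :
      SubCtx γ σ d Ψ Ψ' → SubKind γ σ (d + Ψ.len) K K' →
      SubCtx γ σ d (.consTy Ψ K) (.consTy Ψ' K')
  | consTm {γ σ d Ψ Ψ' k A A'} :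
      SubCtx γ σ d Ψ Ψ' → SubTy γ σ (d + Ψ.len) A A' →
      SubCtx γ σ d (.consTm Ψ k A) (.consTm Ψ' k A')
inductive SubSbst : SCtx M → Sbst M → ℕ → Sbst M → Sbst M → Prop where
  | nil {γ σ d} : SubSbst γ σ d .nil .nil
  | consTy {γ σ d τ τ' A A'} :
      SubSbst γ σ d τ τ' → SubTy γ σ d A A' →
      SubSbst γ σ d (.consTy τ A) (.consTy τ' A')
  | consTm {γ σ d τ τ' k e e'} :
      SubSbst γ σ d τ τ' → SubTm γ σ d e e' →
      SubSbst γ σ d (.consTm τ k e) (.consTm τ' k e')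
inductive SubTm : SCtx M → Sbst M → ℕ → Tm M → Tm M → Prop where
  | bound {γ σ d i} : i < d → SubTm γ σ d (.var i) (.var i)
  | hit {γ σ d i e} : d ≤ i → σ.getTm (i - d) = some e →
      SubTm γ σ d (.var i) (e.shift d 0)
  | free {γ σ d i} : d + σ.len ≤ i → SubTm γ σ d (.var i) (.var (i - σ.len))
  | one {γ σ d} : SubTm γ σ d .one .one
  | susp {γ σ d k l b e e'} :
      SubTm γ σ (d + b) e e' → SubTm γ σ d (.susp k l b e) (.susp k l b e')
  | force {γ σ d m k e e' δ τ τ'} :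
      SubTm γ σ d e e' → SubSbst γ σ d τ τ' →
      SubTm γ σ d (.force m k e δ τ) (.force m k e' δ τ')
  | store {γ σ d m k e e'} :
      SubTm γ σ d e e' → SubTm γ σ d (.store m k e) (.store m k e')
  | load {γ σ d m n e e' f f'} :
      SubTm γ σ d e e' → SubTm γ σ (d + 1) f f' →
      SubTm γ σ d (.load m n e f) (.load m n e' f')
  | tlam {γ σ d K K' e e'} :
      SubKind γ σ d K K' → SubTm γ σ (d + 1) e e' →
      SubTm γ σ d (.tlam K e) (.tlam K' e')
  | tapp {γ σ d e e' A A'} :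
      SubTm γ σ d e e' → SubTy γ σ d A A' →
      SubTm γ σ d (.tapp e A) (.tapp e' A')
  | lam {γ σ d k A A' e e'} :
      SubTy γ σ d A A' → SubTm γ σ (d + 1) e e' →
      SubTm γ σ d (.lam k A e) (.lam k A' e')
  | app {γ σ d e e' f f'} :
      SubTm γ σ d e e' → SubTm γ σ d f f' →
      SubTm γ σ d (.app e f) (.app e' f')
end

/-! ## Typing contexts -/

/-- A declaration: `α : K` (of mode `K.mode`) or `x : A` at mode `k`. -/
inductive Entry (M : Type u) : Type u where
  | ty : Kind M → Entry M
  | tm : M → Ty M → Entry M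

def Entry.mode : Entry M → M
  | .ty K => K.mode
  | .tm k _ => k

/-- A typing context, most recent declaration first.  Splitting a context removes declarations
from it; `none` marks the position of a name that has been removed, so that the indices of the
remaining names do not change.  A `none` position is not a declaration of the context. -/
abbrev Env (M : Type u) : Type u := List (Option (Entry M))

/-- `Γ, Ψ`. -/
def Env.ext (Γ : Env M) : Ctx M → Env M
  | .nil => Γ
  | .consTy Ψ K => some (.ty K) :: Env.ext Γ Ψ
  | .consTm Ψ k A => some (.tm k A) :: Env.ext Γ Ψ

/-- The sub-context of all type variables. -/
def Env.tyPart : Env M → Env M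
  | [] => []
  | some (.ty K) :: Γ => some (.ty K) :: Env.tyPart Γ
  | some (.tm _ _) :: Γ => none :: Env.tyPart Γ
  | none :: Γ => none :: Env.tyPart Γ

/-- `Γ` declares exactly one variable, namely `E` at position `i`. -/
def Env.Single (Γ : Env M) (i : ℕ) (E : Entry M) : Prop :=
  Γ[i]? = some (some E) ∧ ∀ j E', Γ[j]? = some (some E') → j = i

section Judgements

variable [Preorder M]

/-- `Γ ≥ k`. -/
def Env.Ge (Γ : Env M) (k : M) : Prop := ∀ E, some E ∈ Γ → k ≤ E.mode

/-- `k > Ψ ≥ l`, which includes `k ≥ l` also when `Ψ` is empty. -/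
def Ctx.Between (k : M) (Ψ : Ctx M) (l : M) : Prop :=
  l ≤ k ∧ ∀ E, some E ∈ Env.ext [] Ψ → E.mode < k ∧ l ≤ E.mode

/-- `Γ_W`: nothing in the context has to be used, that is, every term variable has a mode with
weakening.  Type variables persist regardless of their modes. -/
def Env.Weak (S : ModeSpec M) (Γ : Env M) : Prop :=
  ∀ k A, some (Entry.tm k A) ∈ Γ → Rule.W ∈ S.sig k

/-- `Split S Γ Γ₁ Γ₂`: the context split `Γ = Γ₁ ⋈ Γ₂`. -/
inductive Split (S : ModeSpec M) : Env M → Env M → Env M → Prop where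
  | nil : Split S [] [] []
  | none {Γ Γ₁ Γ₂} : Split S Γ Γ₁ Γ₂ → Split S (none :: Γ) (none :: Γ₁) (none :: Γ₂)
  | tyBoth {Γ Γ₁ Γ₂ K} : Split S Γ Γ₁ Γ₂ →
      Split S (some (.ty K) :: Γ) (some (.ty K) :: Γ₁) (some (.ty K) :: Γ₂)
  | tmBoth {Γ Γ₁ Γ₂ k A} : Rule.C ∈ S.sig k → Split S Γ Γ₁ Γ₂ →
      Split S (some (.tm k A) :: Γ) (some (.tm k A) :: Γ₁) (some (.tm k A) :: Γ₂)
  | left {Γ Γ₁ Γ₂ E} : Split S Γ Γ₁ Γ₂ →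
      Split S (some E :: Γ) (some E :: Γ₁) (Option.none :: Γ₂)
  | right {Γ Γ₁ Γ₂ E} : Split S Γ Γ₁ Γ₂ →
      Split S (some E :: Γ) (Option.none :: Γ₁) (some E :: Γ₂)

/-! ## Well-formedness and typing

The presuppositions of a judgement are part of it: each rule lists those of its conclusion
(the premises carry their own).  They are

* for `Γ ⊢ K kind`: `⊢ Γ ctx` and `Γ ≥ K.mode`;
* for `Γ ⊢ A : K`: `⊢ Γ ctx`, `Γ ≥ K.mode` and `Γ ⊢ K kind`;
* for `Γ ⊢ e : A` at mode `k`: `⊢ Γ ctx`, `Γ ≥ k` and `Γ ⊢ A : type k`;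
* for `Γ ⊢ σ : Ψ`: `⊢ Γ, Ψ ctx`.

Types, kinds and contexts cannot refer to term variables and never consume assumptions:
the substitution of a neutral type `force P σ` is typed in the type variables of the context. -/

mutual
/-- `⊢ Γ ctx`. -/
inductive WfEnv (S : ModeSpec M) : Env M → Prop where
  | nil : WfEnv S []
  | none {Γ} : WfEnv S Γ → WfEnv S (none :: Γ)
  | consTy {Γ Γ₁ Γ₂ K} :
      Split S Γ Γ₁ Γ₂ → Γ₁.Ge K.mode → WfEnv S Γ₁ → WfEnv S Γ → WfKind S Γ₁ K →
      WfEnv S (some (.ty K) :: Γ)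
  | consTm {Γ Γ₁ Γ₂ k A} :
      Split S Γ Γ₁ Γ₂ → Γ₁.Ge k → WfEnv S Γ₁ → WfEnv S Γ → HasKind S Γ₁ A (.type k) →
      WfEnv S (some (.tm k A) :: Γ)
/-- `Γ ⊢ K kind`. -/
inductive WfKind (S : ModeSpec M) : Env M → Kind M → Prop where
  | type {Γ k} : WfEnv S Γ → Γ.Ge k → WfKind S Γ (.type k)
  | up {Γ k l Ψ K} :
      WfEnv S Γ → Γ.Ge k →
      Ctx.Between k Ψ l → K.mode = l → WfEnv S (Γ.ext Ψ) → WfKind S (Γ.ext Ψ) K →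
      WfKind S Γ (.up k l Ψ K)
/-- `Γ ⊢ A : K`. -/
inductive HasKind (S : ModeSpec M) : Env M → Ty M → Kind M → Prop where
  | var {Γ i K} :
      WfEnv S Γ → Γ.Ge (K.shift (i + 1) 0).mode → WfKind S Γ (K.shift (i + 1) 0) →
      Γ[i]? = some (some (.ty K)) →
      HasKind S Γ (.neu (.var i)) (K.shift (i + 1) 0)
  | thunk {Γ k l Ψ A K} :
      WfEnv S Γ → Γ.Ge k → WfKind S Γ (.up k l Ψ K) →
      HasKind S (Γ.ext Ψ) A K →
      HasKind S Γ (.thunk Ψ.len A) (.up k l Ψ K)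
  | force {Γ Γ₁ Γ₂ P m k Ψ σ K K'} :
      WfEnv S Γ → Γ.Ge K'.mode → WfKind S Γ K' →
      Split S Γ Γ₁ Γ₂ → Γ₁.Ge m → WfEnv S Γ₁ → WfEnv S (Γ.ext Ψ) →
      WfKind S Γ₁ (.up m k Ψ K) → HasKind S Γ₁ (.neu P) (.up m k Ψ K) →
      HasSbst S Γ.tyPart σ Ψ → SubKind Ψ.erase σ 0 K K' →
      HasKind S Γ (.neu (.force P σ)) K'
  | up {Γ k l Ψ A} :
      WfEnv S Γ → Γ.Ge k → WfKind S Γ (.type k) →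
      Ctx.Between k Ψ l → WfEnv S (Γ.ext Ψ) → HasKind S (Γ.ext Ψ) A (.type l) →
      HasKind S Γ (.up k l Ψ A) (.type k)
  | down {Γ Γ₁ Γ₂ m k A} :
      WfEnv S Γ → Γ.Ge k → WfKind S Γ (.type k) →
      Split S Γ Γ₁ Γ₂ → Γ₁.Ge m → k ≤ m → WfEnv S Γ₁ → HasKind S Γ₁ A (.type m) →
      HasKind S Γ (.down m k A) (.type k)
  | all {Γ Γ₁ Γ₂ k K A} :
      WfEnv S Γ → Γ.Ge k → WfKind S Γ (.type k) →
      Split S Γ Γ₁ Γ₂ → Γ₁.Ge K.mode → k ≤ K.mode → WfEnv S Γ₁ → WfKind S Γ₁ K →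
      HasKind S (some (.ty K) :: Γ) A (.type k) →
      HasKind S Γ (.all K A) (.type k)
  | arr {Γ k A B} :
      WfEnv S Γ → Γ.Ge k → WfKind S Γ (.type k) →
      HasKind S Γ A (.type k) → HasKind S Γ B (.type k) →
      HasKind S Γ (.arr A B) (.type k)
  | one {Γ k} :
      WfEnv S Γ → Γ.Ge k → WfKind S Γ (.type k) →
      HasKind S Γ (.one k) (.type k)
/-- `HasTy S Γ e k A`: `Γ ⊢ e : A` at mode `k`. -/
inductive HasTy (S : ModeSpec M) : Env M → Tm M → M → Ty M → Prop where
  | var {Γ Γ₀ ΓW i k A} :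
      WfEnv S Γ → Γ.Ge k → HasKind S Γ (A.shift (i + 1) 0) (.type k) →
      Split S Γ Γ₀ ΓW → Γ₀.Single i (.tm k A) → ΓW.Weak S →
      HasTy S Γ (.var i) k (A.shift (i + 1) 0)
  | susp {Γ k l Ψ e A} :
      WfEnv S Γ → Γ.Ge k → HasKind S Γ (.up k l Ψ A) (.type k) →
      HasTy S (Γ.ext Ψ) e l A →
      HasTy S Γ (.susp k l Ψ.len e) k (.up k l Ψ A)
  | store {Γ Γ₁ ΓW m k e A} :
      WfEnv S Γ → Γ.Ge k → HasKind S Γ (.down m k A) (.type k) →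
      Split S Γ Γ₁ ΓW → ΓW.Weak S → Γ₁.Ge m → WfEnv S Γ₁ → HasTy S Γ₁ e m A →
      HasTy S Γ (.store m k e) k (.down m k A)
  | tlam {Γ k K e A} :
      WfEnv S Γ → Γ.Ge k → HasKind S Γ (.all K A) (.type k) →
      HasTy S (some (.ty K) :: Γ) e k A →
      HasTy S Γ (.tlam K e) k (.all K A)
  | lam {Γ k A B e} :
      WfEnv S Γ → Γ.Ge k → HasKind S Γ (.arr A B) (.type k) →
      HasTy S (some (.tm k A) :: Γ) e k (B.shift 1 0) →
      HasTy S Γ (.lam k A e) k (.arr A B)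
  | one {Γ k} :
      WfEnv S Γ → Γ.Ge k → HasKind S Γ (.one k) (.type k) →
      Γ.Weak S →
      HasTy S Γ .one k (.one k)
  | force {Γ Γ₁ Γ₂ m k e σ Ψ A A'} :
      WfEnv S Γ → Γ.Ge k → HasKind S Γ A' (.type k) →
      Split S Γ Γ₁ Γ₂ → WfEnv S Γ₁ → Γ₁.Ge m → WfEnv S (Γ₂.ext Ψ) →
      HasKind S Γ₁ (.up m k Ψ A) (.type m) → HasTy S Γ₁ e m (.up m k Ψ A) →
      HasSbst S Γ₂ σ Ψ → SubTy Ψ.erase σ 0 A A' →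
      HasTy S Γ (.force m k e Ψ.erase σ) k A'
  | load {Γ Γ₁ Γ₂ m n k e f A B} :
      WfEnv S Γ → Γ.Ge k → HasKind S Γ B (.type k) →
      Split S Γ Γ₁ Γ₂ → WfEnv S Γ₁ → Γ₁.Ge n → k ≤ n →
      WfEnv S (some (.tm m A) :: Γ₂) →
      HasKind S Γ₁ (.down m n A) (.type n) → HasTy S Γ₁ e n (.down m n A) →
      HasTy S (some (.tm m A) :: Γ₂) f k (B.shift 1 0) →
      HasTy S Γ (.load m n e f) k B
  | tapp {Γ Γ₁ Γ₂ k K e A B B'} :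
      WfEnv S Γ → Γ.Ge k → HasKind S Γ B' (.type k) →
      Split S Γ Γ₁ Γ₂ → WfEnv S Γ₁ → Γ₁.Ge K.mode → k ≤ K.mode →
      HasKind S Γ (.all K B) (.type k) → HasTy S Γ e k (.all K B) →
      WfKind S Γ₁ K → HasKind S Γ₁ A K →
      SubTy (.consTy .nil K.erase) (.consTy .nil A) 0 B B' →
      HasTy S Γ (.tapp e A) k B'
  | app {Γ Γ₁ Γ₂ k e f A B} :
      WfEnv S Γ → Γ.Ge k → HasKind S Γ B (.type k) →
      Split S Γ Γ₁ Γ₂ → WfEnv S Γ₁ → WfEnv S Γ₂ →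
      HasKind S Γ₁ (.arr A B) (.type k) → HasTy S Γ₁ e k (.arr A B) →
      HasKind S Γ₂ A (.type k) → HasTy S Γ₂ f k A →
      HasTy S Γ (.app e f) k B
/-- `Γ ⊢ σ : Ψ`. -/
inductive HasSbst (S : ModeSpec M) : Env M → Sbst M → Ctx M → Prop where
  | nil {Γ} : WfEnv S Γ → Γ.Weak S → HasSbst S Γ .nil .nil
  | consTy {Γ Γ₁ Γ₂ σ A Ψ K K'} :
      WfEnv S (Γ.ext (.consTy Ψ K)) →
      Split S Γ Γ₁ Γ₂ → Γ₁.Ge K.mode → HasSbst S Γ σ Ψ → WfEnv S Γ₁ →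
      SubKind Ψ.erase σ 0 K K' → WfKind S Γ₁ K' → HasKind S Γ₁ A K' →
      HasSbst S Γ (.consTy σ A) (.consTy Ψ K)
  | consTm {Γ Γ₁ Γ₂ σ k e Ψ A A'} :
      WfEnv S (Γ.ext (.consTm Ψ k A)) →
      Split S Γ Γ₁ Γ₂ → Γ₁.Ge k → WfEnv S Γ₂ → HasSbst S Γ₂ σ Ψ → WfEnv S Γ₁ →
      SubTy Ψ.erase σ 0 A A' → HasKind S Γ₁ A' (.type k) → HasTy S Γ₁ e k A' →
      HasSbst S Γ (.consTm σ k e) (.consTm Ψ k A)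
end

/-! ## Weak normal and neutral forms, normal templates -/

mutual
/-- Weak normal forms. -/
inductive Wnf : Tm M → Prop where
  | susp {k l n a} : NTmpl k a → Wnf (.susp k l n a)
  | store {m k v} : Wnf v → Wnf (.store m k v)
  | tlam {K e} : Wnf (.tlam K e)
  | lam {k A e} : Wnf (.lam k A e)
  | one : Wnf .one
  | neu {q} : Wne q → Wnf q
/-- Weak neutral forms. -/
inductive Wne : Tm M → Prop where
  | var {i} : Wne (.var i)
  | force {m k q δ σ} : Wne q → Wne (.force m k q δ σ)
  | load {m n q e} : Wne q → Wne (.load m n q e)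
  | tapp {q A} : Wne q → Wne (.tapp q A)
  | app {q v} : Wne q → Wnf v → Wne (.app q v)
/-- `NTmpl k a`: `a` is a normal template in the ambient mode `k`. -/
inductive NTmpl : M → Tm M → Prop where
  | var {k i} : NTmpl k (.var i)
  | susp {k l₀ l₁ n a} : NTmpl k a → NTmpl k (.susp l₀ l₁ n a)
  | forceT {k l₀ l₁ a δ σ} : ¬ k ≤ l₀ → NTmpl k a → NTmpl k (.force l₀ l₁ a δ σ)
  | forceE {k m l₁ q δ σ} : k ≤ m → Wne q → NTmpl k (.force m l₁ q δ σ)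
  | storeT {k l₀ l₁ a} : ¬ k ≤ l₀ → NTmpl k a → NTmpl k (.store l₀ l₁ a)
  | storeE {k m l₁ v} : k ≤ m → Wnf v → NTmpl k (.store m l₁ v)
  | loadT {k l₀ l₁ a b} : ¬ k ≤ l₁ → NTmpl k a → NTmpl k b → NTmpl k (.load l₀ l₁ a b)
  | loadE {k l₀ l₁ v b} : k ≤ l₁ → Wnf v → NTmpl k b → NTmpl k (.load l₀ l₁ v b)
  | tlam {k K a} : NTmpl k a → NTmpl k (.tlam K a)
  | tapp {k a A} : NTmpl k a → NTmpl k (.tapp a A)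
  | lam {k l A a} : NTmpl k a → NTmpl k (.lam l A a)
  | app {k a b} : NTmpl k a → NTmpl k b → NTmpl k (.app a b)
  | one {k} : NTmpl k .one
end

/-! ## Small-step semantics -/

mutual
/-- Term evaluation `e ⟶ e'`. -/
inductive Step : Tm M → Tm M → Prop where
  | forceSusp {m k n a δ σ e'} :
      NTmpl m a → SubTm δ σ 0 a e' → Step (.force m k (.susp m k n a) δ σ) e'
  | loadStore {m n v e e'} :
      Wnf v → SubTm (.consTm .nil) (.consTm .nil m v) 0 e e' →
      Step (.load m n (.store m n v) e) e'
  | tbeta {K e A e'} :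
      SubTm (.consTy .nil K.erase) (.consTy .nil A) 0 e e' → Step (.tapp (.tlam K e) A) e'
  | beta {k A e u e'} :
      Wnf u → SubTm (.consTm .nil) (.consTm .nil k u) 0 e e' → Step (.app (.lam k A e) u) e'
  | susp {k l n e e'} : TStep k e e' → Step (.susp k l n e) (.susp k l n e')
  | force {m k e e' δ σ} : Step e e' → Step (.force m k e δ σ) (.force m k e' δ σ)
  | store {m k e e'} : Step e e' → Step (.store m k e) (.store m k e')
  | load {m n e e' f} : Step e e' → Step (.load m n e f) (.load m n e' f)
  | tapp {e e' A} : Step e e' → Step (.tapp e A) (.tapp e' A)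
  | appL {e e' f} : Step e e' → Step (.app e f) (.app e' f)
  | appR {v f f'} : Wnf v → Step f f' → Step (.app v f) (.app v f')
/-- `TStep m e e'`: template reduction of `e` to `e'` under the ambient mode `m`. -/
inductive TStep : M → Tm M → Tm M → Prop where
  | susp {m k l n e e'} : TStep m e e' → TStep m (.susp k l n e) (.susp k l n e')
  | forceT {m n k e e' δ σ} : ¬ m ≤ n → TStep m e e' →
      TStep m (.force n k e δ σ) (.force n k e' δ σ)
  | forceE {m n k e e' δ σ} : m ≤ n → Step e e' →
      TStep m (.force n k e δ σ) (.force n k e' δ σ)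
  | forceSusp {m n k b a δ σ e'} : m ≤ n → NTmpl n a → SubTm δ σ 0 a e' →
      TStep m (.force n k (.susp n k b a) δ σ) e'
  | storeT {m n k e e'} : ¬ m ≤ n → TStep m e e' → TStep m (.store n k e) (.store n k e')
  | storeE {m n k e e'} : m ≤ n → Step e e' → TStep m (.store n k e) (.store n k e')
  | loadT {m n l e e' f} : ¬ m ≤ l → TStep m e e' → TStep m (.load n l e f) (.load n l e' f)
  | loadE {m n l e e' f} : m ≤ l → Step e e' → TStep m (.load n l e f) (.load n l e' f)
  | loadBodyT {m n l a f f'} : ¬ m ≤ l → NTmpl m a → TStep m f f' →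
      TStep m (.load n l a f) (.load n l a f')
  | loadBodyE {m n l v f f'} : m ≤ l → Wnf v → TStep m f f' →
      TStep m (.load n l v f) (.load n l v f')
  | tlam {m K e e'} : TStep m e e' → TStep m (.tlam K e) (.tlam K e')
  | tapp {m e e' A} : TStep m e e' → TStep m (.tapp e A) (.tapp e' A)
  | lam {m k A e e'} : TStep m e e' → TStep m (.lam k A e) (.lam k A e')
  | appL {m e e' f} : TStep m e e' → TStep m (.app e f) (.app e' f)
  | appR {m a f f'} : NTmpl m a → TStep m f f' → TStep m (.app a f) (.app a f')
end

end Judgements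

end Elevator

namespace Elevator

universe u

variable {M : Type u}

-- Preservation is an induction on the reduction with inversion of typing. Reduction never enters a
-- type, a kind or the substitution of a `force`, which are the parts that a result type may depend
-- on; so in a congruence case the typing rule is reapplied with one premise exchanged. Every redex
-- is an instance of one substitution theorem: if `s` sends the variables of `Θ₀` to well-typed
-- expressions over `Θ` and spends the resources of `Θ` legally (`Good`), then judgements over `Θ₀`
-- become judgements over `Θ` (`HasKind.subst`, `HasTy.subst` and their companions).
--
-- The first difficulty is that hereditary substitution is a partial relation. It must be shown to
-- be defined on well-kinded expressions, and to satisfy `[σ][τ]X = [[σ]τ][σ]X`, because the types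
-- of `force` and of a type application are themselves substitution instances. Both facts follow by
-- a lexicographic induction, outside on a bound for the sizes of the erased kinds annotated on the
-- substitutions, inside on the kinding derivation. When the head of a `force` becomes a template of
-- kind `up m l ψ κ`, the new substitution carries kinds occurring in `ψ`, so the bound drops
-- strictly. Only erased kinds matter here, not modes or resources. The argument therefore takes
-- place on one type `Raw` of trees, which encodes all six syntactic classes, with a simple kinding
-- `SK`: `SK.exists_rsub` is totality and `SK.comp` is commutation. `RSub.reflects`, injectivity of
-- the encoding and functionality of substitution carry the results back to the original syntax.
--
-- The second difficulty is the substructural bookkeeping. An expression of mode `k` is typed in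
-- declarations of mode at least `k`. Hence if the image of a variable `i` uses a declaration `p`,
-- then `p` has at least the mode of `i`, and by monotonicity of the signature every structural rule
-- available at `i` is available at `p`. This is why any split of `Θ₀` is mirrored by a split of `Θ`
-- (`Good.exists_split`). Types are unproblematic: kinding survives the removal of term variables
-- (`HasKind.drop`) and is monotone in the environment (`HasKind.weaken`).
--
-- The typed substitution theorem repeats the double induction: `TySubst S N` is its kinding part
-- for annotations of size at most `N`, and the splice case is the only one that falls back on a
-- smaller `N`.

/-! ## A uniform raw syntax -/

/-- Constructor labels of the uniform syntax. -/
inductive Lab (M : Type u) : Type u where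
  | unit : Lab M
  | kType : M → Lab M
  | kUp : M → M → Lab M
  | one : M → Lab M
  | thunk : Lab M
  | tUp : M → M → Lab M
  | down : M → M → Lab M
  | all : Lab M
  | arr : Lab M
  | eOne : Lab M
  | susp : M → M → Lab M
  | eForce : M → M → SCtx M → Lab M
  | store : M → M → Lab M
  | load : M → M → Lab M
  | tlam : Lab M
  | tapp : Lab M
  | lam : M → Lab M
  | app : Lab M
  | cNil : Lab M
  | cTy : Lab M
  | cTm : M → Lab M
  | sNil : Lab M
  | sTy : Lab M
  | sTm : M → Lab M

/-- Uniform syntax trees: in `node l n a b` the second child `b` lives under `n` binders. -/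
inductive Raw (M : Type u) : Type u where
  | tvar : ℕ → Raw M
  | evar : ℕ → Raw M
  | leaf : Lab M → Raw M
  | node : Lab M → ℕ → Raw M → Raw M → Raw M
  | nforce : Raw M → Raw M → Raw M

namespace Raw

/-- A template binding `n` variables. -/
def thunk (n : ℕ) (A : Raw M) : Raw M := .node .thunk n (.leaf .unit) A

/-- Neutral trees. -/
def IsNeu : Raw M → Prop
  | .tvar _ => True
  | .nforce _ _ => True
  | _ => False

def shift (n : ℕ) : ℕ → Raw M → Raw M
  | d, .tvar i => .tvar (if i < d then i else i + n)
  | d, .evar i => .evar (if i < d then i else i + n)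
  | _, .leaf l => .leaf l
  | d, .node l b x y => .node l b (shift n d x) (shift n (d + b) y)
  | d, .nforce P τ => .nforce (shift n d P) (shift n d τ)

@[simp] theorem isNeu_shift {n d : ℕ} {X : Raw M} : (X.shift n d).IsNeu ↔ X.IsNeu := by
  cases X <;> simp [shift, IsNeu]

@[simp] theorem shift_thunk {n d b : ℕ} {X : Raw M} :
    (thunk b X).shift n d = thunk b (X.shift n (d + b)) := rfl

theorem not_isNeu_thunk {b : ℕ} {X : Raw M} : ¬ (thunk b X).IsNeu := id

theorem shift_zero (X : Raw M) : ∀ d, X.shift 0 d = X := by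
  induction X <;> intro d <;> simp_all [shift]

theorem shift_comm (n m : ℕ) (X : Raw M) :
    ∀ c d, c ≤ d → (X.shift n d).shift m c = (X.shift m c).shift n (d + m) := by
  induction X with
  | tvar i => intro c d h; simp only [shift]; congr 1; split_ifs <;> omega
  | evar i => intro c d h; simp only [shift]; congr 1; split_ifs <;> omega
  | leaf l => intro c d h; rfl
  | node l b x y ihx ihy =>
    intro c d h
    simp only [shift, ihx c d h, ihy (c + b) (d + b) (by omega)]
    congr 2; omega
  | nforce P τ ihP ihτ => intro c d h; simp only [shift, ihP c d h, ihτ c d h]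

theorem shift_shift (n m : ℕ) (X : Raw M) :
    ∀ c d, d ≤ c → c ≤ d + n → (X.shift n d).shift m c = X.shift (n + m) d := by
  induction X with
  | tvar i => intro c d h h'; simp only [shift]; congr 1; split_ifs <;> omega
  | evar i => intro c d h h'; simp only [shift]; congr 1; split_ifs <;> omega
  | leaf l => intro c d h h'; rfl
  | node l b x y ihx ihy =>
    intro c d h h'
    simp only [shift, ihx c d h h', ihy (c + b) (d + b) (by omega) (by omega)]
  | nforce P τ ihP ihτ => intro c d h h'; simp only [shift, ihP c d h h', ihτ c d h h']

end Raw

-- Annotated substitutions and hereditary substitution on trees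

/-- A substitution annotated with the kinds of its type components. -/
abbrev ASub (M : Type u) : Type u := List (Raw M × Option (SKind M))

/-- Apply a shift to all components. -/
def ASub.shift (n c : ℕ) (s : ASub M) : ASub M := s.map fun p => (p.1.shift n c, p.2)

@[simp] theorem ASub.length_shift {n c : ℕ} {s : ASub M} : (s.shift n c).length = s.length := by
  simp [ASub.shift]

theorem ASub.getElem?_shift {n c i : ℕ} {s : ASub M} {X v} (h : s[i]? = some (X, v)) :
    (s.shift n c)[i]? = some (X.shift n c, v) := by
  simp [ASub.shift, h]

/-- `Zip ψ τ s`: the raw substitution `τ` for the names of `ψ` has the components `s`. -/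
inductive Zip : SCtx M → Raw M → ASub M → Prop where
  | nil : Zip .nil (.leaf .sNil) []
  | consTy {ψ τ s A κ} : Zip ψ τ s →
      Zip (.consTy ψ κ) (.node .sTy 0 τ A) ((A, some κ) :: s)
  | consTm {ψ τ s k e} : Zip ψ τ s →
      Zip (.consTm ψ) (.node (.sTm k) 0 τ e) ((e, none) :: s)

theorem Zip.det {ψ : SCtx M} {τ s s'} (h : Zip ψ τ s) (h' : Zip ψ τ s') : s = s' := by
  induction h generalizing s' <;> cases h' <;> simp_all
  all_goals rename_i ih _ h; exact ih h

theorem Zip.shift {ψ : SCtx M} {τ s} (h : Zip ψ τ s) (n c : ℕ) :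
    Zip ψ (τ.shift n c) (s.shift n c) := by
  induction h with
  | nil => exact .nil
  | consTy _ ih => exact .consTy ih
  | consTm _ ih => exact .consTm ih

/-- Hereditary substitution on uniform trees; the last argument is the kind annotation of a
neutral tree whose head has been replaced. -/
inductive RSub : ASub M → ℕ → Raw M → Raw M → Option (SKind M) → Prop where
  | tbound {s d i} : i < d → RSub s d (.tvar i) (.tvar i) none
  | thit {s d i A κ} : d ≤ i → s[i - d]? = some (A, some κ) →
      RSub s d (.tvar i) (A.shift d 0) (some κ)
  | tfree {s d i} : d + s.length ≤ i → RSub s d (.tvar i) (.tvar (i - s.length)) none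
  | ebound {s d i} : i < d → RSub s d (.evar i) (.evar i) none
  | ehit {s d i e} : d ≤ i → s[i - d]? = some (e, none) →
      RSub s d (.evar i) (e.shift d 0) none
  | efree {s d i} : d + s.length ≤ i → RSub s d (.evar i) (.evar (i - s.length)) none
  | leaf {s d l} : RSub s d (.leaf l) (.leaf l) none
  | node {s d l n a a' b b' o o'} : RSub s d a a' o → RSub s (d + n) b b' o' →
      RSub s d (.node l n a b) (.node l n a' b') none
  -- This rule asks for more than `SubNeu.splice`: the template must bind as many names as `τ'` has
  -- components, and `τ'` must have the shape prescribed by `ψ`. On well-kinded expressions these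
  -- demands are automatic.
  | splice {s d P A m l ψ κ τ τ' o s' A' o'} :
      RSub s d P (.thunk s'.length A) (some (.up m l ψ κ)) → RSub s d τ τ' o →
      Zip ψ τ' s' → RSub s' 0 A A' o' → RSub s d (.nforce P τ) A' (some κ)
  | stuck {s d P P' o τ τ' o'} : RSub s d P P' o → P'.IsNeu → RSub s d τ τ' o' →
      RSub s d (.nforce P τ) (.nforce P' τ') none

theorem lt_of_getElem?_eq_some {α : Type*} {l : List α} {i : ℕ} {x : α} (h : l[i]? = some x) :
    i < l.length := by
  by_contra hc
  simp [List.getElem?_eq_none (not_lt.mp hc)] at h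

/-- A template is not neutral, so `splice` and `stuck` exclude each other. Two splices agree because
the annotation of the head determines `ψ`, and `ψ` and `τ'` determine the components. -/
theorem RSub.det {s : ASub M} {d X Y o} (h : RSub s d X Y o) :
    ∀ {Y' o'}, RSub s d X Y' o' → Y = Y' ∧ o = o' := by
  induction h with
  | tbound hi =>
    intro Y' o' h'
    cases h' <;> first | exact ⟨rfl, rfl⟩ | omega
  | thit hi hs =>
    intro Y' o' h'
    have := lt_of_getElem?_eq_some hs
    cases h' <;> first | omega | simp_all
  | tfree hi =>
    intro Y' o' h'
    cases h' with
    | tbound => omega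
    | thit h1 h2 => have := lt_of_getElem?_eq_some h2; omega
    | tfree => exact ⟨rfl, rfl⟩
  | ebound hi =>
    intro Y' o' h'
    cases h' <;> first | exact ⟨rfl, rfl⟩ | omega
  | ehit hi hs =>
    intro Y' o' h'
    have := lt_of_getElem?_eq_some hs
    cases h' <;> first | omega | simp_all
  | efree hi =>
    intro Y' o' h'
    cases h' with
    | ebound => omega
    | ehit h1 h2 => have := lt_of_getElem?_eq_some h2; omega
    | efree => exact ⟨rfl, rfl⟩
  | leaf => intro Y' o' h'; cases h'; exact ⟨rfl, rfl⟩
  | node _ _ iha ihb =>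
    intro Y' o' h'
    cases h' with
    | node ha hb => simp [(iha ha).1, (ihb hb).1]
  | splice _ _ hz _ ihP ihτ ihA =>
    intro Y' o' h'
    cases h' with
    | splice hP' hτ' hz' hA' =>
      obtain ⟨h1, h2⟩ := ihP hP'
      simp only [Raw.thunk, Raw.node.injEq, Option.some.injEq, SKind.up.injEq] at h1 h2
      obtain ⟨-, -, h23, h24⟩ := h2
      obtain ⟨-, -, -, rfl⟩ := h1
      subst h23 h24
      obtain ⟨rfl, -⟩ := ihτ hτ'
      obtain rfl := hz.det hz'
      exact ⟨(ihA hA').1, rfl⟩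
    | stuck hP' hn _ =>
      obtain ⟨rfl, -⟩ := ihP hP'
      exact absurd hn Raw.not_isNeu_thunk
  | stuck _ hn _ ihP ihτ =>
    intro Y' o' h'
    cases h' with
    | splice hP' hτ' hz' hA' =>
      obtain ⟨rfl, -⟩ := ihP hP'
      exact absurd hn Raw.not_isNeu_thunk
    | stuck hP' hn' hτ' => simp [(ihP hP').1, (ihτ hτ').1]

theorem RSub.cast {s : ASub M} {d d' X X' Y Y' o} (h : RSub s d X Y o) (hd : d = d')
    (hX : X = X') (hY : Y = Y') : RSub s d' X' Y' o := by
  subst hd hX hY; exact h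

/-- Shifting the result beyond the bound variables. -/
theorem RSub.shift_ge {s : ASub M} {d X Y o} (h : RSub s d X Y o) (n : ℕ) :
    ∀ c, d ≤ c → RSub (s.shift n (c - d)) d (X.shift n (c + s.length)) (Y.shift n c) o := by
  induction h with
  | tbound hi =>
    intro c hc
    simp only [Raw.shift]
    rw [if_pos (by omega), if_pos (by omega)]
    exact .tbound hi
  | @thit s d i A κ hi hs =>
    intro c hc
    have := lt_of_getElem?_eq_some hs
    refine RSub.cast (.thit hi (ASub.getElem?_shift hs)) rfl ?_ ?_
    · simp only [Raw.shift]; rw [if_pos (by omega)]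
    · rw [Raw.shift_comm _ _ _ _ _ (Nat.zero_le _), Nat.sub_add_cancel hc]
  | @tfree s d i hi =>
    intro c hc
    refine RSub.cast (.tfree (i := if i < c + s.length then i else i + n) ?_) rfl rfl ?_
    · simp only [ASub.length_shift]; split_ifs <;> omega
    · simp only [Raw.shift, ASub.length_shift]; congr 1; split_ifs <;> omega
  | ebound hi =>
    intro c hc
    simp only [Raw.shift]
    rw [if_pos (by omega), if_pos (by omega)]
    exact .ebound hi
  | @ehit s d i A hi hs =>
    intro c hc
    have := lt_of_getElem?_eq_some hs
    refine RSub.cast (.ehit hi (ASub.getElem?_shift hs)) rfl ?_ ?_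
    · simp only [Raw.shift]; rw [if_pos (by omega)]
    · rw [Raw.shift_comm _ _ _ _ _ (Nat.zero_le _), Nat.sub_add_cancel hc]
  | @efree s d i hi =>
    intro c hc
    refine RSub.cast (.efree (i := if i < c + s.length then i else i + n) ?_) rfl rfl ?_
    · simp only [ASub.length_shift]; split_ifs <;> omega
    · simp only [Raw.shift, ASub.length_shift]; congr 1; split_ifs <;> omega
  | leaf => intro c hc; exact .leaf
  | @node s d l k a a' b b' o o' _ _ iha ihb =>
    intro c hc
    refine .node (o' := o') (iha c hc) ?_
    have := ihb (c + k) (by omega)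
    rw [show c + k - (d + k) = c - d by omega] at this
    exact this.cast rfl (by congr 1; omega) rfl
  | @splice s d P A m l ψ κ τ τ' o s' A' o' _ _ hz _ ihP ihτ ihA =>
    intro c hc
    have := ihP c hc
    refine .splice (m := m) (l := l) (s' := s'.shift n c) (A := A.shift n (c + s'.length)) ?_ (ihτ c hc)
      (hz.shift n c) (ihA c (Nat.zero_le _))
    simpa using this
  | stuck _ hn _ ihP ihτ =>
    intro c hc
    exact .stuck (ihP c hc) (Raw.isNeu_shift.mpr hn) (ihτ c hc)

/-- Shifting among the bound variables. -/
theorem RSub.shift_le {s : ASub M} {d X Y o} (h : RSub s d X Y o) (n : ℕ) :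
    ∀ c, c ≤ d → RSub s (d + n) (X.shift n c) (Y.shift n c) o := by
  induction h with
  | @tbound s d i hi =>
    intro c hc
    simp only [Raw.shift]
    exact .tbound (by split_ifs <;> omega)
  | @thit s d i A κ hi hs =>
    intro c hc
    refine RSub.cast (.thit (i := i + n) (d := d + n) (by omega)
      (by rw [show i + n - (d + n) = i - d by omega]; exact hs)) rfl ?_ ?_
    · simp only [Raw.shift]; rw [if_neg (by omega)]
    · rw [Raw.shift_shift _ _ _ _ _ (Nat.zero_le _) (by omega)]
  | @tfree s d i hi =>
    intro c hc
    refine RSub.cast (.tfree (i := i + n) (by omega)) rfl ?_ ?_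
    · simp only [Raw.shift]; rw [if_neg (by omega)]
    · simp only [Raw.shift]; congr 1; split_ifs <;> omega
  | @ebound s d i hi =>
    intro c hc
    simp only [Raw.shift]
    exact .ebound (by split_ifs <;> omega)
  | @ehit s d i A hi hs =>
    intro c hc
    refine RSub.cast (.ehit (i := i + n) (d := d + n) (by omega)
      (by rw [show i + n - (d + n) = i - d by omega]; exact hs)) rfl ?_ ?_
    · simp only [Raw.shift]; rw [if_neg (by omega)]
    · rw [Raw.shift_shift _ _ _ _ _ (Nat.zero_le _) (by omega)]
  | @efree s d i hi =>
    intro c hc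
    refine RSub.cast (.efree (i := i + n) (by omega)) rfl ?_ ?_
    · simp only [Raw.shift]; rw [if_neg (by omega)]
    · simp only [Raw.shift]; congr 1; split_ifs <;> omega
  | leaf => intro c hc; exact .leaf
  | @node s d l k a a' b b' o o' _ _ iha ihb =>
    intro c hc
    exact .node (iha c hc) ((ihb (c + k) (by omega)).cast (by omega) rfl rfl)
  | @splice s d P A m l ψ κ τ τ' o s' A' o' _ _ hz hA ihP ihτ _ =>
    intro c hc
    -- Inside the template the substitution starts again at depth 0, so there the insertion point
    -- lies beyond the bound variables: `shift_ge` applies rather than the induction hypothesis.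
    refine .splice (m := m) (l := l) (s' := s'.shift n c) (A := A.shift n (c + s'.length)) ?_ (ihτ c hc)
      (hz.shift n c) (hA.shift_ge n c (Nat.zero_le _))
    simpa using ihP c hc
  | stuck _ hn _ ihP ihτ =>
    intro c hc
    exact .stuck (ihP c hc) (Raw.isNeu_shift.mpr hn) (ihτ c hc)

/-- Extending a substitution by a component for a variable that does not occur. -/
theorem RSub.cons {s : ASub M} {d X Y o} (h : RSub s d X Y o) (x : Raw M × Option (SKind M)) :
    RSub (x :: s) d (X.shift 1 d) Y o := by
  induction h with
  | tbound hi => simp only [Raw.shift]; rw [if_pos hi]; exact .tbound hi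
  | @thit s d i A κ hi hs =>
    simp only [Raw.shift]; rw [if_neg (by omega)]
    refine .thit (by omega) ?_
    rw [show i + 1 - d = i - d + 1 by omega]; simpa using hs
  | @tfree s d i hi =>
    simp only [Raw.shift]; rw [if_neg (by omega)]
    refine RSub.cast (.tfree (by simp only [List.length_cons]; omega)) rfl rfl ?_
    simp only [List.length_cons]; congr 1; omega
  | ebound hi => simp only [Raw.shift]; rw [if_pos hi]; exact .ebound hi
  | @ehit s d i A hi hs =>
    simp only [Raw.shift]; rw [if_neg (by omega)]
    refine .ehit (by omega) ?_
    rw [show i + 1 - d = i - d + 1 by omega]; simpa using hs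
  | @efree s d i hi =>
    simp only [Raw.shift]; rw [if_neg (by omega)]
    refine RSub.cast (.efree (by simp only [List.length_cons]; omega)) rfl rfl ?_
    simp only [List.length_cons]; congr 1; omega
  | leaf => exact .leaf
  | node _ _ iha ihb => exact .node iha ihb
  | splice _ _ hz hA ihP ihτ _ => exact .splice ihP ihτ hz hA
  | stuck _ hn _ ihP ihτ => exact .stuck ihP hn ihτ

/-! ## Simple kinding -/

/-- The number of names of an erased context. -/
def SCtx.len : SCtx M → ℕ
  | .nil => 0
  | .consTy ψ _ => ψ.len + 1
  | .consTm ψ => ψ.len + 1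

/-- Simple environments: a type variable with its kind, a term variable, or nothing. -/
abbrev SEnv (M : Type u) : Type u := ℕ → Option (Option (SKind M))

def SEnv.cons (v : Option (Option (SKind M))) (φ : SEnv M) : SEnv M
  | 0 => v
  | i + 1 => φ i

def SEnv.ext (φ : SEnv M) : SCtx M → SEnv M
  | .nil => φ
  | .consTy ψ κ => SEnv.cons (some (some κ)) (SEnv.ext φ ψ)
  | .consTm ψ => SEnv.cons (some none) (SEnv.ext φ ψ)

def SEnv.Le (φ φ' : SEnv M) : Prop := ∀ i v, φ i = some v → φ' i = some v

theorem SEnv.Le.cons {φ φ' : SEnv M} (h : φ.Le φ') (v) : (SEnv.cons v φ).Le (SEnv.cons v φ') := by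
  intro i w hw
  cases i with
  | zero => exact hw
  | succ i => exact h i w hw

theorem SEnv.Le.ext {φ φ' : SEnv M} (h : φ.Le φ') (ψ : SCtx M) : (φ.ext ψ).Le (φ'.ext ψ) := by
  match ψ with
  | .nil => exact h
  | .consTy ψ κ => exact (h.ext ψ).cons _
  | .consTm ψ => exact (h.ext ψ).cons _

/-- Simple sorts: types of a kind, substitutions for an erased context, and everything else. -/
inductive Srt (M : Type u) : Type u where
  | kd : SKind M → Srt M
  | sb : SCtx M → Srt M
  | misc : Srt M

/-- The sorts at which arbitrary constructors are allowed. -/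
def Srt.Plain : Srt M → Prop
  | .kd (.type _) => True
  | .misc => True
  | _ => False

/-- The sort of a declaration of a simple environment. -/
def Srt.decl : Option (SKind M) → Srt M
  | some κ => .kd κ
  | none => .misc

/-- Simple kinding. -/
inductive SK : SEnv M → Raw M → Srt M → Prop where
  | tvar {φ i κ} : φ i = some (some κ) → SK φ (.tvar i) (.kd κ)
  | evar {φ i} : φ i = some none → SK φ (.evar i) .misc
  | leaf {φ l t} : t.Plain → SK φ (.leaf l) t
  | node {φ : SEnv M} {l δ a b t₁ t₂ t} : t.Plain → SK φ a t₁ → SK (φ.ext δ) b t₂ →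
      SK φ (.node l δ.len a b) t
  | thunk {φ : SEnv M} {ψ A κ m l} : SK (φ.ext ψ) A (.kd κ) →
      SK φ (.thunk ψ.len A) (.kd (.up m l ψ κ))
  | sbNil {φ} : SK φ (.leaf .sNil) (.sb .nil)
  | sbTy {φ τ A ψ κ} : SK φ τ (.sb ψ) → SK φ A (.kd κ) →
      SK φ (.node .sTy 0 τ A) (.sb (.consTy ψ κ))
  | sbTm {φ τ k e ψ} : SK φ τ (.sb ψ) → SK φ e .misc →
      SK φ (.node (.sTm k) 0 τ e) (.sb (.consTm ψ))
  | nforce {φ P m l ψ κ τ} : SK φ P (.kd (.up m l ψ κ)) → P.IsNeu → SK φ τ (.sb ψ) →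
      SK φ (.nforce P τ) (.kd κ)

/-- Insertion of `n` positions at depth `c` is compatible with the simple environments. -/
def SEnv.Ins (n c : ℕ) (φ φ' : SEnv M) : Prop :=
  ∀ i v, φ i = some v → φ' (if i < c then i else i + n) = some v

theorem SEnv.Ins.cons {n c} {φ φ' : SEnv M} (h : SEnv.Ins n c φ φ') (v) :
    SEnv.Ins n (c + 1) (SEnv.cons v φ) (SEnv.cons v φ') := by
  intro i w hw
  cases i with
  | zero => exact hw
  | succ i =>
    have := h i w hw
    split_ifs with hc
    · rw [if_pos (by omega)] at this; exact this
    · rw [if_neg (by omega)] at this; rw [show i + 1 + n = i + n + 1 by omega]; exact this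

theorem SEnv.Ins.ext {n c} {φ φ' : SEnv M} (h : SEnv.Ins n c φ φ') (ψ : SCtx M) :
    SEnv.Ins n (c + ψ.len) (φ.ext ψ) (φ'.ext ψ) := by
  match ψ with
  | .nil => exact h
  | .consTy ψ κ => exact (h.ext ψ).cons _
  | .consTm ψ => exact (h.ext ψ).cons _

theorem SK.shift {φ : SEnv M} {X t} (h : SK φ X t) :
    ∀ {n c φ'}, SEnv.Ins n c φ φ' → SK φ' (X.shift n c) t := by
  induction h with
  | tvar h => intro n c φ' hi; exact .tvar (hi _ _ h)
  | evar h => intro n c φ' hi; exact .evar (hi _ _ h)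
  | leaf h => intro n c φ' hi; exact .leaf h
  | node h _ _ iha ihb => intro n c φ' hi; exact .node h (iha hi) (ihb (hi.ext _))
  | thunk _ ih => intro n c φ' hi; exact .thunk (ih (hi.ext _))
  | sbNil => intro n c φ' hi; exact .sbNil
  | sbTy _ _ ih ih' => intro n c φ' hi; exact .sbTy (ih hi) (ih' hi)
  | sbTm _ _ ih ih' => intro n c φ' hi; exact .sbTm (ih hi) (ih' hi)
  | nforce _ hn _ ih ih' =>
    intro n c φ' hi; exact .nforce (ih hi) (Raw.isNeu_shift.mpr hn) (ih' hi)

theorem SK.mono {φ φ' : SEnv M} {X t} (h : SK φ X t) (hl : φ.Le φ') : SK φ' X t := by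
  have := h.shift (n := 0) (c := 0) (φ' := φ') (fun i v hv => by simpa using hl i v hv)
  rwa [Raw.shift_zero] at this

theorem SEnv.Ins.one (v) (φ : SEnv M) : SEnv.Ins 1 0 φ (SEnv.cons v φ) := fun _ _ h => h

/-- Substituting for variables that do not occur. -/
theorem SK.rsub_shift {φ : SEnv M} {X t} (h : SK φ X t) :
    ∀ (s : ASub M) (d : ℕ), RSub s d (X.shift s.length d) X none := by
  induction h with
  | @tvar φ i κ h =>
    intro s d
    simp only [Raw.shift]
    split_ifs with hi
    · exact .tbound hi
    · exact RSub.cast (.tfree (by omega)) rfl rfl (by congr 1; omega)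
  | @evar φ i h =>
    intro s d
    simp only [Raw.shift]
    split_ifs with hi
    · exact .ebound hi
    · exact RSub.cast (.efree (by omega)) rfl rfl (by congr 1; omega)
  | leaf h => intro s d; exact .leaf
  | node h _ _ iha ihb => intro s d; exact .node (iha _ _) (ihb _ _)
  | thunk _ ih => intro s d; exact .node .leaf (ih _ _)
  | sbNil => intro s d; exact .leaf
  | sbTy _ _ ih ih' => intro s d; exact .node (ih _ _) (ih' _ _)
  | sbTm _ _ ih ih' => intro s d; exact .node (ih _ _) (ih' _ _)
  | nforce _ hn _ ih ih' => intro s d; exact .stuck (ih _ _) hn (ih' _ _)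

-- Simply kinded substitutions and totality of hereditary substitution

/-- The substitution `s` at depth `d` maps the variables of `φ₀` to trees over `φ`. -/
def SOK (φ₀ φ : SEnv M) (s : ASub M) (d : ℕ) : Prop :=
  ∀ i v, φ₀ i = some v →
    (i < d ∧ φ i = some v) ∨
    (∃ X, d ≤ i ∧ s[i - d]? = some (X, v) ∧ SK φ (X.shift d 0) (.decl v)) ∨
    (d + s.length ≤ i ∧ φ (i - s.length) = some v)

theorem SOK.cons {φ₀ φ : SEnv M} {s d} (h : SOK φ₀ φ s d) (w) :
    SOK (SEnv.cons w φ₀) (SEnv.cons w φ) s (d + 1) := by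
  intro i v hv
  cases i with
  | zero => exact .inl ⟨by omega, hv⟩
  | succ i =>
    rcases h i v hv with ⟨h1, h2⟩ | ⟨X, h1, h2, h3⟩ | ⟨h1, h2⟩
    · exact .inl ⟨by omega, h2⟩
    · refine .inr (.inl ⟨X, by omega, by rw [Nat.add_sub_add_right]; exact h2, ?_⟩)
      rw [← Raw.shift_shift d 1 X 0 0 le_rfl (Nat.zero_le _)]
      exact h3.shift (SEnv.Ins.one w φ)
    · refine .inr (.inr ⟨by omega, ?_⟩)
      rw [show i + 1 - s.length = (i - s.length) + 1 by omega]; exact h2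

theorem SOK.ext {φ₀ φ : SEnv M} {s d} (h : SOK φ₀ φ s d) (ψ : SCtx M) :
    SOK (φ₀.ext ψ) (φ.ext ψ) s (d + ψ.len) := by
  match ψ with
  | .nil => exact h
  | .consTy ψ κ => exact (h.ext ψ).cons _
  | .consTm ψ => exact (h.ext ψ).cons _

theorem Zip.length {ψ : SCtx M} {τ s} (h : Zip ψ τ s) : s.length = ψ.len := by
  induction h <;> simp_all [SCtx.len]

/-- Links a substitution as a tree with a substitution as a list of components: the names of `ψ` go
to trees over `φ`, and all further variables go to themselves. A splice needs this to continue with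
`τ'` as its substitution. -/
theorem SK.exists_zip {φ : SEnv M} {τ t} (h : SK φ τ t) :
    ∀ {ψ}, t = .sb ψ → ∃ s, Zip ψ τ s ∧ SOK (φ.ext ψ) φ s 0 := by
  induction h with
  | tvar => rintro _ ⟨⟩
  | evar => rintro _ ⟨⟩
  | leaf h => rintro _ rfl; cases h
  | node h => rintro _ rfl; cases h
  | thunk => rintro _ ⟨⟩
  | nforce => rintro _ ⟨⟩
  | sbNil =>
    rintro _ ⟨⟩
    exact ⟨[], .nil, fun i v hv => .inr (.inr ⟨by simp, hv⟩)⟩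
  | @sbTy φ τ A ψ κ _ hA ih _ =>
    rintro _ ⟨⟩
    obtain ⟨s, hz, hs⟩ := ih rfl
    refine ⟨_, .consTy hz, fun i v hv => ?_⟩
    cases i with
    | zero =>
      obtain rfl : some κ = v := by simpa [SEnv.ext, SEnv.cons] using hv
      exact .inr (.inl ⟨A, le_rfl, rfl, by rwa [Raw.shift_zero]⟩)
    | succ i =>
      rcases hs i v hv with ⟨h1, h2⟩ | ⟨X, h1, h2, h3⟩ | ⟨h1, h2⟩
      · omega
      · exact .inr (.inl ⟨X, by omega, by simpa using h2, h3⟩)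
      · exact .inr (.inr ⟨by simp only [List.length_cons]; omega, by simpa using h2⟩)
  | @sbTm φ τ k e ψ _ hA ih _ =>
    rintro _ ⟨⟩
    obtain ⟨s, hz, hs⟩ := ih rfl
    refine ⟨_, .consTm hz, fun i v hv => ?_⟩
    cases i with
    | zero =>
      obtain rfl : none = v := by simpa [SEnv.ext, SEnv.cons] using hv
      exact .inr (.inl ⟨e, le_rfl, rfl, by rwa [Raw.shift_zero]⟩)
    | succ i =>
      rcases hs i v hv with ⟨h1, h2⟩ | ⟨X, h1, h2, h3⟩ | ⟨h1, h2⟩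
      · omega
      · exact .inr (.inl ⟨X, by omega, by simpa using h2, h3⟩)
      · exact .inr (.inr ⟨by simp only [List.length_cons]; omega, by simpa using h2⟩)

/-- All kind annotations have size at most `N`. -/
def ASub.Bnd (N : ℕ) (s : ASub M) : Prop := ∀ X κ, (X, some κ) ∈ s → sizeOf κ ≤ N

/-- The annotations are the kinds declared in `ψ`. Since `ψ` is a proper part of `up m l ψ κ`, this
is the descent behind every termination argument below. -/
theorem Zip.bnd {ψ : SCtx M} {τ s} (h : Zip ψ τ s) : s.Bnd (sizeOf ψ) := by
  induction h with
  | nil => intro X κ h; simp at h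
  | @consTy ψ τ s A κ _ ih =>
    intro X κ' h'
    rcases List.mem_cons.mp h' with h' | h'
    · obtain ⟨-, h2⟩ := Prod.mk.inj h'; obtain rfl := Option.some.inj h2; simp
    · have := ih X κ' h'; simp; omega
  | @consTm ψ τ s k e _ ih =>
    intro X κ' h'
    rcases List.mem_cons.mp h' with h' | h'
    · obtain ⟨-, h2⟩ := Prod.mk.inj h'; cases h2
    · have := ih X κ' h'; simp; omega

/-- Canonical forms at contextual kinds: the unrestricted constructors of `SK` are confined to plain
sorts, which leaves only templates and neutral trees. -/
theorem SK.eq_thunk {φ : SEnv M} {X m l ψ κ} (h : SK φ X (.kd (.up m l ψ κ))) (hn : ¬ X.IsNeu) :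
    ∃ A, X = .thunk ψ.len A ∧ SK (φ.ext ψ) A (.kd κ) := by
  cases h with
  | tvar => exact absurd trivial hn
  | leaf h => cases h
  | node h => cases h
  | thunk h => exact ⟨_, rfl, h⟩
  | nforce => exact absurd trivial hn

/-- Totality of hereditary substitution on simply kinded trees. -/
theorem SK.exists_rsub (N : ℕ) : ∀ {φ₀ : SEnv M} {X t}, SK φ₀ X t →
    ∀ {φ s d}, s.Bnd N → SOK φ₀ φ s d →
    ∃ Y o, RSub s d X Y o ∧ SK φ Y t ∧ (∀ κ, o = some κ → t = .kd κ ∧ sizeOf κ ≤ N) ∧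
      (X.IsNeu → ¬ Y.IsNeu → o ≠ none) := by
  -- The last two clauses of the conclusion strengthen the induction: an annotation is the kind of
  -- the tree and respects the bound `N`, and a neutral tree can stop being neutral only if it
  -- receives an annotation.
  induction N using Nat.strong_induction_on with
  | _ N IH =>
  intro φ₀ X t h
  induction h with
  | @tvar φ₀ i κ hi =>
    intro φ s d hb hs
    rcases hs i _ hi with ⟨h1, h2⟩ | ⟨X, h1, h2, h3⟩ | ⟨h1, h2⟩
    · exact ⟨_, _, .tbound h1, .tvar h2, by simp, fun _ h => absurd trivial h⟩
    · refine ⟨_, _, .thit h1 h2, h3, ?_, by simp⟩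
      intro κ' hκ
      cases hκ
      exact ⟨rfl, hb X κ (List.mem_of_getElem? h2)⟩
    · exact ⟨_, _, .tfree h1, .tvar h2, by simp, fun _ h => absurd trivial h⟩
  | @evar φ₀ i hi =>
    intro φ s d hb hs
    rcases hs i _ hi with ⟨h1, h2⟩ | ⟨X, h1, h2, h3⟩ | ⟨h1, h2⟩
    · exact ⟨_, _, .ebound h1, .evar h2, by simp, fun h => h.elim⟩
    · exact ⟨_, _, .ehit h1 h2, h3, by simp, fun h => h.elim⟩
    · exact ⟨_, _, .efree h1, .evar h2, by simp, fun h => h.elim⟩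
  | leaf h =>
    intro φ s d hb hs
    exact ⟨_, _, .leaf, .leaf h, by simp, fun h => h.elim⟩
  | node h _ _ iha ihb =>
    intro φ s d hb hs
    obtain ⟨a, _, h1, h2, -⟩ := iha hb hs
    obtain ⟨b, _, h3, h4, -⟩ := ihb hb (hs.ext _)
    exact ⟨_, _, .node h1 h3, .node h h2 h4, by simp, fun h => h.elim⟩
  | thunk _ ih =>
    intro φ s d hb hs
    obtain ⟨a, _, h1, h2, -⟩ := ih hb (hs.ext _)
    exact ⟨_, _, .node .leaf h1, .thunk h2, by simp, fun h => h.elim⟩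
  | sbNil =>
    intro φ s d hb hs
    exact ⟨_, _, .leaf, .sbNil, by simp, fun h => h.elim⟩
  | sbTy _ _ iha ihb =>
    intro φ s d hb hs
    obtain ⟨a, _, h1, h2, -⟩ := iha hb hs
    obtain ⟨b, _, h3, h4, -⟩ := ihb hb hs
    exact ⟨_, _, .node h1 h3, .sbTy h2 h4, by simp, fun h => h.elim⟩
  | sbTm _ _ iha ihb =>
    intro φ s d hb hs
    obtain ⟨a, _, h1, h2, -⟩ := iha hb hs
    obtain ⟨b, _, h3, h4, -⟩ := ihb hb hs
    exact ⟨_, _, .node h1 h3, .sbTm h2 h4, by simp, fun h => h.elim⟩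
  | @nforce φ₀ P m l ψ κ τ _ hn _ ihP ihτ =>
    intro φ s d hb hs
    obtain ⟨P', o, h1, h2, h3, h4⟩ := ihP hb hs
    obtain ⟨τ', o', h5, h6, -⟩ := ihτ hb hs
    by_cases hP' : P'.IsNeu
    · exact ⟨_, _, .stuck h1 hP' h5, .nforce h2 hP' h6, by simp, fun _ h => absurd trivial h⟩
    · obtain ⟨A, rfl, hA⟩ := h2.eq_thunk hP'
      cases o with
      | none => exact absurd rfl (h4 hn hP')
      | some κ' =>
        obtain ⟨h7, h8⟩ := h3 _ rfl
        cases h7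
        obtain ⟨s', hz, hs'⟩ := h6.exists_zip rfl
        simp only [SKind.up.sizeOf_spec] at h8
        -- The template body `A` is not a subtree of the original tree. The annotation `up m l ψ κ`
        -- has size at most `N`, however, so `ψ` has size below `N` and the outer induction applies.
        obtain ⟨A', o'', h9, h10, -⟩ := IH (sizeOf ψ) (by omega) hA hz.bnd hs'
        rw [← hz.length] at h1
        refine ⟨A', _, .splice h1 h5 hz h9, h10, ?_, by simp⟩
        rintro κ' ⟨⟩
        exact ⟨rfl, by omega⟩

/-- By determinism a given result is the one produced by totality, so it inherits the same
information. -/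
theorem RSub.sound {N : ℕ} {φ₀ φ : SEnv M} {X t Y o s d} (h : RSub s d X Y o) (hX : SK φ₀ X t)
    (hb : s.Bnd N) (hs : SOK φ₀ φ s d) :
    SK φ Y t ∧ (∀ κ, o = some κ → t = .kd κ ∧ sizeOf κ ≤ N) ∧
      (X.IsNeu → ¬ Y.IsNeu → o ≠ none) := by
  obtain ⟨Y', o', h1, h2⟩ := hX.exists_rsub N hb hs
  obtain ⟨rfl, rfl⟩ := h.det h1
  exact h2

-- Commutation of hereditary substitutions

/-- Componentwise substitution. -/
def ASub.Rel (s₂ : ASub M) (c : ℕ) (s s' : ASub M) : Prop :=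
  List.Forall₂ (fun p q => p.2 = q.2 ∧ ∃ o, RSub s₂ c p.1 q.1 o) s s'

theorem Zip.rsub {ψ : SCtx M} {τ s} (h : Zip ψ τ s) : ∀ {s₂ c τ' o}, RSub s₂ c τ τ' o →
    ∃ s', Zip ψ τ' s' ∧ ASub.Rel s₂ c s s' := by
  induction h with
  | nil => intro s₂ c τ' o h; cases h; exact ⟨_, .nil, .nil⟩
  | consTy _ ih =>
    intro s₂ c τ' o h
    cases h with
    | node ha hb =>
      obtain ⟨s', h1, h2⟩ := ih ha
      exact ⟨_, .consTy h1, .cons ⟨rfl, _, hb⟩ h2⟩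
  | consTm _ ih =>
    intro s₂ c τ' o h
    cases h with
    | node ha hb =>
      obtain ⟨s', h1, h2⟩ := ih ha
      exact ⟨_, .consTm h1, .cons ⟨rfl, _, hb⟩ h2⟩

theorem ASub.Rel.bnd {s₂ : ASub M} {c s s' N} (h : ASub.Rel s₂ c s s') (hb : s.Bnd N) :
    s'.Bnd N := by
  induction h with
  | nil => exact hb
  | @cons p q s s' hp _ ih =>
    intro X κ hm
    rcases List.mem_cons.mp hm with hm | hm
    · exact hb p.1 κ (List.mem_cons.mpr (.inl (Prod.ext rfl (by rw [hp.1, ← hm]))))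
    · exact ih (fun X κ h => hb X κ (List.mem_cons_of_mem _ h)) X κ hm

theorem ASub.Rel.get {s₂ : ASub M} {c s s'} (h : ASub.Rel s₂ c s s') :
    ∀ {i : ℕ} {X v}, s[i]? = some (X, v) → ∃ Y o, s'[i]? = some (Y, v) ∧ RSub s₂ c X Y o := by
  induction h with
  | nil => intro i X v h; simp at h
  | @cons p q s s' hp _ ih =>
    intro i X v hi
    cases i with
    | zero =>
      obtain rfl : p = (X, v) := by simpa using hi
      obtain ⟨h1, o, h2⟩ := hp
      exact ⟨q.1, o, by simp [Prod.ext_iff, ← h1], h2⟩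
    | succ i => simpa using ih (by simpa using hi)

theorem ASub.Rel.length {s₂ : ASub M} {c s s'} (h : ASub.Rel s₂ c s s') :
    s'.length = s.length := (List.Forall₂.length_eq h).symm

/-- Hereditary substitutions commute. -/
theorem SK.comp (N : ℕ) : ∀ {φ₀ : SEnv M} {X t}, SK φ₀ X t →
    ∀ {N₁ N₂ φ₁ φ₂ φ₀' s₁ s₂ s₁' d c X₁ X₂ X' o₁ o₂ o'}, N₁ + N₂ ≤ N →
    s₁.Bnd N₁ → s₂.Bnd N₂ → SOK φ₀ φ₁ s₁ d → SOK φ₁ φ₂ s₂ (d + c) →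
    SOK φ₀ φ₀' s₂ (d + s₁.length + c) → SOK φ₀' φ₂ s₁' d → ASub.Rel s₂ c s₁ s₁' →
    RSub s₁ d X X₁ o₁ → RSub s₂ (d + c) X₁ X₂ o₂ → RSub s₂ (d + s₁.length + c) X X' o' →
    ∃ o, RSub s₁' d X' X₂ o := by
  -- The equation is `X[s₁][s₂] = X[s₂][s₁']` with `s₁' = s₁[s₂]`. The components of `s₁` live above
  -- `c` variables that `s₂` leaves alone. Hence `s₂` acts at depth `d + c` once `s₁` has been
  -- carried out, and at depth `d + s₁.length + c` before that. The measure is the sum of both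
  -- bounds, because either substitution can cause a splice.
  induction N using Nat.strong_induction_on with
  | _ N IH =>
  intro φ₀ X t h
  induction h with
  | @tvar φ₀ i κ hi =>
    intro N₁ N₂ φ₁ φ₂ φ₀' s₁ s₂ s₁' d c X₁ X₂ X' o₁ o₂ o' hN hb₁ hb₂ h01 h12 h00 h02 hr r₁ r₂ r'
    have hl := hr.length
    rcases h01 i _ hi with ⟨h1, -⟩ | ⟨A, h1, h2, h3⟩ | ⟨h1, h2⟩
    · obtain ⟨rfl, rfl⟩ := r₁.det (.tbound h1)
      obtain ⟨rfl, rfl⟩ := r₂.det (.tbound (by omega))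
      obtain ⟨rfl, rfl⟩ := r'.det (.tbound (by omega))
      exact ⟨_, .tbound h1⟩
    · have := lt_of_getElem?_eq_some h2
      obtain ⟨rfl, rfl⟩ := r₁.det (.thit h1 h2)
      obtain ⟨rfl, rfl⟩ := r'.det (.tbound (by omega))
      obtain ⟨B, o, h4, h5⟩ := hr.get h2
      obtain ⟨rfl, rfl⟩ := r₂.det ((h5.shift_le d 0 (Nat.zero_le _)).cast (by omega) rfl rfl)
      exact ⟨_, .thit h1 h4⟩
    · obtain ⟨rfl, rfl⟩ := r₁.det (.tfree h1)
      rcases h12 _ _ h2 with ⟨h3, -⟩ | ⟨A, h3, h4, h5⟩ | ⟨h3, -⟩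
      · obtain ⟨rfl, rfl⟩ := r₂.det (.tbound h3)
        obtain ⟨rfl, rfl⟩ := r'.det (.tbound (by omega))
        exact ⟨_, (RSub.tfree (by omega)).cast rfl rfl (by rw [hl])⟩
      · obtain ⟨rfl, rfl⟩ := r₂.det (.thit h3 h4)
        obtain ⟨rfl, rfl⟩ := r'.det (.thit (by omega)
          (by rw [show i - (d + s₁.length + c) = i - s₁.length - (d + c) by omega]; exact h4))
        -- Only `s₂` replaces this variable. On the other route its image has been shifted past
        -- `s₁.length` additional positions, which `s₁'` removes again.
        refine ⟨_, (h5.rsub_shift s₁' d).cast rfl ?_ rfl⟩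
        rw [Raw.shift_shift _ _ _ _ _ (Nat.zero_le _) (by omega), hl]
        congr 1; omega
      · obtain ⟨rfl, rfl⟩ := r₂.det (.tfree h3)
        obtain ⟨rfl, rfl⟩ := r'.det (.tfree (by omega))
        exact ⟨_, (RSub.tfree (by omega)).cast rfl rfl (by congr 1; omega)⟩
  | @evar φ₀ i hi =>
    intro N₁ N₂ φ₁ φ₂ φ₀' s₁ s₂ s₁' d c X₁ X₂ X' o₁ o₂ o' hN hb₁ hb₂ h01 h12 h00 h02 hr r₁ r₂ r'
    have hl := hr.length
    rcases h01 i _ hi with ⟨h1, -⟩ | ⟨A, h1, h2, h3⟩ | ⟨h1, h2⟩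
    · obtain ⟨rfl, rfl⟩ := r₁.det (.ebound h1)
      obtain ⟨rfl, rfl⟩ := r₂.det (.ebound (by omega))
      obtain ⟨rfl, rfl⟩ := r'.det (.ebound (by omega))
      exact ⟨_, .ebound h1⟩
    · have := lt_of_getElem?_eq_some h2
      obtain ⟨rfl, rfl⟩ := r₁.det (.ehit h1 h2)
      obtain ⟨rfl, rfl⟩ := r'.det (.ebound (by omega))
      obtain ⟨B, o, h4, h5⟩ := hr.get h2
      obtain ⟨rfl, rfl⟩ := r₂.det ((h5.shift_le d 0 (Nat.zero_le _)).cast (by omega) rfl rfl)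
      exact ⟨_, .ehit h1 h4⟩
    · obtain ⟨rfl, rfl⟩ := r₁.det (.efree h1)
      rcases h12 _ _ h2 with ⟨h3, -⟩ | ⟨A, h3, h4, h5⟩ | ⟨h3, -⟩
      · obtain ⟨rfl, rfl⟩ := r₂.det (.ebound h3)
        obtain ⟨rfl, rfl⟩ := r'.det (.ebound (by omega))
        exact ⟨_, (RSub.efree (by omega)).cast rfl rfl (by rw [hl])⟩
      · obtain ⟨rfl, rfl⟩ := r₂.det (.ehit h3 h4)
        obtain ⟨rfl, rfl⟩ := r'.det (.ehit (by omega)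
          (by rw [show i - (d + s₁.length + c) = i - s₁.length - (d + c) by omega]; exact h4))
        refine ⟨_, (h5.rsub_shift s₁' d).cast rfl ?_ rfl⟩
        rw [Raw.shift_shift _ _ _ _ _ (Nat.zero_le _) (by omega), hl]
        congr 1; omega
      · obtain ⟨rfl, rfl⟩ := r₂.det (.efree h3)
        obtain ⟨rfl, rfl⟩ := r'.det (.efree (by omega))
        exact ⟨_, (RSub.efree (by omega)).cast rfl rfl (by congr 1; omega)⟩
  | leaf =>
    intro N₁ N₂ φ₁ φ₂ φ₀' s₁ s₂ s₁' d c X₁ X₂ X' o₁ o₂ o' hN hb₁ hb₂ h01 h12 h00 h02 hr r₁ r₂ r'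
    cases r₁; cases r₂; cases r'; exact ⟨_, .leaf⟩
  | sbNil =>
    intro N₁ N₂ φ₁ φ₂ φ₀' s₁ s₂ s₁' d c X₁ X₂ X' o₁ o₂ o' hN hb₁ hb₂ h01 h12 h00 h02 hr r₁ r₂ r'
    cases r₁; cases r₂; cases r'; exact ⟨_, .leaf⟩
  | @node φ₀ l δ a b t₁ t₂ t _ _ _ iha ihb =>
    intro N₁ N₂ φ₁ φ₂ φ₀' s₁ s₂ s₁' d c X₁ X₂ X' o₁ o₂ o' hN hb₁ hb₂ h01 h12 h00 h02 hr r₁ r₂ r'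
    cases r₁ with | node ra₁ rb₁ =>
    cases r₂ with | node ra₂ rb₂ =>
    cases r' with | node ra' rb' =>
    obtain ⟨_, ha⟩ := iha hN hb₁ hb₂ h01 h12 h00 h02 hr ra₁ ra₂ ra'
    have e₁ : d + c + δ.len = d + δ.len + c := by omega
    have e₂ : d + s₁.length + c + δ.len = d + δ.len + s₁.length + c := by omega
    obtain ⟨_, hb⟩ := ihb hN hb₁ hb₂ (h01.ext δ) (e₁ ▸ h12.ext δ) (e₂ ▸ h00.ext δ) (h02.ext δ) hr
      rb₁ (rb₂.cast e₁ rfl rfl) (rb'.cast e₂ rfl rfl)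
    exact ⟨_, .node ha hb⟩
  | @thunk φ₀ δ A κ m l _ ih =>
    intro N₁ N₂ φ₁ φ₂ φ₀' s₁ s₂ s₁' d c X₁ X₂ X' o₁ o₂ o' hN hb₁ hb₂ h01 h12 h00 h02 hr r₁ r₂ r'
    cases r₁ with | node ra₁ rb₁ =>
    cases ra₁
    cases r₂ with | node ra₂ rb₂ =>
    cases ra₂
    cases r' with | node ra' rb' =>
    cases ra'
    have e₁ : d + c + δ.len = d + δ.len + c := by omega
    have e₂ : d + s₁.length + c + δ.len = d + δ.len + s₁.length + c := by omega
    obtain ⟨_, hb⟩ := ih hN hb₁ hb₂ (h01.ext δ) (e₁ ▸ h12.ext δ) (e₂ ▸ h00.ext δ) (h02.ext δ) hr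
      rb₁ (rb₂.cast e₁ rfl rfl) (rb'.cast e₂ rfl rfl)
    exact ⟨_, .node .leaf hb⟩
  | sbTy _ _ iha ihb =>
    intro N₁ N₂ φ₁ φ₂ φ₀' s₁ s₂ s₁' d c X₁ X₂ X' o₁ o₂ o' hN hb₁ hb₂ h01 h12 h00 h02 hr r₁ r₂ r'
    cases r₁ with | node ra₁ rb₁ =>
    cases r₂ with | node ra₂ rb₂ =>
    cases r' with | node ra' rb' =>
    obtain ⟨_, ha⟩ := iha hN hb₁ hb₂ h01 h12 h00 h02 hr ra₁ ra₂ ra'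
    obtain ⟨_, hb⟩ := ihb hN hb₁ hb₂ h01 h12 h00 h02 hr rb₁ rb₂ rb'
    exact ⟨_, .node ha hb⟩
  | sbTm _ _ iha ihb =>
    intro N₁ N₂ φ₁ φ₂ φ₀' s₁ s₂ s₁' d c X₁ X₂ X' o₁ o₂ o' hN hb₁ hb₂ h01 h12 h00 h02 hr r₁ r₂ r'
    cases r₁ with | node ra₁ rb₁ =>
    cases r₂ with | node ra₂ rb₂ =>
    cases r' with | node ra' rb' =>
    obtain ⟨_, ha⟩ := iha hN hb₁ hb₂ h01 h12 h00 h02 hr ra₁ ra₂ ra'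
    obtain ⟨_, hb⟩ := ihb hN hb₁ hb₂ h01 h12 h00 h02 hr rb₁ rb₂ rb'
    exact ⟨_, .node ha hb⟩
  | @nforce φ₀ P m l ψ κ ρ hP hn hρ ihP ihρ =>
    intro N₁ N₂ φ₁ φ₂ φ₀' s₁ s₂ s₁' d c X₁ X₂ X' o₁ o₂ o' hN hb₁ hb₂ h01 h12 h00 h02 hr r₁ r₂ r'
    have hb₁' := hr.bnd hb₁
    obtain ⟨P₁, oP₁, rP₁, hP₁, aP₁, bP₁⟩ := hP.exists_rsub N₁ hb₁ h01
    obtain ⟨ρ₁, _, rρ₁, hρ₁, -⟩ := hρ.exists_rsub N₁ hb₁ h01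
    obtain ⟨P₂, oP₂, rP₂, hP₂, aP₂, bP₂⟩ := hP₁.exists_rsub N₂ hb₂ h12
    obtain ⟨ρ₂, _, rρ₂, hρ₂, -⟩ := hρ₁.exists_rsub N₂ hb₂ h12
    obtain ⟨P', oP', rP', hP', aP', bP'⟩ := hP.exists_rsub N₂ hb₂ h00
    obtain ⟨ρ', _, rρ', hρ', -⟩ := hρ.exists_rsub N₂ hb₂ h00
    obtain ⟨oP, rP⟩ := ihP hN hb₁ hb₂ h01 h12 h00 h02 hr rP₁ rP₂ rP'
    obtain ⟨_, rρ⟩ := ihρ hN hb₁ hb₂ h01 h12 h00 h02 hr rρ₁ rρ₂ rρ'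
    obtain ⟨-, aP, bP⟩ := rP.sound hP' hb₁' h02
    -- `P₂` is the head after both substitutions. If it is neutral, no splice happened on either
    -- route, since templates remain templates. Otherwise both routes are compared with `B[z₂]`, the
    -- body and the components after everything has been substituted.
    by_cases hn₂ : P₂.IsNeu
    · have hn₁ : P₁.IsNeu := by
        by_contra hc
        obtain ⟨B, rfl, -⟩ := hP₁.eq_thunk hc
        cases rP₂; exact hn₂
      have hn' : P'.IsNeu := by
        by_contra hc
        obtain ⟨B, rfl, -⟩ := hP'.eq_thunk hc
        cases rP; exact hn₂
      obtain ⟨rfl, rfl⟩ := r₁.det (.stuck rP₁ hn₁ rρ₁)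
      obtain ⟨rfl, rfl⟩ := r₂.det (.stuck rP₂ hn₂ rρ₂)
      obtain ⟨rfl, rfl⟩ := r'.det (.stuck rP' hn' rρ')
      exact ⟨_, .stuck rP hn₂ rρ⟩
    · obtain ⟨B, rfl, hB⟩ := hP₂.eq_thunk hn₂
      obtain ⟨z₁, hz₁, hs₁⟩ := hρ₁.exists_zip rfl
      obtain ⟨z', hz', hs'⟩ := hρ'.exists_zip rfl
      obtain ⟨z₂, hz₂, hrz₂⟩ := hz₁.rsub rρ₂
      obtain ⟨z₂', hz₂', hs₂⟩ := hρ₂.exists_zip rfl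
      obtain rfl := hz₂.det hz₂'
      obtain ⟨z₂', hz₂', hrz₂'⟩ := hz'.rsub rρ
      obtain rfl := hz₂.det hz₂'
      -- the result of substituting in the body of the template
      have claim : ∃ o, RSub z₂ 0 B X₂ o := by
        by_cases hn₁ : P₁.IsNeu
        · obtain ⟨rfl, rfl⟩ := r₁.det (.stuck rP₁ hn₁ rρ₁)
          cases r₂ with
          | stuck rP₃ hn₃ _ => obtain ⟨rfl, -⟩ := rP₂.det rP₃; exact absurd hn₃ hn₂
          | splice rP₃ rρ₃ hz₃ rB =>
            obtain ⟨e1, rfl⟩ := rP₂.det rP₃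
            obtain ⟨h1, -⟩ := aP₂ _ rfl
            cases h1
            obtain ⟨rfl, -⟩ := rρ₂.det rρ₃
            obtain rfl := hz₂.det hz₃
            simp only [Raw.thunk, Raw.node.injEq] at e1
            obtain ⟨-, -, -, rfl⟩ := e1
            exact ⟨_, rB⟩
        · obtain ⟨B₁, rfl, hB₁⟩ := hP₁.eq_thunk hn₁
          cases r₁ with
          | stuck rP₃ hn₃ _ => obtain ⟨rfl, -⟩ := rP₁.det rP₃; exact absurd hn₃ hn₁
          | splice rP₃ rρ₃ hz₃ rB =>
            obtain ⟨e1, rfl⟩ := rP₁.det rP₃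
            obtain ⟨h1, h2⟩ := aP₁ _ rfl
            cases h1
            obtain ⟨rfl, -⟩ := rρ₁.det rρ₃
            obtain rfl := hz₁.det hz₃
            simp only [Raw.thunk, Raw.node.injEq] at e1
            obtain ⟨-, -, -, rfl⟩ := e1
            simp only [SKind.up.sizeOf_spec] at h2
            cases rP₂ with | node _ rB₂ =>
            have e₁ : d + c + ψ.len = 0 + z₁.length + (d + c) := by rw [hz₁.length]; omega
            -- Here `s₁` has already spliced, so `X₁ = B₁[z₁]`. Commutation is needed for `z₁` and
            -- `s₂`, and `ψ` is part of a kind of size at most `N₁`, so the sum of the bounds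
            -- decreases.
            exact IH (sizeOf ψ + N₂) (by omega) hB₁ le_rfl hz₁.bnd hb₂ hs₁ ((zero_add (d + c)).symm ▸ h12)
              (e₁ ▸ h12.ext ψ) hs₂ hrz₂ rB (r₂.cast (by omega) rfl rfl) (rB₂.cast e₁ rfl rfl)
      obtain ⟨oX, rX⟩ := claim
      by_cases hn' : P'.IsNeu
      · obtain ⟨rfl, rfl⟩ := r'.det (.stuck rP' hn' rρ')
        cases oP with
        | none => exact absurd rfl (bP hn' hn₂)
        | some κ' =>
          obtain ⟨h1, -⟩ := aP _ rfl
          cases h1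
          exact ⟨_, .splice (rP.cast rfl rfl (by rw [hz₂.length])) rρ hz₂ rX⟩
      · obtain ⟨B', rfl, hB'⟩ := hP'.eq_thunk hn'
        cases r' with
        | stuck rP₃ hn₃ _ => obtain ⟨rfl, -⟩ := rP'.det rP₃; exact absurd hn₃ hn'
        | splice rP₃ rρ₃ hz₃ rB =>
          obtain ⟨e1, rfl⟩ := rP'.det rP₃
          obtain ⟨h1, h2⟩ := aP' _ rfl
          cases h1
          obtain ⟨rfl, -⟩ := rρ'.det rρ₃
          obtain rfl := hz'.det hz₃
          simp only [Raw.thunk, Raw.node.injEq] at e1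
          obtain ⟨-, -, -, rfl⟩ := e1
          simp only [SKind.up.sizeOf_spec] at h2
          cases rP with | node _ rB₂ =>
          have e₁ : d + ψ.len = 0 + z'.length + d := by rw [hz'.length]; omega
          -- On the other route `s₂` has spliced, so `X' = B'[z']`. Totality provides `X'[s₁']`, and
          -- commutation of `z'` and `s₁'` identifies it with `B[z₂]`. Now `ψ` is part of a kind of
          -- size at most `N₂`.
          obtain ⟨hX', -⟩ := rB.sound hB' hz'.bnd hs'
          obtain ⟨Y, _, rY, -⟩ := hX'.exists_rsub N₁ hb₁' h02
          obtain ⟨_, rY'⟩ := IH (sizeOf ψ + N₁) (by omega) hB' le_rfl hz'.bnd hb₁' hs'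
            ((zero_add d).symm ▸ h02) (e₁ ▸ h02.ext ψ) hs₂ hrz₂' rB
            (rY.cast (by omega) rfl rfl) (rB₂.cast e₁ rfl rfl)
          obtain ⟨rfl, -⟩ := rX.det rY'
          exact ⟨_, rY⟩

/-! ## Encoding the syntax by uniform trees -/

mutual
def Kind.enc : Kind M → Raw M
  | .type k => .leaf (.kType k)
  | .up k l Ψ K => .node (.kUp k l) Ψ.len (Ctx.enc Ψ) (Kind.enc K)
def Ty.enc : Ty M → Raw M
  | .one k => .leaf (.one k)
  | .neu P => Neu.enc P
  | .thunk b A => .thunk b (Ty.enc A)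
  | .up k l Ψ A => .node (.tUp k l) Ψ.len (Ctx.enc Ψ) (Ty.enc A)
  | .down m k A => .node (.down m k) 0 (.leaf .unit) (Ty.enc A)
  | .all K A => .node .all 1 (Kind.enc K) (Ty.enc A)
  | .arr A B => .node .arr 0 (Ty.enc A) (Ty.enc B)
def Neu.enc : Neu M → Raw M
  | .var i => .tvar i
  | .force P σ => .nforce (Neu.enc P) (Sbst.enc σ)
def Tm.enc : Tm M → Raw M
  | .var i => .evar i
  | .one => .leaf .eOne
  | .susp k l b e => .node (.susp k l) b (.leaf .unit) (Tm.enc e)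
  | .force m k e δ σ => .node (.eForce m k δ) 0 (Tm.enc e) (Sbst.enc σ)
  | .store m k e => .node (.store m k) 0 (.leaf .unit) (Tm.enc e)
  | .load m k e f => .node (.load m k) 1 (Tm.enc e) (Tm.enc f)
  | .tlam K e => .node .tlam 1 (Kind.enc K) (Tm.enc e)
  | .tapp e A => .node .tapp 0 (Tm.enc e) (Ty.enc A)
  | .lam k A e => .node (.lam k) 1 (Ty.enc A) (Tm.enc e)
  | .app e f => .node .app 0 (Tm.enc e) (Tm.enc f)
def Ctx.enc : Ctx M → Raw M
  | .nil => .leaf .cNil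
  | .consTy Ψ K => .node .cTy Ψ.len (Ctx.enc Ψ) (Kind.enc K)
  | .consTm Ψ k A => .node (.cTm k) Ψ.len (Ctx.enc Ψ) (Ty.enc A)
def Sbst.enc : Sbst M → Raw M
  | .nil => .leaf .sNil
  | .consTy σ A => .node .sTy 0 (Sbst.enc σ) (Ty.enc A)
  | .consTm σ k e => .node (.sTm k) 0 (Sbst.enc σ) (Tm.enc e)
end

theorem Neu.isNeu_enc (P : Neu M) : P.enc.IsNeu := by
  cases P <;> simp [Neu.enc, Raw.IsNeu]

theorem Ty.isNeu_enc {A : Ty M} : A.enc.IsNeu ↔ ∃ P, A = .neu P := by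
  cases A with
  | neu P => exact ⟨fun _ => ⟨P, rfl⟩, fun _ => P.isNeu_enc⟩
  | _ => simp [Ty.enc, Raw.IsNeu, Raw.thunk]

theorem Neu.enc_eq_node {P : Neu M} {l n a b} : P.enc ≠ .node l n a b := by
  cases P <;> simp [Neu.enc]

theorem Neu.enc_eq_leaf {P : Neu M} {l} : P.enc ≠ .leaf l := by
  cases P <;> simp [Neu.enc]

theorem Ctx.len_shift (n : ℕ) : ∀ (d : ℕ) (Ψ : Ctx M), (Ctx.shift n d Ψ).len = Ψ.len
  | _, .nil => rfl
  | d, .consTy Ψ _ => by simp [Ctx.shift, Ctx.len, Ctx.len_shift n d Ψ]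
  | d, .consTm Ψ _ _ => by simp [Ctx.shift, Ctx.len, Ctx.len_shift n d Ψ]

mutual
theorem Kind.enc_shift (n : ℕ) : ∀ (d : ℕ) (K : Kind M), (Kind.shift n d K).enc = K.enc.shift n d
  | _, .type _ => rfl
  | d, .up k l Ψ K => by
    simp [Kind.shift, Kind.enc, Raw.shift, Ctx.enc_shift n, Kind.enc_shift n, Ctx.len_shift]
theorem Ty.enc_shift (n : ℕ) : ∀ (d : ℕ) (K : Ty M), (Ty.shift n d K).enc = K.enc.shift n d
  | _, .one _ => rfl
  | d, .neu P => by simp [Ty.shift, Ty.enc, Neu.enc_shift n]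
  | d, .thunk b A => by simp [Ty.shift, Ty.enc, Ty.enc_shift n]
  | d, .up k l Ψ A => by
    simp [Ty.shift, Ty.enc, Raw.shift, Ctx.enc_shift n, Ty.enc_shift n, Ctx.len_shift]
  | d, .down m k A => by simp [Ty.shift, Ty.enc, Raw.shift, Ty.enc_shift n]
  | d, .all K A => by simp [Ty.shift, Ty.enc, Raw.shift, Ty.enc_shift n, Kind.enc_shift n]
  | d, .arr A B => by simp [Ty.shift, Ty.enc, Raw.shift, Ty.enc_shift n]
theorem Neu.enc_shift (n : ℕ) : ∀ (d : ℕ) (K : Neu M), (Neu.shift n d K).enc = K.enc.shift n d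
  | d, .var i => by simp [Neu.shift, Neu.enc, Raw.shift]
  | d, .force P σ => by simp [Neu.shift, Neu.enc, Raw.shift, Neu.enc_shift n, Sbst.enc_shift n]
theorem Tm.enc_shift (n : ℕ) : ∀ (d : ℕ) (K : Tm M), (Tm.shift n d K).enc = K.enc.shift n d
  | d, .var i => by simp [Tm.shift, Tm.enc, Raw.shift]
  | d, .one => rfl
  | d, .susp k l b e => by simp [Tm.shift, Tm.enc, Raw.shift, Tm.enc_shift n]
  | d, .force m k e δ σ => by
    simp [Tm.shift, Tm.enc, Raw.shift, Tm.enc_shift n, Sbst.enc_shift n]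
  | d, .store m k e => by simp [Tm.shift, Tm.enc, Raw.shift, Tm.enc_shift n]
  | d, .load m k e f => by simp [Tm.shift, Tm.enc, Raw.shift, Tm.enc_shift n]
  | d, .tlam K e => by simp [Tm.shift, Tm.enc, Raw.shift, Tm.enc_shift n, Kind.enc_shift n]
  | d, .tapp e A => by simp [Tm.shift, Tm.enc, Raw.shift, Tm.enc_shift n, Ty.enc_shift n]
  | d, .lam k A e => by simp [Tm.shift, Tm.enc, Raw.shift, Tm.enc_shift n, Ty.enc_shift n]
  | d, .app e f => by simp [Tm.shift, Tm.enc, Raw.shift, Tm.enc_shift n]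
theorem Ctx.enc_shift (n : ℕ) : ∀ (d : ℕ) (K : Ctx M), (Ctx.shift n d K).enc = K.enc.shift n d
  | _, .nil => rfl
  | d, .consTy Ψ K => by
    simp [Ctx.shift, Ctx.enc, Raw.shift, Ctx.enc_shift n, Kind.enc_shift n, Ctx.len_shift]
  | d, .consTm Ψ k A => by
    simp [Ctx.shift, Ctx.enc, Raw.shift, Ctx.enc_shift n, Ty.enc_shift n, Ctx.len_shift]
theorem Sbst.enc_shift (n : ℕ) : ∀ (d : ℕ) (K : Sbst M), (Sbst.shift n d K).enc = K.enc.shift n d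
  | _, .nil => rfl
  | d, .consTy σ A => by simp [Sbst.shift, Sbst.enc, Raw.shift, Sbst.enc_shift n, Ty.enc_shift n]
  | d, .consTm σ k e => by
    simp [Sbst.shift, Sbst.enc, Raw.shift, Sbst.enc_shift n, Tm.enc_shift n]
end

-- Allows a tree obtained by substitution to be read back as a unique expression. The constructor
-- `Ty.neu` leaves no trace in the encoding, so every other type constructor has to be separated
-- from neutral trees by hand.
mutual
theorem Kind.enc_inj : ∀ {K K' : Kind M}, K.enc = K'.enc → K = K'
  | .type _, K', h => by cases K' <;> simp_all [Kind.enc]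
  | .up _ _ Ψ K, K', h => by
    cases K' <;> simp only [Kind.enc, Raw.node.injEq, reduceCtorEq, Lab.kUp.injEq] at h
    obtain ⟨⟨rfl, rfl⟩, -, h1, h2⟩ := h
    rw [Ctx.enc_inj h1, Kind.enc_inj h2]
theorem Ty.enc_inj : ∀ {K K' : Ty M}, K.enc = K'.enc → K = K'
  | .one _, K', h => by
    cases K' <;> simp_all [Ty.enc, Raw.thunk]
    exact absurd h.symm Neu.enc_eq_leaf
  | .neu P, K', h => by
    obtain ⟨Q, rfl⟩ := Ty.isNeu_enc.mp (h ▸ P.isNeu_enc : K'.enc.IsNeu)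
    rw [Neu.enc_inj (P := P) (Q := Q) h]
  | .thunk _ A, K', h => by
    cases K' with
    | neu P => exact absurd h.symm Neu.enc_eq_node
    | thunk =>
      simp only [Ty.enc, Raw.thunk, Raw.node.injEq] at h
      obtain ⟨-, rfl, -, h⟩ := h
      rw [Ty.enc_inj h]
    | _ => simp [Ty.enc, Raw.thunk] at h
  | .up _ _ Ψ A, K', h => by
    cases K' with
    | neu P => exact absurd h.symm Neu.enc_eq_node
    | up =>
      simp only [Ty.enc, Raw.node.injEq, Lab.tUp.injEq] at h
      obtain ⟨⟨rfl, rfl⟩, -, h1, h2⟩ := h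
      rw [Ctx.enc_inj h1, Ty.enc_inj h2]
    | _ => simp [Ty.enc, Raw.thunk] at h
  | .down _ _ A, K', h => by
    cases K' with
    | neu P => exact absurd h.symm Neu.enc_eq_node
    | down =>
      simp only [Ty.enc, Raw.node.injEq, Lab.down.injEq] at h
      obtain ⟨⟨rfl, rfl⟩, -, -, h2⟩ := h
      rw [Ty.enc_inj h2]
    | _ => simp [Ty.enc, Raw.thunk] at h
  | .all K A, K', h => by
    cases K' with
    | neu P => exact absurd h.symm Neu.enc_eq_node
    | all =>
      simp only [Ty.enc, Raw.node.injEq] at h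
      obtain ⟨-, -, h1, h2⟩ := h
      rw [Kind.enc_inj h1, Ty.enc_inj h2]
    | _ => simp [Ty.enc, Raw.thunk] at h
  | .arr A B, K', h => by
    cases K' with
    | neu P => exact absurd h.symm Neu.enc_eq_node
    | arr =>
      simp only [Ty.enc, Raw.node.injEq] at h
      obtain ⟨-, -, h1, h2⟩ := h
      rw [Ty.enc_inj h1, Ty.enc_inj h2]
    | _ => simp [Ty.enc, Raw.thunk] at h
theorem Neu.enc_inj : ∀ {P Q : Neu M}, P.enc = Q.enc → P = Q
  | .var _, Q, h => by cases Q <;> simp_all [Neu.enc]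
  | .force P σ, Q, h => by
    cases Q <;> simp only [Neu.enc, Raw.nforce.injEq, reduceCtorEq] at h
    rw [Neu.enc_inj h.1, Sbst.enc_inj h.2]
theorem Tm.enc_inj : ∀ {K K' : Tm M}, K.enc = K'.enc → K = K'
  | .var _, K', h => by cases K' <;> simp_all [Tm.enc]
  | .one, K', h => by cases K' <;> simp_all [Tm.enc]
  | .susp _ _ _ e, K', h => by
    cases K' <;> simp only [Tm.enc, Raw.node.injEq, reduceCtorEq, false_and, Lab.susp.injEq] at h
    obtain ⟨⟨rfl, rfl⟩, rfl, -, h⟩ := h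
    rw [Tm.enc_inj h]
  | .force _ _ e _ σ, K', h => by
    cases K' <;>
      simp only [Tm.enc, Raw.node.injEq, reduceCtorEq, false_and, Lab.eForce.injEq] at h
    obtain ⟨⟨rfl, rfl, rfl⟩, -, h, h'⟩ := h
    rw [Tm.enc_inj h, Sbst.enc_inj h']
  | .store _ _ e, K', h => by
    cases K' <;> simp only [Tm.enc, Raw.node.injEq, reduceCtorEq, false_and, Lab.store.injEq] at h
    obtain ⟨⟨rfl, rfl⟩, -, -, h⟩ := h
    rw [Tm.enc_inj h]
  | .load _ _ e f, K', h => by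
    cases K' <;> simp only [Tm.enc, Raw.node.injEq, reduceCtorEq, false_and, Lab.load.injEq] at h
    obtain ⟨⟨rfl, rfl⟩, -, h, h'⟩ := h
    rw [Tm.enc_inj h, Tm.enc_inj h']
  | .tlam K e, K', h => by
    cases K' <;> simp only [Tm.enc, Raw.node.injEq, reduceCtorEq, false_and] at h
    rw [Kind.enc_inj h.2.2.1, Tm.enc_inj h.2.2.2]
  | .tapp e A, K', h => by
    cases K' <;> simp only [Tm.enc, Raw.node.injEq, reduceCtorEq, false_and] at h
    rw [Tm.enc_inj h.2.2.1, Ty.enc_inj h.2.2.2]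
  | .lam _ A e, K', h => by
    cases K' <;> simp only [Tm.enc, Raw.node.injEq, reduceCtorEq, false_and, Lab.lam.injEq] at h
    obtain ⟨rfl, -, h, h'⟩ := h
    rw [Ty.enc_inj h, Tm.enc_inj h']
  | .app e f, K', h => by
    cases K' <;> simp only [Tm.enc, Raw.node.injEq, reduceCtorEq, false_and] at h
    rw [Tm.enc_inj h.2.2.1, Tm.enc_inj h.2.2.2]
theorem Ctx.enc_inj : ∀ {K K' : Ctx M}, K.enc = K'.enc → K = K'
  | .nil, K', h => by cases K' <;> simp_all [Ctx.enc]
  | .consTy Ψ K, K', h => by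
    cases K' <;> simp only [Ctx.enc, Raw.node.injEq, reduceCtorEq, false_and] at h
    rw [Ctx.enc_inj h.2.2.1, Kind.enc_inj h.2.2.2]
  | .consTm Ψ k A, K', h => by
    cases K' <;> simp only [Ctx.enc, Raw.node.injEq, reduceCtorEq, false_and, Lab.cTm.injEq] at h
    obtain ⟨rfl, -, h, h'⟩ := h
    rw [Ctx.enc_inj h, Ty.enc_inj h']
theorem Sbst.enc_inj : ∀ {K K' : Sbst M}, K.enc = K'.enc → K = K'
  | .nil, K', h => by cases K' <;> simp_all [Sbst.enc]
  | .consTy σ A, K', h => by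
    cases K' <;> simp only [Sbst.enc, Raw.node.injEq, reduceCtorEq, false_and] at h
    rw [Sbst.enc_inj h.2.2.1, Ty.enc_inj h.2.2.2]
  | .consTm σ k e, K', h => by
    cases K' <;> simp only [Sbst.enc, Raw.node.injEq, reduceCtorEq, false_and, Lab.sTm.injEq] at h
    obtain ⟨rfl, -, h, h'⟩ := h
    rw [Sbst.enc_inj h, Tm.enc_inj h']
end

/-! ## Hereditary substitution is functional -/

theorem Sbst.getTy_lt : ∀ {σ : Sbst M} {i A}, σ.getTy i = some A → i < σ.len
  | .nil, _, _, h => by simp [Sbst.getTy] at h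
  | .consTy _ _, 0, _, _ => Nat.succ_pos _
  | .consTm _ _ _, 0, _, h => by simp [Sbst.getTy] at h
  | .consTy σ _, _ + 1, _, h => Nat.succ_lt_succ (Sbst.getTy_lt (σ := σ) h)
  | .consTm σ _ _, _ + 1, _, h => Nat.succ_lt_succ (Sbst.getTy_lt (σ := σ) h)

theorem Sbst.getTm_lt : ∀ {σ : Sbst M} {i e}, σ.getTm i = some e → i < σ.len
  | .nil, _, _, h => by simp [Sbst.getTm] at h
  | .consTm _ _ _, 0, _, _ => Nat.succ_pos _
  | .consTy _ _, 0, _, h => by simp [Sbst.getTm] at h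
  | .consTy σ _, _ + 1, _, h => Nat.succ_lt_succ (Sbst.getTm_lt (σ := σ) h)
  | .consTm σ _ _, _ + 1, _, h => Nat.succ_lt_succ (Sbst.getTm_lt (σ := σ) h)

mutual
theorem SubKind.det {γ : SCtx M} {σ d K K₁} :
    SubKind γ σ d K K₁ → ∀ {K₂}, SubKind γ σ d K K₂ → K₁ = K₂
  | .type, _, .type => rfl
  | .up h₁ h₂, _, .up h₃ h₄ => by rw [SubCtx.det h₁ h₃, SubKind.det h₂ h₄]
termination_by structural h => h
theorem SubTy.det {γ : SCtx M} {σ d A A₁} :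
    SubTy γ σ d A A₁ → ∀ {A₂}, SubTy γ σ d A A₂ → A₁ = A₂
  | .one, _, .one => rfl
  | .neu h₁, _, .neu h₂ => by rw [SubNeu.det h₁ h₂]
  | .thunk h₁, _, .thunk h₂ => by rw [SubTy.det h₁ h₂]
  | .up h₁ h₂, _, .up h₃ h₄ => by rw [SubCtx.det h₁ h₃, SubTy.det h₂ h₄]
  | .down h₁, _, .down h₂ => by rw [SubTy.det h₁ h₂]
  | .all h₁ h₂, _, .all h₃ h₄ => by rw [SubKind.det h₁ h₃, SubTy.det h₂ h₄]
  | .arr h₁ h₂, _, .arr h₃ h₄ => by rw [SubTy.det h₁ h₃, SubTy.det h₂ h₄]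
termination_by structural h => h
theorem SubNeu.det {γ : SCtx M} {σ d P R₁} :
    SubNeu γ σ d P R₁ → ∀ {R₂}, SubNeu γ σ d P R₂ → R₁ = R₂
  | .bound h₁, _, h => by
    cases h <;> first | rfl | omega
  | .hit h₁ h₂ h₃, _, h => by
    cases h with
    | bound => omega
    | hit _ h₄ h₅ =>
      rw [h₂] at h₄; rw [h₃] at h₅; cases h₄; cases h₅; rfl
    | free h₄ => exact absurd (Sbst.getTy_lt h₂) (by omega)
  | .free h₁, _, h => by
    cases h with
    | bound => omega
    | hit _ h₄ h₅ => exact absurd (Sbst.getTy_lt h₄) (by omega)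
    | free h₄ => rfl
  | .splice h₁ h₂ h₃, _, h => by
    cases h with
    | splice h₄ h₅ h₆ =>
      cases SubNeu.det h₁ h₄
      cases SubSbst.det h₂ h₅
      cases SubTy.det h₃ h₆
      rfl
    | stuck h₄ h₅ h₆ => cases SubNeu.det h₁ h₄; cases h₅
  | .stuck h₁ h₂ h₃, _, h => by
    cases h with
    | splice h₄ h₅ h₆ => cases SubNeu.det h₁ h₄; cases h₂
    | stuck h₄ h₅ h₆ =>
      cases SubNeu.det h₁ h₄
      cases SubSbst.det h₃ h₆
      rw [h₂] at h₅; cases h₅; rfl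
termination_by structural h => h
theorem SubCtx.det {γ : SCtx M} {σ d Ψ Ψ₁} :
    SubCtx γ σ d Ψ Ψ₁ → ∀ {Ψ₂}, SubCtx γ σ d Ψ Ψ₂ → Ψ₁ = Ψ₂
  | .nil, _, .nil => rfl
  | .consTy h₁ h₂, _, .consTy h₃ h₄ => by rw [SubCtx.det h₁ h₃, SubKind.det h₂ h₄]
  | .consTm h₁ h₂, _, .consTm h₃ h₄ => by rw [SubCtx.det h₁ h₃, SubTy.det h₂ h₄]
termination_by structural h => h
theorem SubSbst.det {γ : SCtx M} {σ d τ τ₁} :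
    SubSbst γ σ d τ τ₁ → ∀ {τ₂}, SubSbst γ σ d τ τ₂ → τ₁ = τ₂
  | .nil, _, .nil => rfl
  | .consTy h₁ h₂, _, .consTy h₃ h₄ => by rw [SubSbst.det h₁ h₃, SubTy.det h₂ h₄]
  | .consTm h₁ h₂, _, .consTm h₃ h₄ => by rw [SubSbst.det h₁ h₃, SubTm.det h₂ h₄]
termination_by structural h => h
theorem SubTm.det {γ : SCtx M} {σ d e e₁} :
    SubTm γ σ d e e₁ → ∀ {e₂}, SubTm γ σ d e e₂ → e₁ = e₂
  | .bound h₁, _, h => by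
    cases h <;> first | rfl | omega
  | .hit h₁ h₂, _, h => by
    cases h with
    | bound => omega
    | hit _ h₄ => rw [h₂] at h₄; cases h₄; rfl
    | free h₄ => exact absurd (Sbst.getTm_lt h₂) (by omega)
  | .free h₁, _, h => by
    cases h with
    | bound => omega
    | hit _ h₄ => exact absurd (Sbst.getTm_lt h₄) (by omega)
    | free h₄ => rfl
  | .one, _, .one => rfl
  | .susp h₁, _, .susp h₂ => by rw [SubTm.det h₁ h₂]
  | .force h₁ h₂, _, .force h₃ h₄ => by rw [SubTm.det h₁ h₃, SubSbst.det h₂ h₄]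
  | .store h₁, _, .store h₂ => by rw [SubTm.det h₁ h₂]
  | .load h₁ h₂, _, .load h₃ h₄ => by rw [SubTm.det h₁ h₃, SubTm.det h₂ h₄]
  | .tlam h₁ h₂, _, .tlam h₃ h₄ => by rw [SubKind.det h₁ h₃, SubTm.det h₂ h₄]
  | .tapp h₁ h₂, _, .tapp h₃ h₄ => by rw [SubTm.det h₁ h₃, SubTy.det h₂ h₄]
  | .lam h₁ h₂, _, .lam h₃ h₄ => by rw [SubTy.det h₁ h₃, SubTm.det h₂ h₄]
  | .app h₁ h₂, _, .app h₃ h₄ => by rw [SubTm.det h₁ h₃, SubTm.det h₂ h₄]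
termination_by structural h => h
end

/-! ## From uniform trees back to the syntax -/

/-- The kind annotation of an outcome. -/
def NeuRes.ann : NeuRes M → Option (SKind M)
  | .neu _ => none
  | .red _ κ => some κ

theorem Zip.getTy {γ : SCtx M} {τ s} (h : Zip γ τ s) : ∀ {σ : Sbst M}, τ = σ.enc →
    ∀ {i : ℕ} {X κ}, s[i]? = some (X, some κ) →
      ∃ A, X = A.enc ∧ σ.getTy i = some A ∧ γ.getKind i = some κ := by
  induction h with
  | nil => intro σ _ i X κ h; simp at h
  | consTy _ ih =>
    intro σ hσ i X κ h
    cases σ <;> simp only [Sbst.enc, Raw.node.injEq, reduceCtorEq, false_and] at hσ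
    cases i with
    | zero =>
      simp only [List.getElem?_cons_zero, Option.some.injEq, Prod.mk.injEq] at h
      exact ⟨_, by rw [← h.1, hσ.2.2.2], rfl, by rw [← h.2]; rfl⟩
    | succ i => exact ih hσ.2.2.1 (by simpa using h)
  | consTm _ ih =>
    intro σ hσ i X κ h
    cases σ <;> simp only [Sbst.enc, Raw.node.injEq, reduceCtorEq, false_and] at hσ
    cases i with
    | zero => simp at h
    | succ i => exact ih hσ.2.2.1 (by simpa using h)

theorem Zip.getTm {γ : SCtx M} {τ s} (h : Zip γ τ s) : ∀ {σ : Sbst M}, τ = σ.enc →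
    ∀ {i : ℕ} {X}, s[i]? = some (X, none) → ∃ e, X = e.enc ∧ σ.getTm i = some e := by
  induction h with
  | nil => intro σ _ i X h; simp at h
  | consTy _ ih =>
    intro σ hσ i X h
    cases σ <;> simp only [Sbst.enc, Raw.node.injEq, reduceCtorEq, false_and] at hσ
    cases i with
    | zero => simp at h
    | succ i => exact ih hσ.2.2.1 (by simpa using h)
  | consTm _ ih =>
    intro σ hσ i X h
    cases σ <;> simp only [Sbst.enc, Raw.node.injEq, reduceCtorEq, false_and] at hσ
    cases i with
    | zero =>
      simp only [List.getElem?_cons_zero, Option.some.injEq, Prod.mk.injEq] at h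
      exact ⟨_, by rw [← h.1, hσ.2.2.2], rfl⟩
    | succ i => exact ih hσ.2.2.1 (by simpa using h)

theorem Zip.length_eq {γ : SCtx M} {τ s} (h : Zip γ τ s) : ∀ {σ : Sbst M}, τ = σ.enc →
    s.length = σ.len := by
  induction h with
  | nil => intro σ hσ; cases σ <;> simp_all [Sbst.enc, Sbst.len]
  | consTy _ ih =>
    intro σ hσ
    cases σ <;> simp only [Sbst.enc, Raw.node.injEq, reduceCtorEq, false_and] at hσ
    simp [Sbst.len, ih hσ.2.2.1]
  | consTm _ ih =>
    intro σ hσ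
    cases σ <;> simp only [Sbst.enc, Raw.node.injEq, reduceCtorEq, false_and] at hσ
    simp [Sbst.len, ih hσ.2.2.1]

theorem NeuRes.eq_red {R : NeuRes M} {κ} (h : R.ann = some κ) : R = .red R.toTy κ := by
  cases R <;> simp_all [NeuRes.ann, NeuRes.toTy]

theorem Ty.enc_eq_thunk {A : Ty M} {b X} (h : A.enc = .thunk b X) :
    ∃ B, A = .thunk b B ∧ B.enc = X := by
  cases A with
  | neu P => exact absurd h Neu.enc_eq_node
  | thunk => simp only [Ty.enc, Raw.thunk, Raw.node.injEq] at h; exact ⟨_, by rw [h.2.1], h.2.2.2⟩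
  | _ => simp [Ty.enc, Raw.thunk] at h

/-- What a substitution on uniform trees says about encoded expressions. -/
structure Reflects (γ : SCtx M) (σ : Sbst M) (d : ℕ) (X Y : Raw M) (o : Option (SKind M)) :
    Prop where
  neu : ∀ P : Neu M, X = P.enc → ∃ R, Y = R.toTy.enc ∧ R.ann = o ∧ SubNeu γ σ d P R
  kind : ∀ K : Kind M, X = K.enc → ∃ K', Y = K'.enc ∧ SubKind γ σ d K K'
  ty' : ∀ A : Ty M, X = A.enc → (∀ P, A ≠ .neu P) → ∃ A', Y = A'.enc ∧ SubTy γ σ d A A'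
  tm : ∀ e : Tm M, X = e.enc → ∃ e', Y = e'.enc ∧ SubTm γ σ d e e'
  ctx : ∀ Ψ : Ctx M, X = Ψ.enc → ∃ Ψ', Y = Ψ'.enc ∧ SubCtx γ σ d Ψ Ψ'
  sbst : ∀ τ : Sbst M, X = τ.enc → ∃ τ', Y = τ'.enc ∧ SubSbst γ σ d τ τ'

/-- A neutral type and its neutral have the same tree, so neutral types are covered by the field
`neu`, which also records the annotation. -/
theorem Reflects.ty {γ : SCtx M} {σ d X Y o} (h : Reflects γ σ d X Y o) (A : Ty M)
    (hA : X = A.enc) : ∃ A', Y = A'.enc ∧ SubTy γ σ d A A' := by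
  by_cases hn : ∃ P, A = .neu P
  · obtain ⟨P, rfl⟩ := hn
    obtain ⟨R, h1, -, h2⟩ := h.neu P hA
    exact ⟨_, h1, .neu h2⟩
  · exact h.ty' A hA fun P hP => hn ⟨P, hP⟩

theorem Ctx.len_sub {γ : SCtx M} {σ d} : ∀ {Ψ Ψ' : Ctx M}, SubCtx γ σ d Ψ Ψ' → Ψ'.len = Ψ.len
  | _, _, .nil => rfl
  | _, _, .consTy h _ => by simp [Ctx.len, Ctx.len_sub h]
  | _, _, .consTm h _ => by simp [Ctx.len, Ctx.len_sub h]

/-- Each rule on trees is a rule of the original relation as soon as the tree is known to encode an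
expression. The statement quantifies over `γ` and `σ` inside the induction, because a splice
continues with the new pair `ψ`, `τ'`. -/
theorem RSub.reflects {s : ASub M} {d X Y o} (h : RSub s d X Y o) :
    ∀ {γ : SCtx M} {σ : Sbst M}, Zip γ σ.enc s → Reflects γ σ d X Y o := by
  have enc_ne : ∀ {P : Neu M} {A : Ty M}, P.enc = A.enc → (∀ P, A ≠ .neu P) → False := by
    intro P A h hA
    obtain ⟨Q, rfl⟩ := Ty.isNeu_enc.mp (h ▸ P.isNeu_enc)
    exact hA Q rfl
  induction h with
  | @tbound s d i hi =>
    intro γ σ hz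
    refine ⟨fun P hP => ?_, fun K hK => ?_, fun A hA hn => ?_, fun e he => ?_, fun Ψ hΨ => ?_,
      fun τ hτ => ?_⟩
    · cases P <;> simp only [Neu.enc, Raw.tvar.injEq, reduceCtorEq] at hP
      subst hP
      exact ⟨_, rfl, rfl, .bound hi⟩
    · cases K <;> cases hK
    · exact (enc_ne (P := .var i) hA hn).elim
    · cases e <;> cases he
    · cases Ψ <;> cases hΨ
    · cases τ <;> cases hτ
  | @thit s d i A κ hi hs =>
    intro γ σ hz
    refine ⟨fun P hP => ?_, fun K hK => ?_, fun A hA hn => ?_, fun e he => ?_, fun Ψ hΨ => ?_,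
      fun τ hτ => ?_⟩
    · cases P <;> simp only [Neu.enc, Raw.tvar.injEq, reduceCtorEq] at hP
      subst hP
      obtain ⟨A, rfl, h1, h2⟩ := hz.getTy rfl hs
      exact ⟨.red _ _, (Ty.enc_shift _ _ _).symm, rfl, .hit hi h1 h2⟩
    · cases K <;> cases hK
    · exact (enc_ne (P := .var i) hA hn).elim
    · cases e <;> cases he
    · cases Ψ <;> cases hΨ
    · cases τ <;> cases hτ
  | @tfree s d i hi =>
    intro γ σ hz
    refine ⟨fun P hP => ?_, fun K hK => ?_, fun A hA hn => ?_, fun e he => ?_, fun Ψ hΨ => ?_,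
      fun τ hτ => ?_⟩
    · cases P <;> simp only [Neu.enc, Raw.tvar.injEq, reduceCtorEq] at hP
      subst hP
      rw [hz.length_eq rfl] at hi ⊢
      exact ⟨_, rfl, rfl, .free hi⟩
    · cases K <;> cases hK
    · exact (enc_ne (P := .var i) hA hn).elim
    · cases e <;> cases he
    · cases Ψ <;> cases hΨ
    · cases τ <;> cases hτ
  | @ebound s d i hi =>
    intro γ σ hz
    refine ⟨fun P hP => ?_, fun K hK => ?_, fun A hA hn => ?_, fun e he => ?_, fun Ψ hΨ => ?_,
      fun τ hτ => ?_⟩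
    · cases P <;> cases hP
    · cases K <;> cases hK
    · cases A with
      | neu P => exact absurd rfl (hn P)
      | _ => cases hA
    · cases e <;> simp only [Tm.enc, Raw.evar.injEq, reduceCtorEq] at he
      subst he
      exact ⟨.var i, rfl, .bound hi⟩
    · cases Ψ <;> cases hΨ
    · cases τ <;> cases hτ
  | @ehit s d i A hi hs =>
    intro γ σ hz
    refine ⟨fun P hP => ?_, fun K hK => ?_, fun A hA hn => ?_, fun e he => ?_, fun Ψ hΨ => ?_,
      fun τ hτ => ?_⟩
    · cases P <;> cases hP
    · cases K <;> cases hK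
    · cases A with
      | neu P => exact absurd rfl (hn P)
      | _ => cases hA
    · cases e <;> simp only [Tm.enc, Raw.evar.injEq, reduceCtorEq] at he
      subst he
      obtain ⟨A, rfl, h1⟩ := hz.getTm rfl hs
      exact ⟨_, (Tm.enc_shift _ _ _).symm, .hit hi h1⟩
    · cases Ψ <;> cases hΨ
    · cases τ <;> cases hτ
  | @efree s d i hi =>
    intro γ σ hz
    refine ⟨fun P hP => ?_, fun K hK => ?_, fun A hA hn => ?_, fun e he => ?_, fun Ψ hΨ => ?_,
      fun τ hτ => ?_⟩
    · cases P <;> cases hP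
    · cases K <;> cases hK
    · cases A with
      | neu P => exact absurd rfl (hn P)
      | _ => cases hA
    · cases e <;> simp only [Tm.enc, Raw.evar.injEq, reduceCtorEq] at he
      subst he
      rw [hz.length_eq rfl] at hi ⊢
      exact ⟨.var _, rfl, .free hi⟩
    · cases Ψ <;> cases hΨ
    · cases τ <;> cases hτ
  | @leaf s d l =>
    intro γ σ hz
    refine ⟨fun P hP => ?_, fun K hK => ?_, fun A hA hn => ?_, fun e he => ?_, fun Ψ hΨ => ?_,
      fun τ hτ => ?_⟩
    · cases P <;> cases hP
    · cases K <;> cases hK; exact ⟨.type _, rfl, .type⟩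
    · cases A with
      | neu P => exact absurd rfl (hn P)
      | one => cases hA; exact ⟨.one _, rfl, .one⟩
      | _ => cases hA
    · cases e <;> cases he; exact ⟨.one, rfl, .one⟩
    · cases Ψ <;> cases hΨ; exact ⟨.nil, rfl, .nil⟩
    · cases τ <;> cases hτ; exact ⟨.nil, rfl, .nil⟩
  | @node s d l n a a' b b' o o' ha hb iha ihb =>
    intro γ σ hz
    have ra := iha hz
    have rb := ihb hz
    refine ⟨fun P hP => ?_, fun K hK => ?_, fun A hA hn => ?_, fun e he => ?_, fun Ψ hΨ => ?_,
      fun τ hτ => ?_⟩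
    · cases P <;> cases hP
    · cases K <;> simp only [Kind.enc, Raw.node.injEq, reduceCtorEq] at hK
      obtain ⟨rfl, rfl, rfl, rfl⟩ := hK
      obtain ⟨Ψ', rfl, h1⟩ := ra.ctx _ rfl
      obtain ⟨K', rfl, h2⟩ := rb.kind _ rfl
      exact ⟨.up _ _ Ψ' K', by rw [Kind.enc, Ctx.len_sub h1], .up h1 h2⟩
    · cases A with
      | neu P => exact absurd rfl (hn P)
      | one => cases hA
      | thunk =>
        simp only [Ty.enc, Raw.thunk, Raw.node.injEq] at hA
        obtain ⟨rfl, rfl, rfl, rfl⟩ := hA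
        obtain ⟨B, rfl, h1⟩ := rb.ty _ rfl
        cases ha
        exact ⟨.thunk _ B, rfl, .thunk h1⟩
      | up =>
        simp only [Ty.enc, Raw.node.injEq] at hA
        obtain ⟨rfl, rfl, rfl, rfl⟩ := hA
        obtain ⟨Ψ', rfl, h1⟩ := ra.ctx _ rfl
        obtain ⟨B, rfl, h2⟩ := rb.ty _ rfl
        exact ⟨.up _ _ Ψ' B, by rw [Ty.enc, Ctx.len_sub h1], .up h1 h2⟩
      | down =>
        simp only [Ty.enc, Raw.node.injEq] at hA
        obtain ⟨rfl, rfl, rfl, rfl⟩ := hA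
        obtain ⟨B, rfl, h1⟩ := rb.ty _ rfl
        cases ha
        exact ⟨.down _ _ B, rfl, .down h1⟩
      | all =>
        simp only [Ty.enc, Raw.node.injEq] at hA
        obtain ⟨rfl, rfl, rfl, rfl⟩ := hA
        obtain ⟨K', rfl, h1⟩ := ra.kind _ rfl
        obtain ⟨B, rfl, h2⟩ := rb.ty _ rfl
        exact ⟨.all K' B, rfl, .all h1 h2⟩
      | arr =>
        simp only [Ty.enc, Raw.node.injEq] at hA
        obtain ⟨rfl, rfl, rfl, rfl⟩ := hA
        obtain ⟨K', rfl, h1⟩ := ra.ty _ rfl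
        obtain ⟨B, rfl, h2⟩ := rb.ty _ rfl
        exact ⟨.arr K' B, rfl, .arr h1 h2⟩
    · cases e <;> simp only [Tm.enc, Raw.node.injEq, reduceCtorEq] at he <;>
        obtain ⟨rfl, rfl, rfl, rfl⟩ := he
      · obtain ⟨_, rfl, h1⟩ := rb.tm _ rfl
        cases ha
        exact ⟨.susp _ _ _ _, rfl, .susp h1⟩
      · obtain ⟨_, rfl, h1⟩ := ra.tm _ rfl
        obtain ⟨_, rfl, h2⟩ := rb.sbst _ rfl
        exact ⟨.force _ _ _ _ _, rfl, .force h1 h2⟩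
      · obtain ⟨_, rfl, h1⟩ := rb.tm _ rfl
        cases ha
        exact ⟨.store _ _ _, rfl, .store h1⟩
      · obtain ⟨_, rfl, h1⟩ := ra.tm _ rfl
        obtain ⟨_, rfl, h2⟩ := rb.tm _ rfl
        exact ⟨.load _ _ _ _, rfl, .load h1 h2⟩
      · obtain ⟨_, rfl, h1⟩ := ra.kind _ rfl
        obtain ⟨_, rfl, h2⟩ := rb.tm _ rfl
        exact ⟨.tlam _ _, rfl, .tlam h1 h2⟩
      · obtain ⟨_, rfl, h1⟩ := ra.tm _ rfl
        obtain ⟨_, rfl, h2⟩ := rb.ty _ rfl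
        exact ⟨.tapp _ _, rfl, .tapp h1 h2⟩
      · obtain ⟨_, rfl, h1⟩ := ra.ty _ rfl
        obtain ⟨_, rfl, h2⟩ := rb.tm _ rfl
        exact ⟨.lam _ _ _, rfl, .lam h1 h2⟩
      · obtain ⟨_, rfl, h1⟩ := ra.tm _ rfl
        obtain ⟨_, rfl, h2⟩ := rb.tm _ rfl
        exact ⟨.app _ _, rfl, .app h1 h2⟩
    · cases Ψ <;> simp only [Ctx.enc, Raw.node.injEq, reduceCtorEq] at hΨ <;>
        obtain ⟨rfl, rfl, rfl, rfl⟩ := hΨ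
      · obtain ⟨Ψ', rfl, h1⟩ := ra.ctx _ rfl
        obtain ⟨_, rfl, h2⟩ := rb.kind _ rfl
        exact ⟨.consTy Ψ' _, by rw [Ctx.enc, Ctx.len_sub h1], .consTy h1 h2⟩
      · obtain ⟨Ψ', rfl, h1⟩ := ra.ctx _ rfl
        obtain ⟨_, rfl, h2⟩ := rb.ty _ rfl
        exact ⟨.consTm Ψ' _ _, by rw [Ctx.enc, Ctx.len_sub h1], .consTm h1 h2⟩
    · cases τ <;> simp only [Sbst.enc, Raw.node.injEq, reduceCtorEq] at hτ <;>
        obtain ⟨rfl, rfl, rfl, rfl⟩ := hτ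
      · obtain ⟨Ψ', rfl, h1⟩ := ra.sbst _ rfl
        obtain ⟨_, rfl, h2⟩ := rb.ty _ rfl
        exact ⟨.consTy Ψ' _, rfl, .consTy h1 h2⟩
      · obtain ⟨Ψ', rfl, h1⟩ := ra.sbst _ rfl
        obtain ⟨_, rfl, h2⟩ := rb.tm _ rfl
        exact ⟨.consTm Ψ' _ _, rfl, .consTm h1 h2⟩
  | splice _ _ hz' _ ihP ihτ ihA =>
    intro γ σ hz
    refine ⟨fun P hP => ?_, fun K hK => ?_, fun A hA hn => ?_, fun e he => ?_, fun Ψ hΨ => ?_,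
      fun τ hτ => ?_⟩
    · cases P <;> simp only [Neu.enc, Raw.nforce.injEq, reduceCtorEq] at hP
      obtain ⟨R, h1, h2, h3⟩ := (ihP hz).neu _ hP.1
      obtain ⟨τ', rfl, h4⟩ := (ihτ hz).sbst _ hP.2
      obtain ⟨B, h5, rfl⟩ := Ty.enc_eq_thunk h1.symm
      obtain ⟨A', rfl, h6⟩ := (ihA hz').ty _ rfl
      rw [NeuRes.eq_red h2, h5] at h3
      exact ⟨.red A' _, rfl, rfl, .splice h3 h4 h6⟩
    · cases K <;> cases hK
    · cases A with
      | neu P => exact absurd rfl (hn P)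
      | _ => cases hA
    · cases e <;> cases he
    · cases Ψ <;> cases hΨ
    · cases τ <;> cases hτ
  | stuck _ hn _ ihP ihτ =>
    intro γ σ hz
    refine ⟨fun P hP => ?_, fun K hK => ?_, fun A hA hn => ?_, fun e he => ?_, fun Ψ hΨ => ?_,
      fun τ hτ => ?_⟩
    · cases P <;> simp only [Neu.enc, Raw.nforce.injEq, reduceCtorEq] at hP
      obtain ⟨R, rfl, h2, h3⟩ := (ihP hz).neu _ hP.1
      obtain ⟨τ', rfl, h4⟩ := (ihτ hz).sbst _ hP.2
      obtain ⟨Q, h5⟩ := Ty.isNeu_enc.mp hn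
      refine ⟨.neu (.force Q τ'), ?_, rfl, .stuck h3 h5 h4⟩
      rw [h5]; rfl
    · cases K <;> cases hK
    · cases A with
      | neu P => exact absurd rfl (hn P)
      | _ => cases hA
    · cases e <;> cases he
    · cases Ψ <;> cases hΨ
    · cases τ <;> cases hτ

/-! ## Erasure is invariant under shifting and substitution -/

mutual
theorem Kind.erase_shift (n : ℕ) : ∀ (d : ℕ) (K : Kind M), (Kind.shift n d K).erase = K.erase
  | _, .type _ => rfl
  | d, .up k l Ψ K => by simp [Kind.shift, Kind.erase, Ctx.erase_shift n, Kind.erase_shift n]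
theorem Ctx.erase_shift (n : ℕ) : ∀ (d : ℕ) (Ψ : Ctx M), (Ctx.shift n d Ψ).erase = Ψ.erase
  | _, .nil => rfl
  | d, .consTy Ψ K => by simp [Ctx.shift, Ctx.erase, Ctx.erase_shift n, Kind.erase_shift n]
  | d, .consTm Ψ k A => by simp [Ctx.shift, Ctx.erase, Ctx.erase_shift n]
end

-- Erasure forgets the types of term variables, the only places inside a kind where types occur.
-- Annotations therefore stay correct throughout a substitution.
mutual
theorem SubKind.erase_eq {γ : SCtx M} {σ d} : ∀ {K K' : Kind M}, SubKind γ σ d K K' →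
    K'.erase = K.erase
  | _, _, .type => rfl
  | _, _, .up h₁ h₂ => by rw [Kind.erase, Kind.erase, SubCtx.erase_eq h₁, SubKind.erase_eq h₂]
theorem SubCtx.erase_eq {γ : SCtx M} {σ d} : ∀ {Ψ Ψ' : Ctx M}, SubCtx γ σ d Ψ Ψ' →
    Ψ'.erase = Ψ.erase
  | _, _, .nil => rfl
  | _, _, .consTy h₁ h₂ => by rw [Ctx.erase, Ctx.erase, SubCtx.erase_eq h₁, SubKind.erase_eq h₂]
  | _, _, .consTm h₁ _ => by rw [Ctx.erase, Ctx.erase, SubCtx.erase_eq h₁]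
end

theorem Kind.mode_shift (n d : ℕ) (K : Kind M) : (Kind.shift n d K).mode = K.mode := by
  cases K <;> rfl

theorem SubKind.mode_eq {γ : SCtx M} {σ d K K'} (h : SubKind γ σ d K K') : K'.mode = K.mode := by
  cases h <;> rfl

theorem Ctx.len_erase : ∀ Ψ : Ctx M, Ψ.erase.len = Ψ.len
  | .nil => rfl
  | .consTy Ψ _ => congrArg (· + 1) (Ctx.len_erase Ψ)
  | .consTm Ψ _ _ => congrArg (· + 1) (Ctx.len_erase Ψ)

/-! ## Environments, pointwise -/

namespace Env

/-- `Γ` declares `E` at position `i`. -/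
def Has (Γ : Env M) (i : ℕ) (E : Entry M) : Prop := Γ[i]? = some (some E)

/-- `Γ` arises from `Γ'` by removing declarations. -/
def Le (Γ Γ' : Env M) : Prop := Γ.length = Γ'.length ∧ ∀ i E, Γ.Has i E → Γ'.Has i E

open Classical in
/-- The declarations satisfying a predicate. -/
noncomputable def filt (p : ℕ → Entry M → Prop) : Env M → Env M
  | [] => []
  | a :: Γ => a.filter (fun E => p 0 E) :: filt (fun i => p (i + 1)) Γ

@[simp] theorem not_has_nil {i : ℕ} {E : Entry M} : ¬ Has [] i E := by simp [Has]

@[simp] theorem has_zero {a : Option (Entry M)} {Γ : Env M} {E} : Has (a :: Γ) 0 E ↔ a = some E := by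
  simp [Has]

@[simp] theorem has_succ {a : Option (Entry M)} {Γ : Env M} {i E} :
    Has (a :: Γ) (i + 1) E ↔ Γ.Has i E := by
  simp [Has]

theorem Has.unique {Γ : Env M} {i E E'} (h : Γ.Has i E) (h' : Γ.Has i E') : E = E' := by
  unfold Has at *; rw [h] at h'; simpa using h'

theorem mem_iff {Γ : Env M} {E} : some E ∈ Γ ↔ ∃ i, Γ.Has i E := List.mem_iff_getElem?

@[simp] theorem length_filt (p : ℕ → Entry M → Prop) (Γ : Env M) :
    (Γ.filt p).length = Γ.length := by
  induction Γ generalizing p with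
  | nil => rfl
  | cons a Γ ih => simp [filt, ih]

@[simp] theorem has_filt {p : ℕ → Entry M → Prop} {Γ : Env M} {i E} :
    (Γ.filt p).Has i E ↔ Γ.Has i E ∧ p i E := by
  induction Γ generalizing p i with
  | nil => simp [filt]
  | cons a Γ ih =>
    cases i with
    | zero => simp [filt, Option.filter_eq_some_iff]
    | succ i => simp [filt, ih]

theorem ext_has {Γ Γ' : Env M} (hl : Γ.length = Γ'.length) (h : ∀ i E, Γ.Has i E ↔ Γ'.Has i E) :
    Γ = Γ' := by
  refine List.ext_getElem? fun i => ?_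
  by_cases hi : i < Γ.length
  · have hi' : i < Γ'.length := hl ▸ hi
    rw [List.getElem?_eq_getElem hi, List.getElem?_eq_getElem hi']
    congr 1
    have := h i
    simp only [Has, List.getElem?_eq_getElem hi, List.getElem?_eq_getElem hi',
      Option.some.injEq] at this
    exact Option.ext this
  · rw [List.getElem?_eq_none (by omega), List.getElem?_eq_none (by omega)]

theorem Le.refl (Γ : Env M) : Γ.Le Γ := ⟨rfl, fun _ _ h => h⟩

theorem Le.trans {Γ Γ' Γ'' : Env M} (h : Γ.Le Γ') (h' : Γ'.Le Γ'') : Γ.Le Γ'' :=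
  ⟨h.1.trans h'.1, fun i E hi => h'.2 i E (h.2 i E hi)⟩

theorem filt_le (p : ℕ → Entry M → Prop) (Γ : Env M) : (Γ.filt p).Le Γ :=
  ⟨length_filt p Γ, fun _ _ h => (has_filt.mp h).1⟩

theorem Le.cons {Γ Γ' : Env M} (h : Γ.Le Γ') (a) : Le (a :: Γ) (a :: Γ') := by
  refine ⟨by simp [h.1], fun i E hi => ?_⟩
  cases i with
  | zero => simpa using hi
  | succ i => exact has_succ.mpr (h.2 i E (has_succ.mp hi))

theorem Le.cons_none {Γ Γ' : Env M} (h : Γ.Le Γ') (a) : Le (none :: Γ) (a :: Γ') := by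
  refine ⟨by simp [h.1], fun i E hi => ?_⟩
  cases i with
  | zero => simp at hi
  | succ i => exact has_succ.mpr (h.2 i E (has_succ.mp hi))

theorem Le.tail {a b} {Γ Γ' : Env M} (h : Le (a :: Γ) (b :: Γ')) : Γ.Le Γ' :=
  ⟨by simpa using h.1, fun i E hi => has_succ.mp (h.2 (i + 1) E (has_succ.mpr hi))⟩

theorem Le.ext {Γ Γ' : Env M} (h : Γ.Le Γ') (Ψ : Ctx M) : (Γ.ext Ψ).Le (Γ'.ext Ψ) := by
  match Ψ with
  | .nil => exact h
  | .consTy Ψ K => exact (h.ext Ψ).cons _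
  | .consTm Ψ k A => exact (h.ext Ψ).cons _

@[simp] theorem length_tyPart (Γ : Env M) : Γ.tyPart.length = Γ.length := by
  induction Γ with
  | nil => rfl
  | cons a Γ ih => rcases a with _ | (K | ⟨k, A⟩) <;> simp [tyPart, ih]

@[simp] theorem has_tyPart {Γ : Env M} {i E} :
    Γ.tyPart.Has i E ↔ Γ.Has i E ∧ ∃ K, E = .ty K := by
  induction Γ generalizing i with
  | nil => simp [tyPart]
  | cons a Γ ih =>
    rcases a with _ | (K | ⟨k, A⟩) <;> cases i <;> simp [tyPart, ih]
    · rintro rfl; exact ⟨K, rfl⟩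
    · rintro rfl; simp

theorem tyPart_le (Γ : Env M) : Γ.tyPart.Le Γ :=
  ⟨length_tyPart Γ, fun _ _ h => (has_tyPart.mp h).1⟩

theorem Le.tyPart {Γ Γ' : Env M} (h : Γ.Le Γ') : Γ.tyPart.Le Γ'.tyPart :=
  ⟨by simp [h.1], fun i E hi => by
    rw [has_tyPart] at hi ⊢; exact ⟨h.2 i E hi.1, hi.2⟩⟩

/-- The simple environment underlying `Γ`. -/
def er (Γ : Env M) : SEnv M := fun i => Γ[i]?.join.map fun
  | .ty K => some K.erase
  | .tm _ _ => none

theorem er_eq_some {Γ : Env M} {i v} : Γ.er i = some v ↔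
    (∃ K, Γ.Has i (.ty K) ∧ v = some K.erase) ∨ (∃ k A, Γ.Has i (.tm k A) ∧ v = none) := by
  unfold er Has
  rcases Γ[i]? with _ | _ | (K | ⟨k, A⟩) <;> simp [eq_comm]

theorem er_cons_ty (Γ : Env M) (K) : er (some (.ty K) :: Γ) = SEnv.cons (some (some K.erase)) Γ.er := by
  funext i; cases i <;> rfl

theorem er_cons_tm (Γ : Env M) (k A) : er (some (.tm k A) :: Γ) = SEnv.cons (some none) Γ.er := by
  funext i; cases i <;> rfl

theorem er_ext (Γ : Env M) : ∀ Ψ : Ctx M, (Γ.ext Ψ).er = Γ.er.ext Ψ.erase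
  | .nil => rfl
  | .consTy Ψ K => by rw [ext, er_cons_ty, er_ext Γ Ψ]; rfl
  | .consTm Ψ k A => by rw [ext, er_cons_tm, er_ext Γ Ψ]; rfl

theorem Le.er {Γ Γ' : Env M} (h : Γ.Le Γ') : Γ.er.Le Γ'.er := by
  intro i v hv
  rw [er_eq_some] at hv ⊢
  rcases hv with ⟨K, h1, h2⟩ | ⟨k, A, h1, h2⟩
  · exact .inl ⟨K, h.2 _ _ h1, h2⟩
  · exact .inr ⟨k, A, h.2 _ _ h1, h2⟩

end Env

/-! ## Simple kinding over environments -/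

theorem SK.weaken {Γ Γ' : Env M} {X t} (h : SK Γ.er X t) (hl : Γ.Le Γ') : SK Γ'.er X t :=
  h.mono hl.er

theorem SK.unit {φ : SEnv M} {l : Lab M} : SK φ (.leaf l) .misc := .leaf trivial

theorem SK.binary {φ : SEnv M} {l : Lab M} {a b t₁ t₂ t} (ht : Srt.Plain t) (ha : SK φ a t₁)
    (hb : SK φ b t₂) : SK φ (.node l 0 a b) t :=
  SK.node (δ := .nil) ht ha hb

theorem SK.bindTy {φ : SEnv M} {l : Lab M} {a b t₁ t₂ t κ} (ht : Srt.Plain t) (ha : SK φ a t₁)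
    (hb : SK (SEnv.cons (some (some κ)) φ) b t₂) : SK φ (.node l 1 a b) t :=
  SK.node (δ := .consTy .nil κ) ht ha hb

theorem SK.bindTm {φ : SEnv M} {l : Lab M} {a b t₁ t₂ t} (ht : Srt.Plain t) (ha : SK φ a t₁)
    (hb : SK (SEnv.cons (some none) φ) b t₂) : SK φ (.node l 1 a b) t :=
  SK.node (δ := .consTm .nil) ht ha hb

theorem SK.bindCtx {Γ : Env M} {Ψ : Ctx M} {l : Lab M} {a b t₁ t₂ t} (ht : Srt.Plain t)
    (ha : SK Γ.er a t₁) (hb : SK (Γ.ext Ψ).er b t₂) : SK Γ.er (.node l Ψ.len a b) t := by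
  rw [← Ctx.len_erase]
  rw [Env.er_ext] at hb
  exact .node ht ha hb

theorem SK.node_inv {φ : SEnv M} {l : Lab M} {n a b k} (h : SK φ (.node l n a b) (.kd (.type k))) :
    ∃ t, SK φ a t := by
  cases h with
  | node _ h _ => exact ⟨_, h⟩

section

variable [Preorder M] {S : ModeSpec M}

theorem Env.ge_iff {Γ : Env M} {k : M} : Γ.Ge k ↔ ∀ i E, Γ.Has i E → k ≤ E.mode :=
  ⟨fun h i E hi => h E (Env.mem_iff.mpr ⟨i, hi⟩),
    fun h E hE => let ⟨i, hi⟩ := Env.mem_iff.mp hE; h i E hi⟩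

theorem Env.weak_iff {Γ : Env M} :
    Γ.Weak S ↔ ∀ i k A, Γ.Has i (.tm k A) → Rule.W ∈ S.sig k :=
  ⟨fun h i k A hi => h k A (Env.mem_iff.mpr ⟨i, hi⟩),
    fun h k A hE => let ⟨i, hi⟩ := Env.mem_iff.mp hE; h i k A hi⟩

theorem Env.Ge.le {Γ Γ' : Env M} {k : M} (h : Γ'.Ge k) (hl : Γ.Le Γ') : Γ.Ge k :=
  Env.ge_iff.mpr fun i E hi => Env.ge_iff.mp h i E (hl.2 i E hi)

theorem Env.Ge.of_le {Γ : Env M} {k l : M} (h : Γ.Ge k) (hl : l ≤ k) : Γ.Ge l :=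
  fun E hE => hl.trans (h E hE)

theorem Env.weak_tyPart (Γ : Env M) : Γ.tyPart.Weak S :=
  Env.weak_iff.mpr fun i k A hi => by simp at hi

/-- The pointwise form of a context split: two sub-environments that cover `Γ` and share a term
variable only under contraction. With it, splits are constructed by filtering declarations. -/
theorem split_iff {Γ Γ₁ Γ₂ : Env M} : Split S Γ Γ₁ Γ₂ ↔
    Γ₁.Le Γ ∧ Γ₂.Le Γ ∧ (∀ i E, Γ.Has i E → Γ₁.Has i E ∨ Γ₂.Has i E) ∧
      ∀ i k A, Γ₁.Has i (.tm k A) → Γ₂.Has i (.tm k A) → Rule.C ∈ S.sig k := by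
  constructor
  · intro h
    induction h with
    | nil => exact ⟨.refl _, .refl _, by simp, by simp⟩
    | none _ ih =>
      obtain ⟨h1, h2, h3, h4⟩ := ih
      refine ⟨h1.cons _, h2.cons _, ?_, ?_⟩ <;> (intro i; cases i <;> simp)
      · exact h3 _
      · exact h4 _
    | tyBoth _ ih =>
      obtain ⟨h1, h2, h3, h4⟩ := ih
      refine ⟨h1.cons _, h2.cons _, ?_, ?_⟩ <;> (intro i; cases i <;> simp)
      · exact h3 _
      · exact h4 _
    | tmBoth hC _ ih =>
      obtain ⟨h1, h2, h3, h4⟩ := ih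
      refine ⟨h1.cons _, h2.cons _, ?_, ?_⟩ <;> (intro i; cases i <;> simp)
      · exact h3 _
      · exact hC
      · exact h4 _
    | left _ ih =>
      obtain ⟨h1, h2, h3, h4⟩ := ih
      refine ⟨h1.cons _, h2.cons_none _, ?_, ?_⟩ <;> (intro i; cases i <;> simp)
      · exact h3 _
      · exact h4 _
    | right _ ih =>
      obtain ⟨h1, h2, h3, h4⟩ := ih
      refine ⟨h1.cons_none _, h2.cons _, ?_, ?_⟩ <;> (intro i; cases i <;> simp)
      · exact h3 _
      · exact h4 _
  · rintro ⟨h1, h2, h3, h4⟩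
    induction Γ generalizing Γ₁ Γ₂ with
    | nil =>
      obtain rfl := List.length_eq_zero_iff.mp h1.1
      obtain rfl := List.length_eq_zero_iff.mp h2.1
      exact .nil
    | cons a Γ ih =>
      obtain ⟨b, Γ₁, rfl⟩ := List.exists_cons_of_length_pos (l := Γ₁) (by rw [h1.1]; simp)
      obtain ⟨c, Γ₂, rfl⟩ := List.exists_cons_of_length_pos (l := Γ₂) (by rw [h2.1]; simp)
      have hs : Split S Γ Γ₁ Γ₂ := ih h1.tail h2.tail
        (fun i E hi => by simpa using h3 (i + 1) E (by simpa using hi))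
        (fun i k A hi hi' => h4 (i + 1) k A (by simpa using hi) (by simpa using hi'))
      have hb := fun E => h1.2 0 E
      have hc := fun E => h2.2 0 E
      have ha := fun E => h3 0 E
      have hk := fun k A => h4 0 k A
      simp only [Env.has_zero] at ha hb hc hk
      rcases b with _ | E <;> rcases c with _ | E'
      · rcases a with _ | E
        · exact .none hs
        · simpa using ha E
      · obtain rfl := hc E' rfl; exact .right hs
      · obtain rfl := hb E rfl; exact .left hs
      · obtain rfl := hb E rfl
        obtain h := hc E' rfl
        simp only [Option.some.injEq] at h
        subst h
        rcases E with K | ⟨k, A⟩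
        · exact .tyBoth hs
        · exact .tmBoth (hk k A rfl rfl) hs

theorem Split.le_left {Γ Γ₁ Γ₂ : Env M} (h : Split S Γ Γ₁ Γ₂) : Γ₁.Le Γ := (split_iff.mp h).1

theorem Split.le_right {Γ Γ₁ Γ₂ : Env M} (h : Split S Γ Γ₁ Γ₂) : Γ₂.Le Γ := (split_iff.mp h).2.1

/-- Type variables may occur in both parts at any mode, so they can be added on the right without
any condition. -/
theorem Env.Le.split_tyPart {Γ Γ₁ : Env M} (h : Γ₁.Le Γ) : Split S Γ Γ Γ₁.tyPart :=
  split_iff.mpr ⟨.refl _, (Env.tyPart_le _).trans h, fun _ _ h => .inl h, fun i k A _ h' => by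
    simp at h'⟩

/-- Every sub-environment is the left part of a split. -/
theorem Env.Le.exists_split {Γ Γ₁ : Env M} (h : Γ₁.Le Γ) : ∃ Γ₂, Split S Γ Γ₁ Γ₂ := by
  refine ⟨Γ.filt fun i E => ¬ Γ₁.Has i E, split_iff.mpr ⟨h, Env.filt_le _ _, fun i E hi => ?_,
    fun i k A h1 h2 => ?_⟩⟩
  · by_cases h1 : Γ₁.Has i E
    · exact .inl h1
    · exact .inr (Env.has_filt.mpr ⟨hi, h1⟩)
  · exact absurd h1 (Env.has_filt.mp h2).2

/-! ## Typed expressions are simply kinded -/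

-- The context `Ψ` of a contextual type or kind is checked only through well-formedness of `Γ.ext
-- Ψ`. `WfEnv.sk` is therefore stated for every way of cutting the environment into `Γ₀.ext Ψ`.
mutual
theorem WfEnv.sk {Γ : Env M} : WfEnv S Γ → ∀ {Γ₀ : Env M} {Ψ : Ctx M}, Γ = Γ₀.ext Ψ →
    SK Γ₀.er Ψ.enc .misc
  | .nil, _, Ψ, h => by
    cases Ψ <;> simp only [Env.ext, List.nil_eq, reduceCtorEq] at h; exact SK.unit
  | .none _, _, Ψ, h => by
    cases Ψ <;> simp only [Env.ext, List.cons.injEq, reduceCtorEq, false_and] at h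
    exact SK.unit
  | .consTy hs _ _ hΓ hK, _, Ψ, h => by
    cases Ψ with
    | nil => exact SK.unit
    | consTy Ψ K' =>
      simp only [Env.ext, List.cons.injEq, Option.some.injEq, Entry.ty.injEq] at h
      have ih := WfEnv.sk hΓ h.2
      have ihK := hK.sk.weaken hs.le_left
      rw [h.1, h.2] at ihK
      exact .bindCtx trivial ih ihK
    | consTm => simp [Env.ext] at h
  | .consTm hs _ _ hΓ hA, _, Ψ, h => by
    cases Ψ with
    | nil => exact SK.unit
    | consTm Ψ k A =>
      simp only [Env.ext, List.cons.injEq, Option.some.injEq, Entry.tm.injEq] at h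
      have ih := WfEnv.sk hΓ h.2
      have ihA := hA.sk.weaken hs.le_left
      rw [h.1.2, h.2] at ihA
      exact .bindCtx trivial ih ihA
    | consTy => simp [Env.ext] at h
termination_by structural h => h
theorem WfKind.sk {Γ : Env M} {K : Kind M} : WfKind S Γ K → SK Γ.er K.enc .misc
  | .type _ _ => SK.unit
  | .up _ _ _ _ hΨ hK => .bindCtx trivial (WfEnv.sk hΨ rfl) hK.sk
termination_by structural h => h
theorem HasKind.sk {Γ : Env M} {A : Ty M} {K : Kind M} :
    HasKind S Γ A K → SK Γ.er A.enc (.kd K.erase)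
  | .var _ _ _ hi => by
    rw [Kind.erase_shift]
    exact .tvar (Env.er_eq_some.mpr (.inl ⟨_, hi, rfl⟩))
  | .thunk (Ψ := Ψ) _ _ _ hA => by
    have := hA.sk
    rw [Env.er_ext] at this
    rw [Ty.enc, Kind.erase, ← Ctx.len_erase]
    exact .thunk this
  | .force _ _ _ hs _ _ _ _ hP hσ hK => by
    rw [SubKind.erase_eq hK]
    exact .nforce (hP.sk.weaken hs.le_left) (Neu.isNeu_enc _) (hσ.sk.weaken (Env.tyPart_le _))
  | .up _ _ _ _ hΨ hA => .bindCtx trivial (WfEnv.sk hΨ rfl) hA.sk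
  | .down _ _ _ hs _ _ _ hA => .binary trivial SK.unit (hA.sk.weaken hs.le_left)
  | .all _ _ _ hs _ _ _ hK hA => by
    have := hA.sk
    rw [Env.er_cons_ty] at this
    exact .bindTy trivial (hK.sk.weaken hs.le_left) this
  | .arr _ _ _ hA hB => .binary trivial hA.sk hB.sk
  | .one _ _ _ => .leaf trivial
termination_by structural h => h
theorem HasTy.sk {Γ : Env M} {e : Tm M} {k : M} {A : Ty M} :
    HasTy S Γ e k A → SK Γ.er e.enc .misc
  | .var _ _ _ hs hi _ => .evar (Env.er_eq_some.mpr (.inr ⟨_, _, hs.le_left.2 _ _ hi.1, rfl⟩))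
  | .susp _ _ _ he => .bindCtx trivial SK.unit he.sk
  | .store _ _ _ hs _ _ _ he => .binary trivial SK.unit (he.sk.weaken hs.le_left)
  | .tlam _ _ hA he => by
    -- The kind annotation of the abstraction is not checked by a premise of its own; it is a child
    -- of the type `all K A` in the presupposition.
    obtain ⟨t, ht⟩ := SK.node_inv hA.sk
    have := he.sk
    rw [Env.er_cons_ty] at this
    exact .bindTy trivial ht this
  | .lam _ _ hA he => by
    obtain ⟨t, ht⟩ := SK.node_inv hA.sk
    have := he.sk
    rw [Env.er_cons_tm] at this
    exact .bindTm trivial ht this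
  | .one _ _ _ _ => SK.unit
  | .force _ _ _ hs _ _ _ _ he hσ _ =>
    .binary trivial (he.sk.weaken hs.le_left) (hσ.sk.weaken hs.le_right)
  | .load _ _ _ hs _ _ _ _ _ he hf => by
    have := hf.sk.weaken (hs.le_right.cons _)
    rw [Env.er_cons_tm] at this
    exact .bindTm trivial (he.sk.weaken hs.le_left) this
  | .tapp _ _ _ hs _ _ _ _ he _ hA _ => .binary trivial he.sk (hA.sk.weaken hs.le_left)
  | .app _ _ _ hs _ _ _ he _ hf =>
    .binary trivial (he.sk.weaken hs.le_left) (hf.sk.weaken hs.le_right)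
termination_by structural h => h
theorem HasSbst.sk {Γ : Env M} {σ : Sbst M} {Ψ : Ctx M} :
    HasSbst S Γ σ Ψ → SK Γ.er σ.enc (.sb Ψ.erase)
  | .nil _ _ => .sbNil
  | .consTy _ hs _ hσ _ hK _ hA =>
    .sbTy hσ.sk (SubKind.erase_eq hK ▸ hA.sk.weaken hs.le_left)
  | .consTm _ hs _ _ hσ _ _ _ he => .sbTm (hσ.sk.weaken hs.le_right) (he.sk.weaken hs.le_left)
termination_by structural h => h
end

end

/-! ## Substitution on well-kinded expressions -/

/-- The converse of `RSub.reflects`, for simply kinded arguments: totality gives some result on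
trees, reflecting it gives a second instance of the relation, and functionality identifies the two.
-/
theorem SubKind.rsub {γ : SCtx M} {σ d K K' s φ₀ φ t} (h : SubKind γ σ d K K')
    (hz : Zip γ σ.enc s) (hK : SK φ₀ K.enc t) (hs : SOK φ₀ φ s d) :
    ∃ o, RSub s d K.enc K'.enc o := by
  obtain ⟨Y, o, h1, -⟩ := hK.exists_rsub _ hz.bnd hs
  obtain ⟨K'', rfl, h2⟩ := (h1.reflects hz).kind _ rfl
  rw [h.det h2]
  exact ⟨o, h1⟩

theorem SubTy.rsub {γ : SCtx M} {σ d A A' s φ₀ φ t} (h : SubTy γ σ d A A')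
    (hz : Zip γ σ.enc s) (hA : SK φ₀ A.enc t) (hs : SOK φ₀ φ s d) :
    ∃ o, RSub s d A.enc A'.enc o := by
  obtain ⟨Y, o, h1, -⟩ := hA.exists_rsub _ hz.bnd hs
  obtain ⟨K'', rfl, h2⟩ := (h1.reflects hz).ty _ rfl
  rw [h.det h2]
  exact ⟨o, h1⟩

theorem SubTm.rsub {γ : SCtx M} {σ d e e' s φ₀ φ t} (h : SubTm γ σ d e e')
    (hz : Zip γ σ.enc s) (he : SK φ₀ e.enc t) (hs : SOK φ₀ φ s d) :
    ∃ o, RSub s d e.enc e'.enc o := by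
  obtain ⟨Y, o, h1, -⟩ := he.exists_rsub _ hz.bnd hs
  obtain ⟨K'', rfl, h2⟩ := (h1.reflects hz).tm _ rfl
  rw [h.det h2]
  exact ⟨o, h1⟩

/-- Obtained from `RSub.shift_ge`; simple kinding is what permits the passage to trees. -/
theorem SubKind.shift {γ : SCtx M} {σ K K' φ t} (h : SubKind γ σ 0 K K')
    (hσ : SK φ σ.enc (.sb γ)) (hK : SK (φ.ext γ) K.enc t) (n c : ℕ) :
    SubKind γ (Sbst.shift n c σ) 0 (Kind.shift n (c + γ.len) K) (Kind.shift n c K') := by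
  obtain ⟨s, hz, hs⟩ := hσ.exists_zip rfl
  obtain ⟨o, hr⟩ := h.rsub hz hK hs
  have hr' := hr.shift_ge n c (Nat.zero_le _)
  rw [hz.length, ← Kind.enc_shift, ← Kind.enc_shift] at hr'
  have hz' := hz.shift n c
  rw [← Sbst.enc_shift] at hz'
  obtain ⟨K'', h1, h2⟩ := (hr'.reflects hz').kind _ rfl
  rwa [Kind.enc_inj h1]

theorem SubTy.shift {γ : SCtx M} {σ A A' φ t} (h : SubTy γ σ 0 A A')
    (hσ : SK φ σ.enc (.sb γ)) (hA : SK (φ.ext γ) A.enc t) (n c : ℕ) :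
    SubTy γ (Sbst.shift n c σ) 0 (Ty.shift n (c + γ.len) A) (Ty.shift n c A') := by
  obtain ⟨s, hz, hs⟩ := hσ.exists_zip rfl
  obtain ⟨o, hr⟩ := h.rsub hz hA hs
  have hr' := hr.shift_ge n c (Nat.zero_le _)
  rw [hz.length, ← Ty.enc_shift, ← Ty.enc_shift] at hr'
  have hz' := hz.shift n c
  rw [← Sbst.enc_shift] at hz'
  obtain ⟨K'', h1, h2⟩ := (hr'.reflects hz').ty _ rfl
  rwa [Ty.enc_inj h1]

theorem Ty.shift_comm (n m : ℕ) {c d : ℕ} (A : Ty M) (h : c ≤ d) :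
    Ty.shift m c (Ty.shift n d A) = Ty.shift n (d + m) (Ty.shift m c A) :=
  Ty.enc_inj (by simp only [Ty.enc_shift, Raw.shift_comm _ _ _ _ _ h])

theorem Kind.shift_comm (n m : ℕ) {c d : ℕ} (A : Kind M) (h : c ≤ d) :
    Kind.shift m c (Kind.shift n d A) = Kind.shift n (d + m) (Kind.shift m c A) :=
  Kind.enc_inj (by simp only [Kind.enc_shift, Raw.shift_comm _ _ _ _ _ h])

theorem Ty.shift_shift (n m : ℕ) {c d : ℕ} (A : Ty M) (h : d ≤ c) (h' : c ≤ d + n) :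
    Ty.shift m c (Ty.shift n d A) = Ty.shift (n + m) d A :=
  Ty.enc_inj (by simp only [Ty.enc_shift, Raw.shift_shift _ _ _ _ _ h h'])

theorem Kind.shift_shift (n m : ℕ) {c d : ℕ} (A : Kind M) (h : d ≤ c) (h' : c ≤ d + n) :
    Kind.shift m c (Kind.shift n d A) = Kind.shift (n + m) d A :=
  Kind.enc_inj (by simp only [Kind.enc_shift, Raw.shift_shift _ _ _ _ _ h h'])

/-! ## Inserting a removed position -/

def Entry.shift (d : ℕ) : Entry M → Entry M
  | .ty K => .ty (K.shift 1 d)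
  | .tm k A => .tm k (A.shift 1 d)

@[simp] theorem Entry.mode_shift (d : ℕ) (E : Entry M) : (E.shift d).mode = E.mode := by
  cases E with
  | ty K => exact Kind.mode_shift 1 d K
  | tm => rfl

/-- Insert a removed position below the `d` most recent ones. -/
def Env.ins : ℕ → Env M → Env M
  | 0, Γ => none :: Γ
  | _ + 1, [] => []
  | d + 1, a :: Γ => a.map (Entry.shift d) :: Env.ins d Γ

/-- A declaration at position `i < d` refers to the positions after `i`, so the new position appears
to it at depth `d - (i + 1)`. Declarations beyond the insertion point are unchanged. -/
theorem Env.has_ins {Γ : Env M} {d j E'} : (Γ.ins d).Has j E' ↔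
    ∃ i E, Γ.Has i E ∧ j = (if i < d then i else i + 1) ∧
      E' = if i < d then E.shift (d - (i + 1)) else E := by
  induction Γ generalizing d j with
  | nil =>
    cases d with
    | zero => cases j <;> simp [ins]
    | succ d => simp [ins]
  | cons a Γ ih =>
    cases d with
    | zero =>
      cases j with
      | zero => simp [ins]
      | succ j => simp [ins]
    | succ d =>
      cases j with
      | zero =>
        simp only [ins, has_zero]
        constructor
        · intro h
          obtain ⟨E, rfl, rfl⟩ := Option.map_eq_some_iff.mp h
          exact ⟨0, E, by simp, by simp, by simp⟩
        · rintro ⟨i, E, h1, h2, rfl⟩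
          have : i = 0 := by split_ifs at h2; omega
          subst this
          rw [has_zero.mp h1]; simp
      | succ j =>
        simp only [ins, has_succ, ih]
        constructor
        · rintro ⟨i, E, h1, rfl, rfl⟩
          refine ⟨i + 1, E, by simpa using h1, by split_ifs <;> omega, ?_⟩
          split_ifs <;> first | omega | simp
        · rintro ⟨i, E, h1, h2, rfl⟩
          cases i with
          | zero => simp at h2
          | succ i =>
            refine ⟨i, E, by simpa using h1, by split_ifs at h2 ⊢ <;> omega, ?_⟩
            split_ifs <;> first | omega | simp

theorem Env.Has.ins {Γ : Env M} {i E} (h : Γ.Has i E) (d : ℕ) :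
    (Γ.ins d).Has (if i < d then i else i + 1) (if i < d then E.shift (d - (i + 1)) else E) :=
  Env.has_ins.mpr ⟨i, E, h, rfl, rfl⟩

theorem Env.has_ins_mode {Γ : Env M} {d j E'} (h : (Γ.ins d).Has j E') :
    ∃ i E, Γ.Has i E ∧ E.mode = E'.mode := by
  obtain ⟨i, E, h1, -, rfl⟩ := Env.has_ins.mp h
  exact ⟨i, E, h1, by split_ifs <;> simp⟩

theorem Env.ext_ins (Γ : Env M) (d : ℕ) : ∀ Ψ : Ctx M,
    (Γ.ext Ψ).ins (d + Ψ.len) = (Γ.ins d).ext (Ctx.shift 1 d Ψ)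
  | .nil => rfl
  | .consTy Ψ K => by
    rw [ext, Ctx.len, ← Nat.add_assoc, ins, ext_ins Γ d Ψ, Ctx.shift, ext]; rfl
  | .consTm Ψ k A => by
    rw [ext, Ctx.len, ← Nat.add_assoc, ins, ext_ins Γ d Ψ, Ctx.shift, ext]; rfl

theorem Env.tyPart_ins (Γ : Env M) (d : ℕ) : (Γ.ins d).tyPart = Γ.tyPart.ins d := by
  induction Γ generalizing d with
  | nil => cases d <;> rfl
  | cons a Γ ih =>
    cases d with
    | zero => rfl
    | succ d => rcases a with _ | (K | ⟨k, A⟩) <;> simp [ins, tyPart, Entry.shift, ih]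

theorem Ctx.mem_ext_shift {n : ℕ} : ∀ {d : ℕ} {Ψ : Ctx M} {E},
    some E ∈ Env.ext [] (Ctx.shift n d Ψ) → ∃ E', some E' ∈ Env.ext [] Ψ ∧ E'.mode = E.mode
  | _, .nil, E, h => by simp [Ctx.shift, Env.ext] at h
  | d, .consTy Ψ K, E, h => by
    simp only [Ctx.shift, Env.ext, List.mem_cons, Option.some.injEq] at h ⊢
    rcases h with rfl | h
    · exact ⟨.ty K, .inl rfl, (Kind.mode_shift _ _ K).symm⟩
    · obtain ⟨E', h1, h2⟩ := Ctx.mem_ext_shift h; exact ⟨E', .inr h1, h2⟩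
  | d, .consTm Ψ k A, E, h => by
    simp only [Ctx.shift, Env.ext, List.mem_cons, Option.some.injEq] at h ⊢
    rcases h with rfl | h
    · exact ⟨.tm k A, .inl rfl, rfl⟩
    · obtain ⟨E', h1, h2⟩ := Ctx.mem_ext_shift h; exact ⟨E', .inr h1, h2⟩

theorem Env.Single.ins {Γ : Env M} {i E} (h : Γ.Single i E) (d : ℕ) :
    (Γ.ins d).Single (if i < d then i else i + 1) (if i < d then E.shift (d - (i + 1)) else E) := by
  refine ⟨Env.Has.ins h.1 d, fun j E' hj => ?_⟩
  obtain ⟨i', E', h1, rfl, -⟩ := Env.has_ins.mp hj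
  rw [h.2 i' E' h1]

theorem SubKind.ins {Γ : Env M} {σ : Sbst M} {Ψ : Ctx M} {K K' t}
    (h : SubKind Ψ.erase σ 0 K K') (hσ : SK Γ.er σ.enc (.sb Ψ.erase))
    (hK : SK (Γ.ext Ψ).er K.enc t) (d : ℕ) :
    SubKind (Ctx.shift 1 d Ψ).erase (Sbst.shift 1 d σ) 0 (Kind.shift 1 (d + Ψ.len) K)
      (Kind.shift 1 d K') := by
  rw [Ctx.erase_shift, ← Ctx.len_erase]
  rw [Env.er_ext] at hK
  exact h.shift hσ hK 1 d

theorem SubTy.ins {Γ : Env M} {σ : Sbst M} {Ψ : Ctx M} {A A' t}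
    (h : SubTy Ψ.erase σ 0 A A') (hσ : SK Γ.er σ.enc (.sb Ψ.erase))
    (hA : SK (Γ.ext Ψ).er A.enc t) (d : ℕ) :
    SubTy (Ctx.shift 1 d Ψ).erase (Sbst.shift 1 d σ) 0 (Ty.shift 1 (d + Ψ.len) A)
      (Ty.shift 1 d A') := by
  rw [Ctx.erase_shift, ← Ctx.len_erase]
  rw [Env.er_ext] at hA
  exact h.shift hσ hA 1 d

section

variable [Preorder M] {S : ModeSpec M}

theorem Env.Ge.ins {Γ : Env M} {k : M} (h : Γ.Ge k) (d : ℕ) : (Γ.ins d).Ge k :=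
  Env.ge_iff.mpr fun _ _ hj => let ⟨i, E, h1, h2⟩ := Env.has_ins_mode hj
    h2 ▸ Env.ge_iff.mp h i E h1

theorem Env.Weak.ins {Γ : Env M} (h : Γ.Weak S) (d : ℕ) : (Γ.ins d).Weak S := by
  refine Env.weak_iff.mpr fun j k A hj => ?_
  obtain ⟨i, E, h1, -, h2⟩ := Env.has_ins.mp hj
  cases E with
  | ty K => split_ifs at h2; cases h2
  | tm k' A' =>
    have : k = k' := by split_ifs at h2 <;> exact (Entry.tm.inj h2).1
    exact this ▸ Env.weak_iff.mp h i k' A' h1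

theorem Split.ins {Γ Γ₁ Γ₂ : Env M} (h : Split S Γ Γ₁ Γ₂) (d : ℕ) :
    Split S (Γ.ins d) (Γ₁.ins d) (Γ₂.ins d) := by
  induction h generalizing d with
  | nil => cases d <;> first | exact .none .nil | exact .nil
  | none h ih => cases d <;> first | exact .none (.none h) | exact .none (ih _)
  | tyBoth h ih => cases d <;> first | exact .none (.tyBoth h) | exact .tyBoth (ih _)
  | tmBoth hC h ih => cases d <;> first | exact .none (.tmBoth hC h) | exact .tmBoth hC (ih _)
  | left h ih => cases d <;> first | exact .none (.left h) | exact .left (ih _)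
  | right h ih => cases d <;> first | exact .none (.right h) | exact .right (ih _)

theorem Ctx.Between.shift {k l : M} {Ψ : Ctx M} (h : Ctx.Between k Ψ l) (n d : ℕ) :
    Ctx.Between k (Ctx.shift n d Ψ) l :=
  ⟨h.1, fun _ hE => let ⟨E', h1, h2⟩ := Ctx.mem_ext_shift hE; h2 ▸ h.2 E' h1⟩

theorem WfEnv.tail {a} {Γ : Env M} (h : WfEnv S (a :: Γ)) : WfEnv S Γ := by
  cases h <;> assumption

-- Presuppositions, and insertion into derivations

theorem HasKind.wf {Γ : Env M} {A K} (h : HasKind S Γ A K) : WfEnv S Γ := by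
  cases h <;> assumption

theorem HasKind.ge {Γ : Env M} {A K} (h : HasKind S Γ A K) : Γ.Ge K.mode := by
  cases h <;> assumption

theorem HasKind.wfKind {Γ : Env M} {A K} (h : HasKind S Γ A K) : WfKind S Γ K := by
  cases h <;> assumption

theorem HasTy.wf {Γ : Env M} {e k A} (h : HasTy S Γ e k A) : WfEnv S Γ := by
  cases h <;> assumption

theorem HasTy.ge {Γ : Env M} {e k A} (h : HasTy S Γ e k A) : Γ.Ge k := by
  cases h <;> assumption

theorem HasTy.hasKind {Γ : Env M} {e k A} (h : HasTy S Γ e k A) : HasKind S Γ A (.type k) := by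
  cases h <;> assumption

theorem WfKind.body_sk {Γ : Env M} {k l Ψ K} (h : WfKind S Γ (.up k l Ψ K)) :
    SK (Γ.ext Ψ).er K.enc .misc := by
  cases h with
  | up _ _ _ _ _ h => exact h.sk

theorem HasKind.up_body_sk {Γ : Env M} {k l Ψ A K} (h : HasKind S Γ (.up k l Ψ A) K) :
    ∃ t, SK (Γ.ext Ψ).er A.enc t := by
  cases h with
  | up _ _ _ _ _ h => exact ⟨_, h.sk⟩

theorem HasKind.all_body_sk {Γ : Env M} {A K K'} (h : HasKind S Γ (.all K A) K') :
    ∃ t, SK (Env.er (some (.ty K) :: Γ)) A.enc t := by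
  cases h with
  | all _ _ _ _ _ _ _ _ h => exact ⟨_, h.sk⟩

theorem WfEnv.sk_last_ty {Γ : Env M} {K} (h : WfEnv S (some (.ty K) :: Γ)) :
    SK Γ.er K.enc .misc := by
  cases h with
  | consTy hs _ _ _ h => exact h.sk.weaken hs.le_left

theorem WfEnv.sk_last_tm {Γ : Env M} {k A} (h : WfEnv S (some (.tm k A) :: Γ)) :
    ∃ t, SK Γ.er A.enc t := by
  cases h with
  | consTm hs _ _ _ h => exact ⟨_, h.sk.weaken hs.le_left⟩

-- A removed position declares nothing, so inserting one only renumbers indices: modes, splits and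
-- structural rules are unaffected. Proper weakening is treated separately and does not change
-- indices.
mutual
theorem WfEnv.ins {Γ : Env M} : WfEnv S Γ → ∀ d, WfEnv S (Γ.ins d)
  | .nil, d => by cases d <;> first | exact .none .nil | exact .nil
  | .none h, d => by
    cases d with
    | zero => exact .none (.none h)
    | succ d => exact .none (h.ins d)
  | .consTy hs hg h₁ h hK, d => by
    cases d with
    | zero => exact .none (.consTy hs hg h₁ h hK)
    | succ d =>
      exact .consTy (hs.ins d) ((Kind.mode_shift _ _ _).symm ▸ hg.ins d) (h₁.ins d) (h.ins d)
        (hK.ins d)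
  | .consTm hs hg h₁ h hA, d => by
    cases d with
    | zero => exact .none (.consTm hs hg h₁ h hA)
    | succ d => exact .consTm (hs.ins d) (hg.ins d) (h₁.ins d) (h.ins d) (hA.ins d)
termination_by structural h => h
theorem WfKind.ins {Γ : Env M} {K : Kind M} : WfKind S Γ K →
    ∀ d, WfKind S (Γ.ins d) (K.shift 1 d)
  | .type h hg, d => .type (h.ins d) (hg.ins d)
  | .up (Ψ := Ψ) h hg hb hm hΨ hK, d => by
    have h1 := hΨ.ins (d + Ψ.len)
    have h2 := hK.ins (d + Ψ.len)
    rw [Env.ext_ins] at h1 h2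
    exact .up (h.ins d) (hg.ins d) (hb.shift 1 d) ((Kind.mode_shift _ _ _).trans hm) h1 h2
termination_by structural h => h
theorem HasKind.ins {Γ : Env M} {A : Ty M} {K : Kind M} : HasKind S Γ A K →
    ∀ d, HasKind S (Γ.ins d) (A.shift 1 d) (K.shift 1 d)
  | .var (i := i) (K := K) h hg hK hi, d => by
    have h1 := h.ins d
    have h2 := hK.ins d
    have h3 := hg.ins d
    have h4 := Env.Has.ins hi d
    rw [← Kind.mode_shift 1 d] at h3
    simp only [Ty.shift, Neu.shift]
    split_ifs at h4 ⊢ with hd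
    · have e : Kind.shift 1 d (K.shift (i + 1) 0) = (K.shift 1 (d - (i + 1))).shift (i + 1) 0 := by
        rw [Kind.shift_comm _ _ _ (Nat.zero_le _)]; congr 1; omega
      rw [e] at h2 h3 ⊢
      exact .var h1 h3 h2 h4
    · have e : Kind.shift 1 d (K.shift (i + 1) 0) = K.shift (i + 1 + 1) 0 :=
        Kind.shift_shift _ _ _ (Nat.zero_le _) (by omega)
      rw [e] at h2 h3 ⊢
      exact .var h1 h3 h2 h4
  | .thunk (Ψ := Ψ) h hg hK hA, d => by
    have h2 := hA.ins (d + Ψ.len)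
    rw [Env.ext_ins] at h2
    have := HasKind.thunk (h.ins d) (hg.ins d) (hK.ins d) h2
    rwa [Ctx.len_shift] at this
  | .force (Ψ := Ψ) h hg hK hs hg₁ h₁ hΨ hK₁ hP hσ hsub, d => by
    have h1 := hΨ.ins (d + Ψ.len)
    rw [Env.ext_ins] at h1
    have h2 := hσ.ins d
    rw [← Env.tyPart_ins] at h2
    refine .force (h.ins d) ((Kind.mode_shift _ _ _).symm ▸ hg.ins d) (hK.ins d) (hs.ins d)
      (hg₁.ins d) (h₁.ins d) h1 (hK₁.ins d) (hP.ins d) h2 ?_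
    exact hsub.ins (hσ.sk.weaken (Env.tyPart_le _)) (hK₁.body_sk.weaken (hs.le_left.ext _)) d
  | .up (Ψ := Ψ) h hg hK hb hΨ hA, d => by
    have h1 := hΨ.ins (d + Ψ.len)
    have h2 := hA.ins (d + Ψ.len)
    rw [Env.ext_ins] at h1 h2
    exact .up (h.ins d) (hg.ins d) (hK.ins d) (hb.shift 1 d) h1 h2
  | .down h hg hK hs hg₁ hkm h₁ hA, d =>
    .down (h.ins d) (hg.ins d) (hK.ins d) (hs.ins d) (hg₁.ins d) hkm (h₁.ins d) (hA.ins d)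
  | .all h hg hK hs hg₁ hkm h₁ hK₁ hA, d =>
    .all (h.ins d) (hg.ins d) (hK.ins d) (hs.ins d) ((Kind.mode_shift _ _ _).symm ▸ hg₁.ins d)
      ((Kind.mode_shift _ _ _).symm ▸ hkm) (h₁.ins d) (hK₁.ins d) (hA.ins (d + 1))
  | .arr h hg hK hA hB, d => .arr (h.ins d) (hg.ins d) (hK.ins d) (hA.ins d) (hB.ins d)
  | .one h hg hK, d => .one (h.ins d) (hg.ins d) (hK.ins d)
termination_by structural h => h
theorem HasTy.ins {Γ : Env M} {e : Tm M} {k : M} {A : Ty M} : HasTy S Γ e k A →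
    ∀ d, HasTy S (Γ.ins d) (e.shift 1 d) k (A.shift 1 d)
  | .var (i := i) (A := A) h hg hA hs hi hw, d => by
    have h1 := h.ins d
    have h2 := hA.ins d
    have h4 := hi.ins d
    simp only [Tm.shift]
    split_ifs at h4 ⊢ with hd
    · have e : Ty.shift 1 d (A.shift (i + 1) 0) = (A.shift 1 (d - (i + 1))).shift (i + 1) 0 := by
        rw [Ty.shift_comm _ _ _ (Nat.zero_le _)]; congr 1; omega
      rw [e] at h2 ⊢
      exact .var h1 (hg.ins d) h2 (hs.ins d) h4 (hw.ins d)
    · have e : Ty.shift 1 d (A.shift (i + 1) 0) = A.shift (i + 1 + 1) 0 :=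
        Ty.shift_shift _ _ _ (Nat.zero_le _) (by omega)
      rw [e] at h2 ⊢
      exact .var h1 (hg.ins d) h2 (hs.ins d) h4 (hw.ins d)
  | .susp (Ψ := Ψ) h hg hA he, d => by
    have h2 := he.ins (d + Ψ.len)
    rw [Env.ext_ins] at h2
    have := HasTy.susp (h.ins d) (hg.ins d) (hA.ins d) h2
    rwa [Ctx.len_shift] at this
  | .store h hg hA hs hw hg₁ h₁ he, d =>
    .store (h.ins d) (hg.ins d) (hA.ins d) (hs.ins d) (hw.ins d) (hg₁.ins d) (h₁.ins d) (he.ins d)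
  | .tlam h hg hA he, d => .tlam (h.ins d) (hg.ins d) (hA.ins d) (he.ins (d + 1))
  | .lam h hg hA he, d => by
    have h2 := he.ins (d + 1)
    rw [← Ty.shift_comm _ _ _ (Nat.zero_le _)] at h2
    exact .lam (h.ins d) (hg.ins d) (hA.ins d) h2
  | .one h hg hA hw, d => .one (h.ins d) (hg.ins d) (hA.ins d) (hw.ins d)
  | .force (Ψ := Ψ) h hg hA' hs h₁ hg₁ hΨ hA he hσ hsub, d => by
    have h1 := hΨ.ins (d + Ψ.len)
    rw [Env.ext_ins] at h1
    obtain ⟨t, ht⟩ := hA.up_body_sk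
    have := HasTy.force (h.ins d) (hg.ins d) (hA'.ins d) (hs.ins d) (h₁.ins d) (hg₁.ins d) h1
      (hA.ins d) (he.ins d) (hσ.ins d)
      (hsub.ins (hσ.sk.weaken hs.le_right) (ht.weaken (hs.le_left.ext _)) d)
    rwa [Ctx.erase_shift] at this
  | .load h hg hB hs h₁ hg₁ hkn hx hA he hf, d => by
    have h2 := hf.ins (d + 1)
    rw [← Ty.shift_comm _ _ _ (Nat.zero_le _)] at h2
    exact .load (h.ins d) (hg.ins d) (hB.ins d) (hs.ins d) (h₁.ins d) (hg₁.ins d) hkn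
      (hx.ins (d + 1)) (hA.ins d) (he.ins d) h2
  | .tapp (K := K) (A := A) h hg hB' hs h₁ hg₁ hkm hB he hK hA hsub, d => by
    obtain ⟨t, ht⟩ := hB.all_body_sk
    have h2 := SubTy.ins (Γ := Γ) (Ψ := .consTy .nil K) hsub
      (.sbTy .sbNil (hA.sk.weaken hs.le_left)) ht d
    exact .tapp (h.ins d) (hg.ins d) (hB'.ins d) (hs.ins d) (h₁.ins d)
      ((Kind.mode_shift _ _ _).symm ▸ hg₁.ins d) ((Kind.mode_shift _ _ _).symm ▸ hkm) (hB.ins d)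
      (he.ins d) (hK.ins d) (hA.ins d) h2
  | .app h hg hB hs h₁ h₂ hAB he hA hf, d =>
    .app (h.ins d) (hg.ins d) (hB.ins d) (hs.ins d) (h₁.ins d) (h₂.ins d) (hAB.ins d) (he.ins d)
      (hA.ins d) (hf.ins d)
termination_by structural h => h
theorem HasSbst.ins {Γ : Env M} {σ : Sbst M} {Ψ : Ctx M} : HasSbst S Γ σ Ψ →
    ∀ d, HasSbst S (Γ.ins d) (σ.shift 1 d) (Ψ.shift 1 d)
  | .nil h hw, d => .nil (h.ins d) (hw.ins d)
  | .consTy (Ψ := Ψ) (K := K) hΨ hs hg hσ h₁ hsub hK hA, d => by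
    have h1 := hΨ.ins (d + Ctx.len (.consTy Ψ K))
    rw [Env.ext_ins] at h1
    exact .consTy h1 (hs.ins d) ((Kind.mode_shift _ _ _).symm ▸ hg.ins d) (hσ.ins d) (h₁.ins d)
      (hsub.ins hσ.sk hΨ.sk_last_ty d) (hK.ins d) (hA.ins d)
  | .consTm (Ψ := Ψ) (k := k) (A := A) hΨ hs hg h₂ hσ h₁ hsub hA he, d => by
    have h1 := hΨ.ins (d + Ctx.len (.consTm Ψ k A))
    rw [Env.ext_ins] at h1
    obtain ⟨t, ht⟩ := hΨ.sk_last_tm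
    exact .consTm h1 (hs.ins d) (hg.ins d) (h₂.ins d) (hσ.ins d) (h₁.ins d)
      (hsub.ins (hσ.sk.weaken hs.le_right) ht d) (hA.ins d) (he.ins d)
termination_by structural h => h
end

end

/-! ## Types do not depend on term variables -/

/-- `Γ'` arises from `Γ` by removing term variables. -/
def Env.Drop (Γ' Γ : Env M) : Prop := Γ'.Le Γ ∧ ∀ j K, Γ.Has j (.ty K) → Γ'.Has j (.ty K)

theorem Env.Drop.tyPart (Γ : Env M) : Γ.tyPart.Drop Γ :=
  ⟨Env.tyPart_le Γ, fun _ K h => Env.has_tyPart.mpr ⟨h, K, rfl⟩⟩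

theorem Env.Drop.tyPart_eq {Γ Γ' : Env M} (h : Γ'.Drop Γ) : Γ'.tyPart = Γ.tyPart := by
  refine Env.ext_has (by simp [h.1.1]) fun i E => ?_
  simp only [Env.has_tyPart]
  constructor
  · rintro ⟨h1, h2⟩; exact ⟨h.1.2 _ _ h1, h2⟩
  · rintro ⟨h1, K, rfl⟩; exact ⟨h.2 _ _ h1, K, rfl⟩

theorem Env.Drop.cons {Γ Γ' : Env M} (h : Γ'.Drop Γ) (a) : Env.Drop (a :: Γ') (a :: Γ) := by
  refine ⟨h.1.cons a, fun i K hi => ?_⟩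
  cases i with
  | zero => simpa using hi
  | succ i => exact Env.has_succ.mpr (h.2 i K (Env.has_succ.mp hi))

theorem Env.Drop.tail {a b} {Γ Γ' : Env M} (h : Env.Drop (a :: Γ') (b :: Γ)) : Γ'.Drop Γ :=
  ⟨h.1.tail, fun i K hi => Env.has_succ.mp (h.2 (i + 1) K (Env.has_succ.mpr hi))⟩

theorem Env.Drop.ext {Γ Γ' : Env M} (h : Γ'.Drop Γ) (Ψ : Ctx M) : (Γ'.ext Ψ).Drop (Γ.ext Ψ) := by
  match Ψ with
  | .nil => exact h
  | .consTy Ψ K => exact (h.ext Ψ).cons _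
  | .consTm Ψ k A => exact (h.ext Ψ).cons _

/-- The witness is the intersection of `Γ₁` and `Γ'`; it restricts the left part of a split to the
smaller environment without losing type variables. -/
theorem Env.Drop.meet {Γ Γ' Γ₁ : Env M} (h : Γ'.Drop Γ) (h₁ : Γ₁.Le Γ) :
    ∃ Γ₁' : Env M, Γ₁'.Drop Γ₁ ∧ Γ₁'.Le Γ' := by
  refine ⟨Γ₁.filt fun i E => Γ'.Has i E, ⟨Env.filt_le _ _, fun i K hi => ?_⟩, ?_, fun i E hi => ?_⟩
  · exact Env.has_filt.mpr ⟨hi, h.2 _ _ (h₁.2 _ _ hi)⟩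
  · rw [Env.length_filt, h₁.1, h.1.1]
  · exact (Env.has_filt.mp hi).2

theorem Env.Drop.exists_cons {a} {Γ Γ' : Env M} (h : Γ'.Drop (a :: Γ)) :
    ∃ (b : Option (Entry M)) (Γ'' : Env M), Γ' = b :: Γ'' ∧ Γ''.Drop Γ ∧ (b = a ∨ b = none) := by
  obtain ⟨b, Γ'', rfl⟩ := List.exists_cons_of_length_pos (l := Γ') (by rw [h.1.1]; simp)
  refine ⟨b, Γ'', rfl, h.tail, ?_⟩
  rcases b with _ | E
  · exact .inr rfl
  · exact .inl (Env.has_zero.mp (h.1.2 0 E (Env.has_zero.mpr rfl))).symm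

section

variable [Preorder M] {S : ModeSpec M}

theorem Env.Drop.exists_split {Γ Γ' Γ₁ Γ₂ : Env M} (h : Γ'.Drop Γ) (hs : Split S Γ Γ₁ Γ₂) :
    ∃ Γ₁' Γ₂' : Env M, Γ₁'.Drop Γ₁ ∧ Split S Γ' Γ₁' Γ₂' := by
  obtain ⟨Γ₁', h1, h2⟩ := h.meet hs.le_left
  obtain ⟨Γ₂', h3⟩ := h2.exists_split
  exact ⟨Γ₁', Γ₂', h1, h3⟩

-- Kinding never looks up a term variable of its environment: the substitution of a neutral type is
-- typed in `tyPart`, which removing term variables does not change. A removed term declaration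
-- simply becomes an empty position.
mutual
theorem WfEnv.drop {Γ : Env M} : WfEnv S Γ → ∀ {Γ' : Env M}, Γ'.Drop Γ → WfEnv S Γ'
  | .nil, Γ', hd => by
    obtain rfl := List.length_eq_zero_iff.mp hd.1.1; exact .nil
  | .none h, Γ', hd => by
    obtain ⟨b, Γ'', rfl, hd', rfl | rfl⟩ := hd.exists_cons <;> exact .none (h.drop hd')
  | .consTy hs hg h₁ h hK, Γ', hd => by
    obtain ⟨b, Γ'', rfl, hd', hb⟩ := hd.exists_cons
    have hb := hd.2 0 _ (Env.has_zero.mpr rfl)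
    rw [Env.has_zero] at hb
    subst hb
    obtain ⟨Γ₁', Γ₂', h1, h2⟩ := hd'.exists_split hs
    exact .consTy h2 (hg.le h1.1) (h₁.drop h1) (h.drop hd') (hK.drop h1)
  | .consTm hs hg h₁ h hA, Γ', hd => by
    obtain ⟨b, Γ'', rfl, hd', rfl | rfl⟩ := hd.exists_cons
    · obtain ⟨Γ₁', Γ₂', h1, h2⟩ := hd'.exists_split hs
      exact .consTm h2 (hg.le h1.1) (h₁.drop h1) (h.drop hd') (hA.drop h1)
    · exact .none (h.drop hd')
termination_by structural h => h
theorem WfKind.drop {Γ : Env M} {K : Kind M} : WfKind S Γ K → ∀ {Γ' : Env M}, Γ'.Drop Γ →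
    WfKind S Γ' K
  | .type h hg, _, hd => .type (h.drop hd) (hg.le hd.1)
  | .up h hg hb hm hΨ hK, _, hd =>
    .up (h.drop hd) (hg.le hd.1) hb hm (hΨ.drop (hd.ext _)) (hK.drop (hd.ext _))
termination_by structural h => h
theorem HasKind.drop {Γ : Env M} {A : Ty M} {K : Kind M} : HasKind S Γ A K →
    ∀ {Γ' : Env M}, Γ'.Drop Γ → HasKind S Γ' A K
  | .var h hg hK hi, _, hd => .var (h.drop hd) (hg.le hd.1) (hK.drop hd) (hd.2 _ _ hi)
  | .thunk h hg hK hA, _, hd => .thunk (h.drop hd) (hg.le hd.1) (hK.drop hd) (hA.drop (hd.ext _))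
  | .force h hg hK hs hg₁ h₁ hΨ hK₁ hP hσ hsub, _, hd => by
    obtain ⟨Γ₁', Γ₂', h1, h2⟩ := hd.exists_split hs
    exact .force (h.drop hd) (hg.le hd.1) (hK.drop hd) h2 (hg₁.le h1.1) (h₁.drop h1)
      (hΨ.drop (hd.ext _)) (hK₁.drop h1) (hP.drop h1) (hd.tyPart_eq ▸ hσ) hsub
  | .up h hg hK hb hΨ hA, _, hd =>
    .up (h.drop hd) (hg.le hd.1) (hK.drop hd) hb (hΨ.drop (hd.ext _)) (hA.drop (hd.ext _))
  | .down h hg hK hs hg₁ hkm h₁ hA, _, hd => by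
    obtain ⟨Γ₁', Γ₂', h1, h2⟩ := hd.exists_split hs
    exact .down (h.drop hd) (hg.le hd.1) (hK.drop hd) h2 (hg₁.le h1.1) hkm (h₁.drop h1)
      (hA.drop h1)
  | .all h hg hK hs hg₁ hkm h₁ hK₁ hA, _, hd => by
    obtain ⟨Γ₁', Γ₂', h1, h2⟩ := hd.exists_split hs
    exact .all (h.drop hd) (hg.le hd.1) (hK.drop hd) h2 (hg₁.le h1.1) hkm (h₁.drop h1)
      (hK₁.drop h1) (hA.drop (hd.cons _))
  | .arr h hg hK hA hB, _, hd =>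
    .arr (h.drop hd) (hg.le hd.1) (hK.drop hd) (hA.drop hd) (hB.drop hd)
  | .one h hg hK, _, hd => .one (h.drop hd) (hg.le hd.1) (hK.drop hd)
termination_by structural h => h
end

/-! ## Weakening -/

theorem WfEnv.cons_ty_mono {Γ Γ' : Env M} {K} (h : WfEnv S (some (.ty K) :: Γ)) (hl : Γ.Le Γ')
    (h' : WfEnv S Γ') : WfEnv S (some (.ty K) :: Γ') := by
  cases h with
  | consTy hs hg h₁ _ hK =>
    obtain ⟨Γ₂', h2⟩ := (hs.le_left.trans hl).exists_split
    exact .consTy h2 hg h₁ h' hK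

theorem WfEnv.cons_tm_mono {Γ Γ' : Env M} {k A} (h : WfEnv S (some (.tm k A) :: Γ)) (hl : Γ.Le Γ')
    (h' : WfEnv S Γ') : WfEnv S (some (.tm k A) :: Γ') := by
  cases h with
  | consTm hs hg h₁ _ hK =>
    obtain ⟨Γ₂', h2⟩ := (hs.le_left.trans hl).exists_split
    exact .consTm h2 hg h₁ h' hK

theorem WfEnv.ext_mono {Γ Γ' : Env M} (hl : Γ.Le Γ') (h' : WfEnv S Γ') :
    ∀ {Ψ : Ctx M}, WfEnv S (Γ.ext Ψ) → WfEnv S (Γ'.ext Ψ)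
  | .nil, _ => h'
  | .consTy _ _, h => h.cons_ty_mono (hl.ext _) (WfEnv.ext_mono hl h' h.tail)
  | .consTm _ _ _, h => h.cons_tm_mono (hl.ext _) (WfEnv.ext_mono hl h' h.tail)

theorem Env.Ge.cons {Γ : Env M} {k : M} {E} (h : Γ.Ge k) (hE : k ≤ E.mode) :
    Env.Ge (some E :: Γ) k := by
  intro E' hE'
  rcases List.mem_cons.mp hE' with h' | h'
  · cases h'; exact hE
  · exact h E' h'

theorem Env.Ge.head {Γ : Env M} {k : M} {E} (h : Env.Ge (some E :: Γ) k) : k ≤ E.mode :=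
  h E (by simp)

theorem Env.Ge.ext {Γ : Env M} {l : M} (h : Γ.Ge l) : ∀ {Ψ : Ctx M},
    (∀ E, some E ∈ Env.ext [] Ψ → l ≤ E.mode) → (Γ.ext Ψ).Ge l
  | .nil, _ => h
  | .consTy Ψ K, hΨ => (h.ext fun E hE => hΨ E (List.mem_cons_of_mem _ hE)).cons
      (hΨ (.ty K) (by simp [Env.ext]))
  | .consTm Ψ k A, hΨ => (h.ext fun E hE => hΨ E (List.mem_cons_of_mem _ hE)).cons
      (hΨ (.tm k A) (by simp [Env.ext]))

theorem Ctx.Between.ge_ext {k l : M} {Ψ : Ctx M} (hb : Ctx.Between k Ψ l) {Γ : Env M}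
    (h : Γ.Ge k) : (Γ.ext Ψ).Ge l :=
  (h.of_le hb.1).ext fun E hE => (hb.2 E hE).2

theorem Env.Ge.tyPart {Γ : Env M} {k : M} (h : Γ.Ge k) : Γ.tyPart.Ge k := h.le (Env.tyPart_le _)

/-- `Γ'` extends `Γ`; the additional term variables need not be used. -/
def Env.Wk (S : ModeSpec M) (Γ Γ' : Env M) : Prop :=
  Γ.Le Γ' ∧ ∀ i k A, Γ'.Has i (.tm k A) → ¬ Γ.Has i (.tm k A) → Rule.W ∈ S.sig k

theorem Env.Wk.cons {Γ Γ' : Env M} (h : Env.Wk S Γ Γ') (a) : Env.Wk S (a :: Γ) (a :: Γ') := by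
  refine ⟨h.1.cons a, fun i k A h1 h2 => ?_⟩
  cases i with
  | zero => exact absurd (by simpa using h1) h2
  | succ i => exact h.2 i k A (by simpa using h1) (by simpa using h2)

theorem Env.Wk.ext {Γ Γ' : Env M} (h : Env.Wk S Γ Γ') (Ψ : Ctx M) :
    Env.Wk S (Γ.ext Ψ) (Γ'.ext Ψ) := by
  match Ψ with
  | .nil => exact h
  | .consTy Ψ K => exact (h.ext Ψ).cons _
  | .consTm Ψ k A => exact (h.ext Ψ).cons _

theorem Env.Wk.tyPart {Γ Γ' : Env M} (h : Γ.Le Γ') : Env.Wk S Γ.tyPart Γ'.tyPart :=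
  ⟨h.tyPart, fun i k A h1 => by simp at h1⟩

theorem Env.Wk.weak {Γ Γ' : Env M} (h : Env.Wk S Γ Γ') (hw : Γ.Weak S) : Γ'.Weak S := by
  refine Env.weak_iff.mpr fun i k A hi => ?_
  by_cases h1 : Γ.Has i (.tm k A)
  · exact Env.weak_iff.mp hw i k A h1
  · exact h.2 i k A hi h1

/-- All new declarations go to the right part, so derivations over the left part are reused
verbatim. The right part also receives every type variable of `Γ'`, which makes it well formed by
`WfEnv.drop`. -/
theorem Env.Wk.exists_split {Γ Γ' Γ₁ Γ₂ : Env M} (h : Env.Wk S Γ Γ') (hs : Split S Γ Γ₁ Γ₂) :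
    ∃ Γ₂' : Env M, Split S Γ' Γ₁ Γ₂' ∧ Env.Wk S Γ₂ Γ₂' ∧ Γ₂'.Drop Γ' := by
  obtain ⟨h1, h2, h3, h4⟩ := split_iff.mp hs
  refine ⟨Γ'.filt fun i E => Γ₂.Has i E ∨ ¬ Γ₁.Has i E ∨ ∃ K, E = .ty K,
    split_iff.mpr ⟨h1.trans h.1, Env.filt_le _ _, fun i E hi => ?_, fun i k A hi hi' => ?_⟩,
    ⟨⟨by rw [Env.length_filt, h2.1, h.1.1], fun i E hi => ?_⟩, fun i k A hi hi' => ?_⟩,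
    Env.filt_le _ _, fun i K hi => ?_⟩
  · by_cases hc : Γ₁.Has i E
    · exact .inl hc
    · exact .inr (Env.has_filt.mpr ⟨hi, .inr (.inl hc)⟩)
  · rcases (Env.has_filt.mp hi').2 with hc | hc | ⟨K, hc⟩
    · exact h4 i k A hi hc
    · exact absurd hi hc
    · cases hc
  · exact Env.has_filt.mpr ⟨h.1.2 i E (h2.2 i E hi), .inl hi⟩
  · obtain ⟨h5, h6⟩ := Env.has_filt.mp hi
    rcases h6 with hc | hc | ⟨K, hc⟩
    · exact absurd hc hi'
    · exact h.2 i k A h5 fun h6 => (h3 i _ h6).elim hc hi'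
    · cases hc
  · exact Env.has_filt.mpr ⟨hi, .inr (.inr ⟨K, rfl⟩)⟩

-- Kinding consumes nothing and tolerates arbitrary additional declarations; typing requires
-- weakening for each additional term variable. In both cases the mode bound on the larger
-- environment has to be supplied.
mutual
theorem WfKind.weaken {Γ : Env M} {K : Kind M} : WfKind S Γ K → ∀ {Γ' : Env M}, Γ.Le Γ' →
    WfEnv S Γ' → Γ'.Ge K.mode → WfKind S Γ' K
  | .type _ _, _, _, h', hg' => .type h' hg'
  | .up _ _ hb hm hΨ hK, _, hl, h', hg' =>
    have hΨ' := WfEnv.ext_mono hl h' hΨ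
    .up h' hg' hb hm hΨ' (hK.weaken (hl.ext _) hΨ' (hm.symm ▸ hb.ge_ext hg'))
termination_by structural h => h
theorem HasKind.weaken {Γ : Env M} {A : Ty M} {K : Kind M} : HasKind S Γ A K →
    ∀ {Γ' : Env M}, Γ.Le Γ' → WfEnv S Γ' → Γ'.Ge K.mode → HasKind S Γ' A K
  | .var _ _ hK hi, _, hl, h', hg' => .var h' hg' (hK.weaken hl h' hg') (hl.2 _ _ hi)
  | .thunk _ _ hK hA, _, hl, h', hg' => by
    have hK' := hK.weaken hl h' hg'
    refine .thunk h' hg' hK' ?_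
    -- Well-formedness of the extended environment is not a premise of this rule; it is read off the
    -- well-formedness of the contextual kind.
    cases hK' with
    | up _ _ hb hm hΨ _ => exact hA.weaken (hl.ext _) hΨ (hm.symm ▸ hb.ge_ext hg')
  | .force _ _ hK hs hg₁ h₁ hΨ hK₁ hP hσ hsub, _, hl, h', hg' => by
    obtain ⟨Γ₂', h2⟩ := (hs.le_left.trans hl).exists_split
    exact .force h' hg' (hK.weaken hl h' hg') h2 hg₁ h₁ (WfEnv.ext_mono hl h' hΨ) hK₁ hP
      (hσ.weaken (.tyPart hl) (h'.drop (.tyPart _))) hsub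
  | .up _ _ hK hb hΨ hA, _, hl, h', hg' =>
    have hΨ' := WfEnv.ext_mono hl h' hΨ
    .up h' hg' (hK.weaken hl h' hg') hb hΨ' (hA.weaken (hl.ext _) hΨ' (hb.ge_ext hg'))
  | .down _ _ hK hs hg₁ hkm h₁ hA, _, hl, h', hg' => by
    obtain ⟨Γ₂', h2⟩ := (hs.le_left.trans hl).exists_split
    exact .down h' hg' (hK.weaken hl h' hg') h2 hg₁ hkm h₁ hA
  | .all _ _ hK hs hg₁ hkm h₁ hK₁ hA, _, hl, h', hg' => by
    obtain ⟨Γ₂', h2⟩ := (hs.le_left.trans hl).exists_split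
    exact .all h' hg' (hK.weaken hl h' hg') h2 hg₁ hkm h₁ hK₁
      (hA.weaken (hl.cons _) (hA.wf.cons_ty_mono hl h') (hg'.cons hkm))
  | .arr _ _ hK hA hB, _, hl, h', hg' =>
    .arr h' hg' (hK.weaken hl h' hg') (hA.weaken hl h' hg') (hB.weaken hl h' hg')
  | .one _ _ hK, _, hl, h', hg' => .one h' hg' (hK.weaken hl h' hg')
termination_by structural h => h
theorem HasTy.weaken {Γ : Env M} {e : Tm M} {k : M} {A : Ty M} : HasTy S Γ e k A →
    ∀ {Γ' : Env M}, Env.Wk S Γ Γ' → WfEnv S Γ' → Γ'.Ge k → HasTy S Γ' e k A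
  | .var _ _ hA hs hi hw, _, hl, h', hg' => by
    obtain ⟨Γ₂', h2, h3, -⟩ := hl.exists_split hs
    exact .var h' hg' (hA.weaken hl.1 h' hg') h2 hi (h3.weak hw)
  | .susp _ _ hA he, _, hl, h', hg' => by
    have hA' := hA.weaken hl.1 h' hg'
    refine .susp h' hg' hA' ?_
    cases hA' with
    | up _ _ _ hb hΨ _ => exact he.weaken (hl.ext _) hΨ (hb.ge_ext hg')
  | .store _ _ hA hs hw hg₁ h₁ he, _, hl, h', hg' => by
    obtain ⟨Γ₂', h2, h3, -⟩ := hl.exists_split hs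
    exact .store h' hg' (hA.weaken hl.1 h' hg') h2 (h3.weak hw) hg₁ h₁ he
  | .tlam _ _ hA he, _, hl, h', hg' =>
    .tlam h' hg' (hA.weaken hl.1 h' hg')
      (he.weaken (hl.cons _) (he.wf.cons_ty_mono hl.1 h') (hg'.cons he.ge.head))
  | .lam _ _ hA he, _, hl, h', hg' =>
    .lam h' hg' (hA.weaken hl.1 h' hg')
      (he.weaken (hl.cons _) (he.wf.cons_tm_mono hl.1 h') (hg'.cons he.ge.head))
  | .one _ _ hA hw, _, hl, h', hg' => .one h' hg' (hA.weaken hl.1 h' hg') (hl.weak hw)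
  | .force _ _ hA' hs h₁ hg₁ hΨ hA he hσ hsub, _, hl, h', hg' => by
    obtain ⟨Γ₂', h2, h3, h4⟩ := hl.exists_split hs
    have h5 := h'.drop h4
    exact .force h' hg' (hA'.weaken hl.1 h' hg') h2 h₁ hg₁ (WfEnv.ext_mono h3.1 h5 hΨ) hA he
      (hσ.weaken h3 h5) hsub
  | .load _ _ hB hs h₁ hg₁ hkn hx hA he hf, _, hl, h', hg' => by
    obtain ⟨Γ₂', h2, h3, h4⟩ := hl.exists_split hs
    have h5 := h'.drop h4
    have hx' := hx.cons_tm_mono h3.1 h5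
    exact .load h' hg' (hB.weaken hl.1 h' hg') h2 h₁ hg₁ hkn hx' hA he
      (hf.weaken (h3.cons _) hx' ((hg'.le h4.1).cons hf.ge.head))
  | .tapp _ _ hB' hs h₁ hg₁ hkm hB he hK hA hsub, _, hl, h', hg' => by
    obtain ⟨Γ₂', h2⟩ := (hs.le_left.trans hl.1).exists_split
    exact .tapp h' hg' (hB'.weaken hl.1 h' hg') h2 h₁ hg₁ hkm (hB.weaken hl.1 h' hg')
      (he.weaken hl h' hg') hK hA hsub
  | .app _ _ hB hs h₁ h₂ hAB he hA hf, _, hl, h', hg' => by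
    obtain ⟨Γ₂', h2, h3, h4⟩ := hl.exists_split hs
    have h5 := h'.drop h4
    exact .app h' hg' (hB.weaken hl.1 h' hg') h2 h₁ h5 hAB he (hA.weaken h3.1 h5 (hg'.le h4.1))
      (hf.weaken h3 h5 (hg'.le h4.1))
termination_by structural h => h
theorem HasSbst.weaken {Γ : Env M} {σ : Sbst M} {Ψ : Ctx M} : HasSbst S Γ σ Ψ →
    ∀ {Γ' : Env M}, Env.Wk S Γ Γ' → WfEnv S Γ' → HasSbst S Γ' σ Ψ
  | .nil _ hw, _, hl, h' => .nil h' (hl.weak hw)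
  | .consTy hΨ hs hg hσ h₁ hsub hK hA, _, hl, h' => by
    obtain ⟨Γ₂', h2⟩ := (hs.le_left.trans hl.1).exists_split
    exact .consTy (WfEnv.ext_mono hl.1 h' hΨ) h2 hg (hσ.weaken hl h') h₁ hsub hK hA
  | .consTm hΨ hs hg h₂ hσ h₁ hsub hA he, _, hl, h' => by
    obtain ⟨Γ₂', h2, h3, h4⟩ := hl.exists_split hs
    have h5 := h'.drop h4
    exact .consTm (WfEnv.ext_mono hl.1 h' hΨ) h2 hg h5 (hσ.weaken h3 h5) h₁ hsub hA he
termination_by structural h => h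
end

/-- Kinding is monotone in the type variables. -/
theorem HasKind.mono {Γ Γ' : Env M} {A K} (h : HasKind S Γ A K) (hl : Γ.tyPart.Le Γ')
    (h' : WfEnv S Γ') (hg : Γ'.Ge K.mode) : HasKind S Γ' A K :=
  (h.drop (.tyPart _)).weaken hl h' hg

/-! ## Restriction to high modes, and variables -/

/-- The declarations of mode at least `m`. -/
noncomputable def Env.geq (m : M) (Γ : Env M) : Env M := Γ.filt fun _ E => m ≤ E.mode

@[simp] theorem Env.has_geq {m : M} {Γ : Env M} {i E} :
    (Γ.geq m).Has i E ↔ Γ.Has i E ∧ m ≤ E.mode := Env.has_filt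

theorem Env.geq_le (m : M) (Γ : Env M) : (Γ.geq m).Le Γ := Env.filt_le _ _

theorem Env.geq_ge (m : M) (Γ : Env M) : (Γ.geq m).Ge m :=
  Env.ge_iff.mpr fun _ _ h => (Env.has_geq.mp h).2

theorem Env.Le.geq {m : M} {Γ Γ' : Env M} (h : Γ.Le Γ') (hg : Γ.Ge m) : Γ.Le (Γ'.geq m) :=
  ⟨by rw [Env.geq, Env.length_filt, h.1], fun i E hi =>
    Env.has_geq.mpr ⟨h.2 i E hi, Env.ge_iff.mp hg i E hi⟩⟩

theorem Env.geq_cons_of_le {m : M} {Γ : Env M} {E : Entry M} (h : m ≤ E.mode) :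
    Env.geq m (some E :: Γ) = some E :: Γ.geq m := by
  refine Env.ext_has (by simp [geq]) fun i E' => ?_
  cases i <;> simp
  rintro rfl; exact h

theorem Env.geq_cons_of_not_le {m : M} {Γ : Env M} {E : Entry M} (h : ¬ m ≤ E.mode) :
    Env.geq m (some E :: Γ) = none :: Γ.geq m := by
  refine Env.ext_has (by simp [geq]) fun i E' => ?_
  cases i <;> simp
  rintro rfl; exact h

theorem Env.geq_cons_none {m : M} {Γ : Env M} : Env.geq m (none :: Γ) = none :: Γ.geq m := by
  refine Env.ext_has (by simp [geq]) fun i E' => ?_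
  cases i <;> simp

/-- Mode independence: a declaration of mode `j` is checked in a sub-context of mode at least `j`,
so a surviving declaration never refers to one that has been removed. -/
theorem WfEnv.geq {Γ : Env M} (h : WfEnv S Γ) (m : M) : WfEnv S (Γ.geq m) := by
  induction Γ with
  | nil => exact .nil
  | cons a Γ ih =>
    have h' := ih h.tail
    rcases a with _ | E
    · rw [Env.geq_cons_none]; exact .none h'
    · by_cases hm : m ≤ E.mode
      · rw [Env.geq_cons_of_le hm]
        cases h with
        | consTy hs hg h₁ _ hK =>
          obtain ⟨Γ₂, h2⟩ := (hs.le_left.geq (hg.of_le hm)).exists_split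
          exact .consTy h2 hg h₁ h' hK
        | consTm hs hg h₁ _ hK =>
          obtain ⟨Γ₂, h2⟩ := (hs.le_left.geq (hg.of_le hm)).exists_split
          exact .consTm h2 hg h₁ h' hK
      · rw [Env.geq_cons_of_not_le hm]; exact .none h'

/-- The type variables of mode at least `m`. -/
noncomputable def Env.tyGeq (m : M) (Γ : Env M) : Env M := (Γ.geq m).tyPart

@[simp] theorem Env.has_tyGeq {m : M} {Γ : Env M} {i E} :
    (Γ.tyGeq m).Has i E ↔ (Γ.Has i E ∧ m ≤ E.mode) ∧ ∃ K, E = .ty K := by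
  simp [Env.tyGeq]

theorem WfEnv.tyGeq {Γ : Env M} (h : WfEnv S Γ) (m : M) : WfEnv S (Γ.tyGeq m) :=
  (h.geq m).drop (.tyPart _)

theorem Env.tyGeq_ge (m : M) (Γ : Env M) : (Γ.tyGeq m).Ge m := (Env.geq_ge m Γ).tyPart

theorem Env.tyGeq_le_cons (m : M) (Γ : Env M) (a) :
    Env.Le (none :: Γ.tyGeq m) (Env.tyGeq m (a :: Γ)) := by
  refine ⟨by simp [tyGeq, geq], fun i E hi => ?_⟩
  cases i with
  | zero => simp at hi
  | succ i => simpa using hi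

/-- By mode independence and `WfKind.drop`, the kind of a variable needs only type variables of at
least its own mode. Each later declaration adds one shift and an inclusion. -/
theorem WfEnv.wfKind_at {Γ : Env M} (h : WfEnv S Γ) : ∀ {i K}, Γ.Has i (.ty K) →
    WfKind S (Γ.tyGeq K.mode) (K.shift (i + 1) 0) := by
  induction Γ with
  | nil => intro i K hi; simp at hi
  | cons a Γ ih =>
    have hstep : ∀ {i : ℕ} {K : Kind M}, WfKind S (Env.tyGeq K.mode Γ) (Kind.shift i 0 K) →
        WfKind S (Env.tyGeq K.mode (a :: Γ)) (Kind.shift (i + 1) 0 K) := by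
      intro i K hK
      have := hK.ins 0
      rw [Kind.shift_shift _ _ _ le_rfl (Nat.zero_le _)] at this
      exact this.weaken (Env.tyGeq_le_cons _ _ _) (h.tyGeq _)
        (by rw [Kind.mode_shift]; exact Env.tyGeq_ge _ _)
    intro i K hi
    cases i with
    | zero =>
      rw [Env.has_zero] at hi
      subst hi
      apply hstep
      have hz : Kind.shift 0 0 K = K := Kind.enc_inj (by rw [Kind.enc_shift, Raw.shift_zero])
      rw [hz]
      cases h with
      | consTy hs hg h₁ h hK =>
        exact (hK.drop (.tyPart _)).weaken (hs.le_left.geq hg).tyPart (h.tyGeq _)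
          (Env.tyGeq_ge _ _)
    | succ i => exact hstep (ih h.tail (Env.has_succ.mp hi))

theorem WfEnv.hasKind_at {Γ : Env M} (h : WfEnv S Γ) : ∀ {i k A}, Γ.Has i (.tm k A) →
    HasKind S (Γ.tyGeq k) (A.shift (i + 1) 0) (.type k) := by
  induction Γ with
  | nil => intro i K A hi; simp at hi
  | cons a Γ ih =>
    have hstep : ∀ {i : ℕ} {k : M} {A : Ty M}, HasKind S (Env.tyGeq k Γ) (Ty.shift i 0 A) (.type k) →
        HasKind S (Env.tyGeq k (a :: Γ)) (Ty.shift (i + 1) 0 A) (.type k) := by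
      intro i k A hA
      have := hA.ins 0
      rw [Ty.shift_shift _ _ _ le_rfl (Nat.zero_le _)] at this
      exact this.weaken (Env.tyGeq_le_cons _ _ _) (h.tyGeq _) (Env.tyGeq_ge _ _)
    intro i k A hi
    cases i with
    | zero =>
      rw [Env.has_zero] at hi
      subst hi
      apply hstep
      have hz : Ty.shift 0 0 A = A := Ty.enc_inj (by rw [Ty.enc_shift, Raw.shift_zero])
      rw [hz]
      cases h with
      | consTm hs hg h₁ h hA =>
        exact (hA.drop (.tyPart _)).weaken (hs.le_left.geq hg).tyPart (h.tyGeq _)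
          (Env.tyGeq_ge _ _)
    | succ i => exact hstep (ih h.tail (Env.has_succ.mp hi))

theorem WfEnv.hasKind_var {Γ : Env M} (h : WfEnv S Γ) {i K} (hi : Γ.Has i (.ty K)) :
    HasKind S (Γ.tyGeq K.mode) (.neu (.var i)) (K.shift (i + 1) 0) :=
  .var (h.tyGeq _) (by rw [Kind.mode_shift]; exact Env.tyGeq_ge _ _) (h.wfKind_at hi)
    (Env.has_tyGeq.mpr ⟨⟨hi, le_rfl⟩, K, rfl⟩)

/-- The declarations that the term variable `i` of mode `k` may use. -/
noncomputable def Env.own (Γ : Env M) (i : ℕ) (k : M) : Env M :=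
  (Γ.geq k).filt fun j E => (∃ K, E = .ty K) ∨ j = i

theorem Env.has_own {Γ : Env M} {i k j E} : (Γ.own i k).Has j E ↔
    (Γ.Has j E ∧ k ≤ E.mode) ∧ ((∃ K, E = .ty K) ∨ j = i) := by
  simp [Env.own]

theorem Env.own_le (Γ : Env M) (i : ℕ) (k : M) : (Γ.own i k).Le Γ :=
  (Env.filt_le _ _).trans (Env.geq_le k Γ)

theorem WfEnv.hasTy_var {Γ : Env M} (h : WfEnv S Γ) {i k A} (hi : Γ.Has i (.tm k A)) :
    HasTy S (Γ.own i k) (.var i) k (A.shift (i + 1) 0) := by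
  have hd : (Γ.own i k).Drop (Γ.geq k) := ⟨Env.filt_le _ _, fun j K hj =>
    Env.has_filt.mpr ⟨hj, .inl ⟨K, rfl⟩⟩⟩
  have hw := (h.geq k).drop hd
  have hl : (Γ.own i k).length = Γ.length := (Env.own_le Γ i k).1
  have hg : (Γ.own i k).Ge k := (Env.geq_ge k Γ).le hd.1
  have hi' : (Γ.own i k).Has i (.tm k A) := Env.has_own.mpr ⟨⟨hi, le_rfl⟩, .inr rfl⟩
  refine .var (Γ₀ := (Γ.own i k).filt fun j _ => j = i) (ΓW := (Γ.own i k).tyPart) hw hg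
    ((h.hasKind_at hi).weaken ⟨by simp [Env.tyGeq, Env.own], fun j E hj => ?_⟩ hw hg)
    (split_iff.mpr ⟨Env.filt_le _ _, Env.tyPart_le _, fun j E hj => ?_, fun j k' A' _ hj => ?_⟩)
    ⟨Env.has_filt.mpr ⟨hi', rfl⟩, fun j E hj => (Env.has_filt.mp hj).2⟩ (Env.weak_tyPart _)
  · obtain ⟨h1, h2⟩ := Env.has_tyGeq.mp hj
    exact Env.has_own.mpr ⟨h1, .inl h2⟩
  · rcases (Env.has_own.mp hj).2 with h1 | h1
    · exact .inr (Env.has_tyPart.mpr ⟨hj, h1⟩)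
    · exact .inl (Env.has_filt.mpr ⟨hj, h1⟩)
  · simp at hj

end

/-! ## Inversion of substitution on encoded expressions -/

section

variable {s : ASub M} {d : ℕ} {o : Option (SKind M)}

theorem RSub.kind_up {k l : M} {Ψ : Ctx M} {K X : Kind M}
    (h : RSub s d (Kind.up k l Ψ K).enc X.enc o) : ∃ Ψ' K' o₁ o₂, X = .up k l Ψ' K' ∧
      Ψ'.len = Ψ.len ∧ RSub s d Ψ.enc Ψ'.enc o₁ ∧ RSub s (d + Ψ.len) K.enc K'.enc o₂ := by
  -- Case analysis needs a variable as the resulting tree; the expression `X` is recovered from its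
  -- encoding afterwards.
  generalize hY : X.enc = Y at h
  cases h with | node h1 h2 =>
  cases X with
  | up =>
    simp only [Kind.enc, Raw.node.injEq, Lab.kUp.injEq] at hY
    obtain ⟨⟨rfl, rfl⟩, hl, rfl, rfl⟩ := hY
    exact ⟨_, _, _, _, rfl, hl, h1, h2⟩
  | _ => cases hY

theorem RSub.kind_type {k : M} {X : Kind M} (h : RSub s d (Kind.type k).enc X.enc o) :
    X = .type k := by
  generalize hY : X.enc = Y at h
  cases h
  exact Kind.enc_inj hY

theorem RSub.kind_mode {K K' : Kind M} (h : RSub s d K.enc K'.enc o) : K'.mode = K.mode := by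
  cases K with
  | type => rw [h.kind_type]
  | up => obtain ⟨_, _, _, _, rfl, -⟩ := h.kind_up; rfl

theorem RSub.ty_one {k : M} {X : Ty M} (h : RSub s d (Ty.one k).enc X.enc o) : X = .one k := by
  generalize hY : X.enc = Y at h
  cases h
  exact Ty.enc_inj hY

theorem RSub.ty_up {k l : M} {Ψ : Ctx M} {A X : Ty M}
    (h : RSub s d (Ty.up k l Ψ A).enc X.enc o) : ∃ Ψ' A' o₁ o₂, X = .up k l Ψ' A' ∧
      Ψ'.len = Ψ.len ∧ RSub s d Ψ.enc Ψ'.enc o₁ ∧ RSub s (d + Ψ.len) A.enc A'.enc o₂ := by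
  generalize hY : X.enc = Y at h
  cases h with | node h1 h2 =>
  cases X with
  | neu => exact absurd hY Neu.enc_eq_node
  | up =>
    simp only [Ty.enc, Raw.node.injEq, Lab.tUp.injEq] at hY
    obtain ⟨⟨rfl, rfl⟩, hl, rfl, rfl⟩ := hY
    exact ⟨_, _, _, _, rfl, hl, h1, h2⟩
  | _ => cases hY

theorem RSub.ty_thunk {b : ℕ} {A X : Ty M} (h : RSub s d (Ty.thunk b A).enc X.enc o) :
    ∃ A' o₁, X = .thunk b A' ∧ RSub s (d + b) A.enc A'.enc o₁ := by
  generalize hY : X.enc = Y at h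
  cases h with | node h1 h2 =>
  cases h1
  obtain ⟨B, rfl, rfl⟩ := Ty.enc_eq_thunk hY
  exact ⟨_, _, rfl, h2⟩

theorem RSub.ty_down {m k : M} {A X : Ty M} (h : RSub s d (Ty.down m k A).enc X.enc o) :
    ∃ A' o₁, X = .down m k A' ∧ RSub s d A.enc A'.enc o₁ := by
  generalize hY : X.enc = Y at h
  cases h with | node h1 h2 =>
  cases X with
  | neu => exact absurd hY Neu.enc_eq_node
  | down =>
    simp only [Ty.enc, Raw.node.injEq, Lab.down.injEq] at hY
    obtain ⟨⟨rfl, rfl⟩, -, -, rfl⟩ := hY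
    exact ⟨_, _, rfl, h2⟩
  | _ => cases hY

theorem RSub.ty_all {K : Kind M} {A X : Ty M} (h : RSub s d (Ty.all K A).enc X.enc o) :
    ∃ K' A' o₁ o₂, X = .all K' A' ∧ RSub s d K.enc K'.enc o₁ ∧
      RSub s (d + 1) A.enc A'.enc o₂ := by
  generalize hY : X.enc = Y at h
  cases h with | node h1 h2 =>
  cases X with
  | neu => exact absurd hY Neu.enc_eq_node
  | all =>
    simp only [Ty.enc, Raw.node.injEq] at hY
    obtain ⟨-, -, rfl, rfl⟩ := hY
    exact ⟨_, _, _, _, rfl, h1, h2⟩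
  | _ => cases hY

theorem RSub.ty_arr {A B X : Ty M} (h : RSub s d (Ty.arr A B).enc X.enc o) :
    ∃ A' B' o₁ o₂, X = .arr A' B' ∧ RSub s d A.enc A'.enc o₁ ∧ RSub s d B.enc B'.enc o₂ := by
  generalize hY : X.enc = Y at h
  cases h with | node h1 h2 =>
  cases X with
  | neu => exact absurd hY Neu.enc_eq_node
  | arr =>
    simp only [Ty.enc, Raw.node.injEq] at hY
    obtain ⟨-, -, rfl, rfl⟩ := hY
    exact ⟨_, _, _, _, rfl, h1, h2⟩
  | _ => cases hY

theorem RSub.ctx_nil {X : Ctx M} (h : RSub s d Ctx.nil.enc X.enc o) : X = .nil := by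
  generalize hY : X.enc = Y at h
  cases h
  exact Ctx.enc_inj hY

theorem RSub.ctx_ty {Ψ X : Ctx M} {K} (h : RSub s d (Ctx.consTy Ψ K).enc X.enc o) :
    ∃ Ψ' K' o₁ o₂, X = .consTy Ψ' K' ∧ Ψ'.len = Ψ.len ∧ RSub s d Ψ.enc Ψ'.enc o₁ ∧
      RSub s (d + Ψ.len) K.enc K'.enc o₂ := by
  generalize hY : X.enc = Y at h
  cases h with | node h1 h2 =>
  cases X with
  | consTy =>
    simp only [Ctx.enc, Raw.node.injEq] at hY
    obtain ⟨-, hl, rfl, rfl⟩ := hY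
    exact ⟨_, _, _, _, rfl, hl, h1, h2⟩
  | _ => cases hY

theorem RSub.ctx_tm {Ψ X : Ctx M} {k A} (h : RSub s d (Ctx.consTm Ψ k A).enc X.enc o) :
    ∃ Ψ' A' o₁ o₂, X = .consTm Ψ' k A' ∧ Ψ'.len = Ψ.len ∧ RSub s d Ψ.enc Ψ'.enc o₁ ∧
      RSub s (d + Ψ.len) A.enc A'.enc o₂ := by
  generalize hY : X.enc = Y at h
  cases h with | node h1 h2 =>
  cases X with
  | consTm =>
    simp only [Ctx.enc, Raw.node.injEq, Lab.cTm.injEq] at hY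
    obtain ⟨rfl, hl, rfl, rfl⟩ := hY
    exact ⟨_, _, _, _, rfl, hl, h1, h2⟩
  | _ => cases hY

theorem RSub.sbst_nil {X : Sbst M} (h : RSub s d Sbst.nil.enc X.enc o) : X = .nil := by
  generalize hY : X.enc = Y at h
  cases h
  exact Sbst.enc_inj hY

theorem RSub.sbst_ty {τ X : Sbst M} {A} (h : RSub s d (Sbst.consTy τ A).enc X.enc o) :
    ∃ τ' A' o₁ o₂, X = .consTy τ' A' ∧ RSub s d τ.enc τ'.enc o₁ ∧ RSub s d A.enc A'.enc o₂ := by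
  generalize hY : X.enc = Y at h
  cases h with | node h1 h2 =>
  cases X with
  | consTy =>
    simp only [Sbst.enc, Raw.node.injEq] at hY
    obtain ⟨-, -, rfl, rfl⟩ := hY
    exact ⟨_, _, _, _, rfl, h1, h2⟩
  | _ => cases hY

theorem RSub.sbst_tm {τ X : Sbst M} {k e} (h : RSub s d (Sbst.consTm τ k e).enc X.enc o) :
    ∃ τ' e' o₁ o₂, X = .consTm τ' k e' ∧ RSub s d τ.enc τ'.enc o₁ ∧ RSub s d e.enc e'.enc o₂ := by
  generalize hY : X.enc = Y at h
  cases h with | node h1 h2 =>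
  cases X with
  | consTm =>
    simp only [Sbst.enc, Raw.node.injEq, Lab.sTm.injEq] at hY
    obtain ⟨rfl, -, rfl, rfl⟩ := hY
    exact ⟨_, _, _, _, rfl, h1, h2⟩
  | _ => cases hY

theorem RSub.tm_one {X : Tm M} (h : RSub s d Tm.one.enc X.enc o) : X = .one := by
  generalize hY : X.enc = Y at h
  cases h
  exact Tm.enc_inj hY

theorem RSub.tm_susp {k l : M} {n : ℕ} {e X : Tm M} (h : RSub s d (Tm.susp k l n e).enc X.enc o) :
    ∃ e' o₁, X = .susp k l n e' ∧ RSub s (d + n) e.enc e'.enc o₁ := by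
  generalize hY : X.enc = Y at h
  cases h with | node h1 h2 =>
  cases X with
  | susp =>
    simp only [Tm.enc, Raw.node.injEq, Lab.susp.injEq] at hY
    obtain ⟨⟨rfl, rfl⟩, rfl, -, rfl⟩ := hY
    exact ⟨_, _, rfl, h2⟩
  | _ => cases hY

theorem RSub.tm_store {m k : M} {e X : Tm M} (h : RSub s d (Tm.store m k e).enc X.enc o) :
    ∃ e' o₁, X = .store m k e' ∧ RSub s d e.enc e'.enc o₁ := by
  generalize hY : X.enc = Y at h
  cases h with | node h1 h2 =>
  cases X with
  | store =>
    simp only [Tm.enc, Raw.node.injEq, Lab.store.injEq] at hY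
    obtain ⟨⟨rfl, rfl⟩, -, -, rfl⟩ := hY
    exact ⟨_, _, rfl, h2⟩
  | _ => cases hY

theorem RSub.tm_force {m k : M} {e X : Tm M} {δ τ}
    (h : RSub s d (Tm.force m k e δ τ).enc X.enc o) :
    ∃ e' τ' o₁ o₂, X = .force m k e' δ τ' ∧ RSub s d e.enc e'.enc o₁ ∧
      RSub s d τ.enc τ'.enc o₂ := by
  generalize hY : X.enc = Y at h
  cases h with | node h1 h2 =>
  cases X with
  | force =>
    simp only [Tm.enc, Raw.node.injEq, Lab.eForce.injEq] at hY
    obtain ⟨⟨rfl, rfl, rfl⟩, -, rfl, rfl⟩ := hY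
    exact ⟨_, _, _, _, rfl, h1, h2⟩
  | _ => cases hY

theorem RSub.tm_load {m k : M} {e f X : Tm M} (h : RSub s d (Tm.load m k e f).enc X.enc o) :
    ∃ e' f' o₁ o₂, X = .load m k e' f' ∧ RSub s d e.enc e'.enc o₁ ∧
      RSub s (d + 1) f.enc f'.enc o₂ := by
  generalize hY : X.enc = Y at h
  cases h with | node h1 h2 =>
  cases X with
  | load =>
    simp only [Tm.enc, Raw.node.injEq, Lab.load.injEq] at hY
    obtain ⟨⟨rfl, rfl⟩, -, rfl, rfl⟩ := hY
    exact ⟨_, _, _, _, rfl, h1, h2⟩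
  | _ => cases hY

theorem RSub.tm_tlam {K : Kind M} {e X : Tm M} (h : RSub s d (Tm.tlam K e).enc X.enc o) :
    ∃ K' e' o₁ o₂, X = .tlam K' e' ∧ RSub s d K.enc K'.enc o₁ ∧
      RSub s (d + 1) e.enc e'.enc o₂ := by
  generalize hY : X.enc = Y at h
  cases h with | node h1 h2 =>
  cases X with
  | tlam =>
    simp only [Tm.enc, Raw.node.injEq] at hY
    obtain ⟨-, -, rfl, rfl⟩ := hY
    exact ⟨_, _, _, _, rfl, h1, h2⟩
  | _ => cases hY

theorem RSub.tm_tapp {e X : Tm M} {A} (h : RSub s d (Tm.tapp e A).enc X.enc o) :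
    ∃ e' A' o₁ o₂, X = .tapp e' A' ∧ RSub s d e.enc e'.enc o₁ ∧ RSub s d A.enc A'.enc o₂ := by
  generalize hY : X.enc = Y at h
  cases h with | node h1 h2 =>
  cases X with
  | tapp =>
    simp only [Tm.enc, Raw.node.injEq] at hY
    obtain ⟨-, -, rfl, rfl⟩ := hY
    exact ⟨_, _, _, _, rfl, h1, h2⟩
  | _ => cases hY

theorem RSub.tm_lam {k : M} {A : Ty M} {e X : Tm M} (h : RSub s d (Tm.lam k A e).enc X.enc o) :
    ∃ A' e' o₁ o₂, X = .lam k A' e' ∧ RSub s d A.enc A'.enc o₁ ∧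
      RSub s (d + 1) e.enc e'.enc o₂ := by
  generalize hY : X.enc = Y at h
  cases h with | node h1 h2 =>
  cases X with
  | lam =>
    simp only [Tm.enc, Raw.node.injEq, Lab.lam.injEq] at hY
    obtain ⟨rfl, -, rfl, rfl⟩ := hY
    exact ⟨_, _, _, _, rfl, h1, h2⟩
  | _ => cases hY

theorem RSub.tm_app {e f X : Tm M} (h : RSub s d (Tm.app e f).enc X.enc o) :
    ∃ e' f' o₁ o₂, X = .app e' f' ∧ RSub s d e.enc e'.enc o₁ ∧ RSub s d f.enc f'.enc o₂ := by
  generalize hY : X.enc = Y at h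
  cases h with | node h1 h2 =>
  cases X with
  | app =>
    simp only [Tm.enc, Raw.node.injEq] at hY
    obtain ⟨-, -, rfl, rfl⟩ := hY
    exact ⟨_, _, _, _, rfl, h1, h2⟩
  | _ => cases hY

theorem RSub.ty_det {X : Raw M} {A A' : Ty M} {o' : Option (SKind M)} (h : RSub s d X A.enc o)
    (h' : RSub s d X A'.enc o') : A = A' := Ty.enc_inj (h.det h').1

theorem RSub.kind_det {X : Raw M} {A A' : Kind M} {o' : Option (SKind M)}
    (h : RSub s d X A.enc o) (h' : RSub s d X A'.enc o') : A = A' := Kind.enc_inj (h.det h').1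

theorem RSub.tm_det {X : Raw M} {A A' : Tm M} {o' : Option (SKind M)} (h : RSub s d X A.enc o)
    (h' : RSub s d X A'.enc o') : A = A' := Tm.enc_inj (h.det h').1

end

/-! ## Substitutions between environments -/

/-- The image of the term variable `i` of `Θ₀`, which is typed in `T i`, uses `p`. -/
def Uses (Θ₀ : Env M) (T : ℕ → Env M) (i p : ℕ) : Prop :=
  (∃ k A, Θ₀.Has i (.tm k A)) ∧ ∃ k A, (T i).Has p (.tm k A)

/-- The resources of the images under one more binder. -/
def liftRes (Γ : Env M) (T : ℕ → Env M) : ℕ → Env M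
  | 0 => Γ
  | i + 1 => none :: T i

theorem uses_succ {Θ₀ : Env M} {T : ℕ → Env M} {a} {Γ : Env M} {i p} :
    Uses (a :: Θ₀) (liftRes Γ T) (i + 1) (p + 1) ↔ Uses Θ₀ T i p := by
  simp [Uses, liftRes]

theorem not_uses_succ_zero {Θ₀ : Env M} {T : ℕ → Env M} {a} {Γ : Env M} {i} :
    ¬ Uses (a :: Θ₀) (liftRes Γ T) (i + 1) 0 := by
  simp [Uses, liftRes]

theorem Uses.mono {Γ₁ Θ₀ : Env M} {T : ℕ → Env M} (hl : Γ₁.Le Θ₀) {i p}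
    (h : Uses Γ₁ T i p) : Uses Θ₀ T i p :=
  ⟨let ⟨k, A, h⟩ := h.1; ⟨k, A, hl.2 _ _ h⟩, h.2⟩

theorem Env.Le.none_tyPart {Θ₁ Θ : Env M} (h : Θ₁.Le Θ.tyPart) (b : Option (Entry M)) :
    Env.Le (none :: Θ₁) (Env.tyPart (b :: Θ)) := by
  rcases b with _ | (K | ⟨k, A⟩) <;> exact h.cons_none _

theorem Kind.enc_shift_succ (K : Kind M) (i : ℕ) :
    (Kind.shift (i + 1 + 1) 0 K).enc = (Kind.shift (i + 1) 0 K).enc.shift 1 0 := by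
  rw [← Kind.enc_shift, Kind.shift_shift _ _ _ le_rfl (Nat.zero_le _)]

theorem Ty.enc_shift_succ (K : Ty M) (i : ℕ) :
    (Ty.shift (i + 1 + 1) 0 K).enc = (Ty.shift (i + 1) 0 K).enc.shift 1 0 := by
  rw [← Ty.enc_shift, Ty.shift_shift _ _ _ le_rfl (Nat.zero_le _)]

section

variable [Preorder M] {S : ModeSpec M}

/-- `s` maps the type variables of `Θ₀` to types over `Θ`. -/
def TyImg (S : ModeSpec M) (s : ASub M) (d : ℕ) (Θ₀ Θ : Env M) : Prop :=
  ∀ i K, Θ₀.Has i (.ty K) → ∃ A K' Θ₁ o o', RSub s d (.tvar i) (Ty.enc A) o ∧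
    RSub s d (Kind.shift (i + 1) 0 K).enc (Kind.enc K') o' ∧ Env.Le Θ₁ Θ.tyPart ∧
    HasKind S Θ₁ A K'

/-- `s` maps the term variables of `Θ₀` to terms over `Θ`, where the image of the `i`-th variable
is typed in `T i`. -/
structure TmImg (S : ModeSpec M) (s : ASub M) (d : ℕ) (Θ₀ Θ : Env M) (T : ℕ → Env M) : Prop where
  tm : ∀ i k A, Θ₀.Has i (.tm k A) → ∃ e A' o o', RSub s d (.evar i) (Tm.enc e) o ∧
    RSub s d (Ty.shift (i + 1) 0 A).enc (Ty.enc A') o' ∧ (T i).Le Θ ∧ HasTy S (T i) e k A'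
  contr : ∀ p k A, Θ.Has p (.tm k A) → ∀ i j, Uses Θ₀ T i p → Uses Θ₀ T j p → i ≠ j →
    Rule.C ∈ S.sig k
  weak : ∀ p k A, Θ.Has p (.tm k A) → (∀ i, ¬ Uses Θ₀ T i p) → Rule.W ∈ S.sig k

/-- `s` at depth `d` substitutes types over `Θ` for the type variables of `Θ₀`; its kind
annotations have size at most `N`. -/
structure GoodTy (S : ModeSpec M) (N : ℕ) (s : ASub M) (d : ℕ) (Θ₀ Θ : Env M) (φ₀ φ : SEnv M) :
    Prop where
  zip : ∃ γ σ, Zip γ (Sbst.enc σ) s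
  bnd : s.Bnd N
  er : Θ₀.er.Le φ₀
  ok : SOK φ₀ φ s d
  ty : TyImg S s d Θ₀ Θ

/-- Like `GoodTy`, and `s` also substitutes terms for the term variables. -/
structure Good (S : ModeSpec M) (N : ℕ) (s : ASub M) (d : ℕ) (Θ₀ Θ : Env M) (φ₀ φ : SEnv M)
    (T : ℕ → Env M) : Prop extends GoodTy S N s d Θ₀ Θ φ₀ φ, TmImg S s d Θ₀ Θ T

variable {N d : ℕ} {s : ASub M} {Θ₀ Θ : Env M} {φ₀ φ : SEnv M} {T : ℕ → Env M}

theorem TyImg.le {Θ' Θ₁ : Env M} (h : TyImg S s d Θ₀ Θ) (h₀ : Θ₁.Le Θ₀) (hl : Θ.tyPart.Le Θ') :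
    TyImg S s d Θ₁ Θ' := by
  intro i K hi
  obtain ⟨A, K', Θ₂, o, o', h1, h2, h3, h4⟩ := h i K (h₀.2 _ _ hi)
  refine ⟨A, K', Θ₂, o, o', h1, h2, ⟨by simpa using h3.1.trans hl.1, fun j E hj => ?_⟩, h4⟩
  have := h3.2 j E hj
  exact Env.has_tyPart.mpr ⟨hl.2 _ _ this, (Env.has_tyPart.mp this).2⟩

/-- Substitution preserves the mode of a kind. The presupposition of kinding then confines the image
of a variable of mode at least `m` to declarations of mode at least `m`. -/
theorem TyImg.geq {Θ₁ : Env M} {m : M} (h : TyImg S s d Θ₀ Θ) (h₀ : Θ₁.Le Θ₀) (hg : Θ₁.Ge m) :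
    TyImg S s d Θ₁ (Θ.geq m) := by
  intro i K hi
  obtain ⟨A, K', Θ₂, o, o', h1, h2, h3, h4⟩ := h i K (h₀.2 _ _ hi)
  refine ⟨A, K', Θ₂, o, o', h1, h2, ⟨by simpa [Env.geq] using h3.1, fun j E hj => ?_⟩, h4⟩
  have h5 := h3.2 j E hj
  rw [Env.has_tyPart] at h5 ⊢
  have h6 := Env.ge_iff.mp h4.ge j E hj
  rw [h2.kind_mode, Kind.mode_shift] at h6
  exact ⟨Env.has_geq.mpr ⟨h5.1, (Env.ge_iff.mp hg i _ hi).trans h6⟩, h5.2⟩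

/-- The simple environments `φ₀` and `φ` remain fixed while splits shrink `Θ₀` and `Θ`. Totality and
commutation thus keep applying without any new check of the substitution. -/
theorem GoodTy.le {Θ' Θ₁ : Env M} (h : GoodTy S N s d Θ₀ Θ φ₀ φ) (h₀ : Θ₁.Le Θ₀)
    (hl : Θ.tyPart.Le Θ') : GoodTy S N s d Θ₁ Θ' φ₀ φ :=
  ⟨h.zip, h.bnd, fun i v hv => h.er i v (h₀.er i v hv), h.ok, h.ty.le h₀ hl⟩

theorem GoodTy.geq {Θ₁ : Env M} {m : M} (h : GoodTy S N s d Θ₀ Θ φ₀ φ) (h₀ : Θ₁.Le Θ₀)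
    (hg : Θ₁.Ge m) : GoodTy S N s d Θ₁ (Θ.geq m) φ₀ φ :=
  ⟨h.zip, h.bnd, fun i v hv => h.er i v (h₀.er i v hv), h.ok, h.ty.geq h₀ hg⟩

/-- With all term variables gone the conditions on resources are vacuous, so `T` is arbitrary. -/
theorem GoodTy.tyPart (h : GoodTy S N s d Θ₀ Θ φ₀ φ) :
    Good S N s d Θ₀.tyPart Θ.tyPart φ₀ φ T :=
  { h.le (Env.tyPart_le _) (Env.Le.refl _) with
    tm := fun i k A hi => by simp at hi
    contr := fun p k A hp => by simp at hp
    weak := fun p k A hp => by simp at hp }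

/-! ### Existence of substitution instances -/

theorem GoodTy.exists_ty (h : GoodTy S N s d Θ₀ Θ φ₀ φ) {A : Ty M} {t} (hA : SK φ₀ A.enc t) :
    ∃ A' o, RSub s d A.enc (Ty.enc A') o := by
  obtain ⟨γ, σ, hz⟩ := h.zip
  obtain ⟨Y, o, h1, -⟩ := hA.exists_rsub _ h.bnd h.ok
  obtain ⟨A', rfl, -⟩ := (h1.reflects hz).ty _ rfl
  exact ⟨A', o, h1⟩

theorem GoodTy.exists_kind (h : GoodTy S N s d Θ₀ Θ φ₀ φ) {A : Kind M} {t}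
    (hA : SK φ₀ A.enc t) : ∃ A' o, RSub s d A.enc (Kind.enc A') o := by
  obtain ⟨γ, σ, hz⟩ := h.zip
  obtain ⟨Y, o, h1, -⟩ := hA.exists_rsub _ h.bnd h.ok
  obtain ⟨A', rfl, -⟩ := (h1.reflects hz).kind _ rfl
  exact ⟨A', o, h1⟩

theorem GoodTy.exists_sbst (h : GoodTy S N s d Θ₀ Θ φ₀ φ) {A : Sbst M} {t}
    (hA : SK φ₀ A.enc t) : ∃ A' o, RSub s d A.enc (Sbst.enc A') o := by
  obtain ⟨γ, σ, hz⟩ := h.zip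
  obtain ⟨Y, o, h1, -⟩ := hA.exists_rsub _ h.bnd h.ok
  obtain ⟨A', rfl, -⟩ := (h1.reflects hz).sbst _ rfl
  exact ⟨A', o, h1⟩

theorem GoodTy.kind_erase (h : GoodTy S N s d Θ₀ Θ φ₀ φ) {d'} {K K' : Kind M} {o}
    (hK : RSub s d' K.enc K'.enc o) : K'.erase = K.erase := by
  obtain ⟨γ, σ, hz⟩ := h.zip
  obtain ⟨K'', h1, h2⟩ := (hK.reflects hz).kind _ rfl
  rw [Kind.enc_inj h1, h2.erase_eq]

theorem GoodTy.ctx_erase (h : GoodTy S N s d Θ₀ Θ φ₀ φ) {d'} {Ψ Ψ' : Ctx M} {o}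
    (hK : RSub s d' Ψ.enc Ψ'.enc o) : Ψ'.erase = Ψ.erase := by
  obtain ⟨γ, σ, hz⟩ := h.zip
  obtain ⟨K'', h1, h2⟩ := (hK.reflects hz).ctx _ rfl
  rw [Ctx.enc_inj h1, h2.erase_eq]

/-! ### Passing under binders -/

theorem TyImg.succ (h : TyImg S s d Θ₀ Θ) {i K} (hi : Θ₀.Has i (.ty K)) (b : Option (Entry M)) :
    ∃ A K' Θ₁ o o', RSub s (d + 1) (.tvar (i + 1)) (Ty.enc A) o ∧
    RSub s (d + 1) (Kind.shift (i + 1 + 1) 0 K).enc (Kind.enc K') o' ∧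
    Env.Le Θ₁ (Env.tyPart (b :: Θ)) ∧ HasKind S Θ₁ A K' := by
  obtain ⟨A, K', Θ₁, o, o', h1, h2, h3, h4⟩ := h i K hi
  refine ⟨A.shift 1 0, K'.shift 1 0, none :: Θ₁, o, o', ?_, ?_, h3.none_tyPart b, h4.ins 0⟩
  · rw [Ty.enc_shift]; exact h1.shift_le 1 0 (Nat.zero_le _)
  · rw [Kind.enc_shift_succ, Kind.enc_shift 1 0 K']; exact h2.shift_le 1 0 (Nat.zero_le _)

theorem GoodTy.cons_ty (h : GoodTy S N s d Θ₀ Θ φ₀ φ) {K K' o} (hK : RSub s d K.enc (Kind.enc K') o)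
    (hΘ : WfEnv S (some (.ty K') :: Θ)) :
    GoodTy S N s (d + 1) (some (.ty K) :: Θ₀) (some (.ty K') :: Θ)
      (SEnv.cons (some (some K.erase)) φ₀) (SEnv.cons (some (some K.erase)) φ) := by
  refine ⟨h.zip, h.bnd, ?_, h.ok.cons _, fun i L hi => ?_⟩
  · rw [Env.er_cons_ty]; exact h.er.cons _
  · cases i with
    | zero =>
      rw [Env.has_zero] at hi
      cases hi
      refine ⟨.neu (.var 0), K'.shift 1 0, _, none, o, .tbound (Nat.succ_pos _), ?_, ?_,
        hΘ.hasKind_var (Env.has_zero.mpr rfl)⟩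
      · rw [Kind.enc_shift, Kind.enc_shift]; exact hK.shift_le 1 0 (Nat.zero_le _)
      · exact (Env.geq_le _ _).tyPart
    | succ i => exact h.ty.succ (Env.has_succ.mp hi) _

theorem GoodTy.cons_tm (h : GoodTy S N s d Θ₀ Θ φ₀ φ) (k A A') :
    GoodTy S N s (d + 1) (some (.tm k A) :: Θ₀) (some (.tm k A') :: Θ)
      (SEnv.cons (some none) φ₀) (SEnv.cons (some none) φ) := by
  refine ⟨h.zip, h.bnd, ?_, h.ok.cons _, fun i L hi => ?_⟩
  · rw [Env.er_cons_tm]; exact h.er.cons _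
  · cases i with
    | zero => simp at hi
    | succ i => exact h.ty.succ (Env.has_succ.mp hi) _

theorem TmImg.succ (h : TmImg S s d Θ₀ Θ T) {i k A} (hi : Θ₀.Has i (.tm k A))
    (b : Option (Entry M)) :
    ∃ e A' o o', RSub s (d + 1) (.evar (i + 1)) (Tm.enc e) o ∧
    RSub s (d + 1) (Ty.shift (i + 1 + 1) 0 A).enc (Ty.enc A') o' ∧
    Env.Le (none :: T i) (b :: Θ) ∧ HasTy S (none :: T i) e k A' := by
  obtain ⟨e, A', o, o', h1, h2, h3, h4⟩ := h.tm i k A hi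
  refine ⟨e.shift 1 0, A'.shift 1 0, o, o', ?_, ?_, h3.cons_none b, h4.ins 0⟩
  · rw [Tm.enc_shift]; exact h1.shift_le 1 0 (Nat.zero_le _)
  · rw [Ty.enc_shift_succ, Ty.enc_shift 1 0 A']; exact h2.shift_le 1 0 (Nat.zero_le _)

theorem Good.cons_ty (h : Good S N s d Θ₀ Θ φ₀ φ T) {K K' o} (hK : RSub s d K.enc (Kind.enc K') o)
    (hΘ : WfEnv S (some (.ty K') :: Θ)) :
    Good S N s (d + 1) (some (.ty K) :: Θ₀) (some (.ty K') :: Θ)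
      (SEnv.cons (some (some K.erase)) φ₀) (SEnv.cons (some (some K.erase)) φ)
      (liftRes [] T) := by
  refine ⟨h.toGoodTy.cons_ty hK hΘ, ⟨fun i k' B hi => ?_, fun p k' B hp => ?_, fun p k' B hp hn => ?_⟩⟩
  · cases i with
    | zero => simp at hi
    | succ i => exact h.toTmImg.succ (Env.has_succ.mp hi) _
  · cases p with
    | zero => simp at hp
    | succ p =>
      rintro (_ | i) (_ | j) hi hj hij
      · exact absurd rfl hij
      · simp [Uses] at hi
      · simp [Uses] at hj
      · exact h.contr p k' B (Env.has_succ.mp hp) i j (uses_succ.mp hi) (uses_succ.mp hj)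
          (fun e => hij (congrArg _ e))
  · cases p with
    | zero => simp at hp
    | succ p => exact h.weak p k' B (Env.has_succ.mp hp) fun i hi => hn (i + 1) (uses_succ.mpr hi)

/-- The bound variable is its own image and spends itself and no other term variable, which is what
`Env.own` provides. The older images are shifted past it, so position 0 is spent exactly once. -/
theorem Good.cons_tm (h : Good S N s d Θ₀ Θ φ₀ φ T) {k A A' o}
    (hA : RSub s d A.enc (Ty.enc A') o) (hΘ : WfEnv S (some (.tm k A') :: Θ)) :
    Good S N s (d + 1) (some (.tm k A) :: Θ₀) (some (.tm k A') :: Θ)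
      (SEnv.cons (some none) φ₀) (SEnv.cons (some none) φ)
      (liftRes (Env.own (some (.tm k A') :: Θ) 0 k) T) := by
  have h0 : ∀ p, ¬ Uses (some (.tm k A) :: Θ₀)
      (liftRes (Env.own (some (.tm k A') :: Θ) 0 k) T) 0 (p + 1) := by
    rintro p ⟨-, k', B, hB⟩
    rcases (Env.has_own.mp hB).2 with ⟨K, hK⟩ | h
    · cases hK
    · cases h
  refine ⟨h.toGoodTy.cons_tm k A A', ⟨fun i k' B hi => ?_, fun p k' B hp => ?_, fun p k' B hp hn => ?_⟩⟩
  · cases i with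
    | zero =>
      rw [Env.has_zero] at hi
      cases hi
      refine ⟨.var 0, A'.shift 1 0, none, o, .ebound (Nat.succ_pos _), ?_, Env.own_le _ _ _,
        hΘ.hasTy_var (Env.has_zero.mpr rfl)⟩
      rw [Ty.enc_shift, Ty.enc_shift]; exact hA.shift_le 1 0 (Nat.zero_le _)
    | succ i => exact h.toTmImg.succ (Env.has_succ.mp hi) _
  · cases p with
    | zero =>
      rintro (_ | i) (_ | j) hi hj hij
      · exact absurd rfl hij
      · exact absurd hj not_uses_succ_zero
      · exact absurd hi not_uses_succ_zero
      · exact absurd hj not_uses_succ_zero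
    | succ p =>
      rintro (_ | i) (_ | j) hi hj hij
      · exact absurd rfl hij
      · exact absurd hi (h0 p)
      · exact absurd hj (h0 p)
      · exact h.contr p k' B (Env.has_succ.mp hp) i j (uses_succ.mp hi) (uses_succ.mp hj)
          (fun e => hij (congrArg _ e))
  · cases p with
    | zero =>
      refine absurd ⟨⟨k, A, Env.has_zero.mpr rfl⟩, k', B, Env.has_own.mpr ⟨⟨hp, ?_⟩, .inr rfl⟩⟩
        (hn 0)
      rw [Env.has_zero] at hp
      cases hp
      exact le_rfl
    | succ p => exact h.weak p k' B (Env.has_succ.mp hp) fun i hi => hn (i + 1) (uses_succ.mpr hi)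

theorem GoodTy.ext (h : GoodTy S N s d Θ₀ Θ φ₀ φ) : ∀ {Ψ Ψ' : Ctx M} {o},
    RSub s d Ψ.enc Ψ'.enc o → WfEnv S (Θ.ext Ψ') →
    GoodTy S N s (d + Ψ.len) (Θ₀.ext Ψ) (Θ.ext Ψ') (φ₀.ext Ψ.erase) (φ.ext Ψ.erase)
  | .nil, Ψ', _, hr, _ => by rw [hr.ctx_nil]; exact h
  | .consTy Ψ K, _, _, hr, hw => by
    obtain ⟨Ψ', K', _, _, rfl, -, h1, h2⟩ := hr.ctx_ty
    exact (h.ext h1 hw.tail).cons_ty h2 hw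
  | .consTm Ψ k A, _, _, hr, hw => by
    obtain ⟨Ψ', K', _, _, rfl, -, h1, h2⟩ := hr.ctx_tm
    exact (h.ext h1 hw.tail).cons_tm _ _ _

theorem Good.ext (h : Good S N s d Θ₀ Θ φ₀ φ T) : ∀ {Ψ Ψ' : Ctx M} {o},
    RSub s d Ψ.enc Ψ'.enc o → WfEnv S (Θ.ext Ψ') →
    ∃ T', Good S N s (d + Ψ.len) (Θ₀.ext Ψ) (Θ.ext Ψ') (φ₀.ext Ψ.erase) (φ.ext Ψ.erase) T'
  | .nil, Ψ', _, hr, _ => by rw [hr.ctx_nil]; exact ⟨T, h⟩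
  | .consTy Ψ K, _, _, hr, hw => by
    obtain ⟨Ψ', K', _, _, rfl, -, h1, h2⟩ := hr.ctx_ty
    obtain ⟨T', h3⟩ := h.ext h1 hw.tail
    exact ⟨_, h3.cons_ty h2 hw⟩
  | .consTm Ψ k A, _, _, hr, hw => by
    obtain ⟨Ψ', K', _, _, rfl, -, h1, h2⟩ := hr.ctx_tm
    obtain ⟨T', h3⟩ := h.ext h1 hw.tail
    exact ⟨_, h3.cons_tm h2 hw⟩

/-! ### Distributing resources -/

theorem TmImg.mode_le (h : TmImg S s d Θ₀ Θ T) {i k A p k' A'} (hi : Θ₀.Has i (.tm k A))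
    (hp : (T i).Has p (.tm k' A')) : k ≤ k' := by
  obtain ⟨e, B, o, o', -, -, -, h4⟩ := h.tm i k A hi
  exact Env.ge_iff.mp h4.ge p _ hp

/-- The presupposition of the image's typing bounds every declaration it uses from below by the mode
of the variable. Together with `ModeSpec.mono`, this carries contraction and weakening from a
variable to the resources of its image. -/
theorem TmImg.uses_mode_le (h : TmImg S s d Θ₀ Θ T) {i k A p k' A'} (hi : Θ₀.Has i (.tm k A))
    (hu : Uses Θ₀ T i p) (hp : Θ.Has p (.tm k' A')) : k ≤ k' := by
  obtain ⟨-, k'', B, hB⟩ := hu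
  obtain ⟨e, _, o, o', -, -, h3, -⟩ := h.tm i k A hi
  have := (h3.2 _ _ hB).unique hp
  cases this
  exact h.mode_le hi hB

theorem TmImg.weak_of_weak (h : TmImg S s d Θ₀ Θ T) (hw : Θ₀.Weak S) : Θ.Weak S := by
  refine Env.weak_iff.mpr fun p k A hp => ?_
  by_cases hu : ∃ i, Uses Θ₀ T i p
  · obtain ⟨i, hu⟩ := hu
    obtain ⟨⟨k', A', hi⟩, -⟩ := id hu
    exact S.mono (h.uses_mode_le hi hu hp) (Env.weak_iff.mp hw i k' A' hi)
  · exact h.weak p k A hp fun i hi => hu ⟨i, hi⟩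

/-- The heart of the resource argument: resources follow the variables whose images spend them. A
declaration spent from the left part has mode at least `m`, since the variable spending it does. -/
theorem Good.exists_split (h : Good S N s d Θ₀ Θ φ₀ φ T) (hΘ : WfEnv S Θ) {Γ₁ Γ₂ : Env M}
    (hs : Split S Θ₀ Γ₁ Γ₂) {m : M} (hg : Γ₁.Ge m) :
    ∃ Θ₁ Θ₂ : Env M, Split S Θ Θ₁ Θ₂ ∧ Θ₁.Ge m ∧ WfEnv S Θ₁ ∧ WfEnv S Θ₂ ∧
      Good S N s d Γ₁ Θ₁ φ₀ φ T ∧ Good S N s d Γ₂ Θ₂ φ₀ φ T := by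
  obtain ⟨l1, l2, cov, hC⟩ := split_iff.mp hs
  -- The left part receives only what images of `Γ₁` spend; declarations that no image spends go to
  -- the right part. Type variables of sufficient mode belong to both.
  let Θ₁ : Env M := (Θ.geq m).filt fun p E => (∃ K, E = .ty K) ∨ ∃ i, Uses Γ₁ T i p
  let Θ₂ : Env M := Θ.filt fun p E => (∃ K, E = .ty K) ∨ (∃ i, Uses Γ₂ T i p) ∨
    ¬ ∃ i, Uses Γ₁ T i p
  have d1 : Θ₁.Drop (Θ.geq m) := ⟨Env.filt_le _ _, fun i K hi => Env.has_filt.mpr ⟨hi, .inl ⟨K, rfl⟩⟩⟩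
  have d2 : Θ₂.Drop Θ := ⟨Env.filt_le _ _, fun i K hi => Env.has_filt.mpr ⟨hi, .inl ⟨K, rfl⟩⟩⟩
  have g1 : Θ₁.Ge m := (Env.geq_ge m Θ).le d1.1
  have le1 : Θ₁.Le Θ := d1.1.trans (Env.geq_le m Θ)
  refine ⟨Θ₁, Θ₂, split_iff.mpr ⟨le1, d2.1, fun p E hp => ?_, fun p k A h1 h2 => ?_⟩, g1,
    (hΘ.geq m).drop d1, hΘ.drop d2,
    { h.toGoodTy.le l1 (Env.tyPart_le _ |>.trans (Env.Le.refl _)) with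
      ty := (h.ty.geq l1 hg).le (Env.Le.refl _) ⟨by simp [Θ₁], fun p E hp => ?_⟩
      tm := fun i k A hi => ?_
      contr := fun p k A hp i j hi hj => h.contr p k A (le1.2 _ _ hp) i j (hi.mono l1) (hj.mono l1)
      weak := fun p k A hp hn => ?_ },
    { h.toGoodTy.le l2 (Env.tyPart_le _ |>.trans (Env.Le.refl _)) with
      ty := h.ty.le l2 ⟨by simp [Θ₂], fun p E hp => ?_⟩
      tm := fun i k A hi => ?_
      contr := fun p k A hp i j hi hj =>
        h.contr p k A (d2.1.2 _ _ hp) i j (hi.mono l2) (hj.mono l2)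
      weak := fun p k A hp hn => ?_ }⟩
  · rcases E with K | ⟨k, A⟩
    · exact .inr (d2.2 _ _ hp)
    · by_cases hu : ∃ i, Uses Γ₁ T i p
      · refine .inl (Env.has_filt.mpr ⟨Env.has_geq.mpr ⟨hp, ?_⟩, .inr hu⟩)
        obtain ⟨i, hu⟩ := hu
        obtain ⟨⟨k', A', hi⟩, -⟩ := id hu
        exact (Env.ge_iff.mp hg _ _ hi).trans (h.uses_mode_le (l1.2 _ _ hi) (hu.mono l1) hp)
      · exact .inr (Env.has_filt.mpr ⟨hp, .inr (.inr hu)⟩)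
  · have hp := d2.1.2 _ _ h2
    rcases (Env.has_filt.mp h1).2 with ⟨K, hK⟩ | ⟨i, hu⟩
    · cases hK
    rcases (Env.has_filt.mp h2).2 with ⟨K, hK⟩ | ⟨j, hu'⟩ | hn
    · cases hK
    -- A declaration needed on both sides is either shared by two different images, which `contr`
    -- covers, or spent by one variable occurring in both parts. In the second case contraction at
    -- that variable's mode passes up to the declaration.
    · by_cases hij : i = j
      · subst hij
        obtain ⟨⟨k', A', hi⟩, -⟩ := id hu
        obtain ⟨⟨k'', A'', hi'⟩, -⟩ := id hu'
        have := (l1.2 _ _ hi).unique (l2.2 _ _ hi')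
        cases this
        exact S.mono (h.uses_mode_le (l1.2 _ _ hi) (hu.mono l1) hp) (hC i k' A' hi hi')
      · exact h.contr p k A hp i j (hu.mono l1) (hu'.mono l2) hij
    · exact absurd ⟨i, hu⟩ hn
  · obtain ⟨h1, K, rfl⟩ := Env.has_tyPart.mp hp
    exact d1.2 _ _ h1
  · obtain ⟨e, A', o, o', h1, h2, h3, h4⟩ := h.tm i k A (l1.2 _ _ hi)
    refine ⟨e, A', o, o', h1, h2, ⟨by simpa [Θ₁, Env.geq] using h3.1, fun p E hp => ?_⟩, h4⟩
    refine Env.has_filt.mpr ⟨Env.has_geq.mpr ⟨h3.2 _ _ hp,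
      (Env.ge_iff.mp hg _ _ hi).trans (Env.ge_iff.mp h4.ge _ _ hp)⟩, ?_⟩
    rcases E with K | ⟨k', B⟩
    · exact .inl ⟨K, rfl⟩
    · exact .inr ⟨i, ⟨k, A, hi⟩, k', B, hp⟩
  · rcases (Env.has_filt.mp hp).2 with ⟨K, hK⟩ | ⟨i, hu⟩
    · cases hK
    · exact absurd hu (hn i)
  · obtain ⟨h1, K, rfl⟩ := Env.has_tyPart.mp hp
    exact d2.2 _ _ h1
  · obtain ⟨e, A', o, o', h1, h2, h3, h4⟩ := h.tm i k A (l2.2 _ _ hi)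
    refine ⟨e, A', o, o', h1, h2, ⟨by simpa [Θ₂] using h3.1, fun p E hp => ?_⟩, h4⟩
    refine Env.has_filt.mpr ⟨h3.2 _ _ hp, ?_⟩
    rcases E with K | ⟨k', B⟩
    · exact .inl ⟨K, rfl⟩
    · exact .inr (.inl ⟨i, ⟨k, A, hi⟩, k', B, hp⟩)
  -- A declaration of `Θ₂` that no image of `Γ₂` spends is there because no image of `Γ₁` spends it
  -- either. The two parts cover `Θ₀`, so no image at all spends it.
  · refine h.weak p k A (d2.1.2 _ _ hp) fun i hu => ?_
    obtain ⟨⟨k', A', hi⟩, hT⟩ := hu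
    rcases (Env.has_filt.mp hp).2 with ⟨K, hK⟩ | ⟨j, hu⟩ | hn'
    · cases hK
    · exact hn j hu
    · rcases cov i _ hi with hi | hi
      · exact hn' ⟨i, ⟨k', A', hi⟩, hT⟩
      · exact hn i ⟨⟨k', A', hi⟩, hT⟩

end

/-! ## Composition of substitutions -/

/-- The case of `SK.comp` in which `τ` acts at depth 0 and `s` at depth `d`, so that `c` is `d`. -/
theorem SK.comp_zip {φ₀ φ : SEnv M} {s : ASub M} {d N : ℕ} (hb : s.Bnd N) (hs : SOK φ₀ φ s d)
    {ψ : SCtx M} {τ τ' X X' X'' X₁ : Raw M} {t : Srt M} {s₁ : ASub M}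
    {o₁ o₂ o₃ o₄ : Option (SKind M)} (hτ : SK φ₀ τ (.sb ψ)) (hX : SK (φ₀.ext ψ) X t)
    (hz : Zip ψ τ s₁) (rτ : RSub s d τ τ' o₁) (r₁ : RSub s₁ 0 X X' o₂) (r₂ : RSub s d X' X'' o₃)
    (r₃ : RSub s (d + ψ.len) X X₁ o₄) :
    ∃ s', Zip ψ τ' s' ∧ ∃ o, RSub s' 0 X₁ X'' o := by
  obtain ⟨s₁', hz', hrel⟩ := hz.rsub rτ
  obtain ⟨s₂, hz₂, hs₂⟩ := hτ.exists_zip rfl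
  obtain rfl := hz.det hz₂
  obtain ⟨s₃, hz₃, hs₃⟩ := (rτ.sound hτ hb hs).1.exists_zip rfl
  obtain rfl := hz'.det hz₃
  have hd : 0 + s₁.length + d = d + ψ.len := by rw [hz.length]; omega
  refine ⟨s₁', hz', SK.comp _ hX le_rfl hz.bnd hb (c := d) hs₂ (by rwa [Nat.zero_add])
    (by rw [hd]; exact hs.ext ψ) hs₃ hrel r₁ (by rwa [Nat.zero_add]) (by rwa [hd])⟩

theorem Ctx.mem_ext_rsub {s : ASub M} {d : ℕ} : ∀ {Ψ Ψ' : Ctx M} {o E},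
    RSub s d Ψ.enc Ψ'.enc o → some E ∈ Env.ext [] Ψ' → ∃ E', some E' ∈ Env.ext [] Ψ ∧
      E'.mode = E.mode
  | .nil, _, _, E, hr, hE => by rw [hr.ctx_nil] at hE; simp [Env.ext] at hE
  | .consTy Ψ K, _, _, E, hr, hE => by
    obtain ⟨Ψ', K', _, _, rfl, -, h1, h2⟩ := hr.ctx_ty
    rcases List.mem_cons.mp hE with h | h
    · cases h
      exact ⟨.ty K, by simp [Env.ext], h2.kind_mode.symm⟩
    · obtain ⟨E', h3, h4⟩ := Ctx.mem_ext_rsub h1 h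
      exact ⟨E', List.mem_cons_of_mem _ h3, h4⟩
  | .consTm Ψ k A, _, _, E, hr, hE => by
    obtain ⟨Ψ', K', _, _, rfl, -, h1, h2⟩ := hr.ctx_tm
    rcases List.mem_cons.mp hE with h | h
    · cases h
      exact ⟨.tm k A, by simp [Env.ext], rfl⟩
    · obtain ⟨E', h3, h4⟩ := Ctx.mem_ext_rsub h1 h
      exact ⟨E', List.mem_cons_of_mem _ h3, h4⟩

theorem Raw.rsub_nil {φ : SEnv M} {X t} (h : SK φ X t) : RSub [] 0 X X none := by
  have := h.rsub_shift [] 0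
  rwa [List.length_nil, Raw.shift_zero] at this

theorem Raw.shift_tvar_succ (i : ℕ) : Raw.shift 1 0 (.tvar i : Raw M) = .tvar (i + 1) := by
  simp [Raw.shift]

theorem Raw.shift_evar_succ (i : ℕ) : Raw.shift 1 0 (.evar i : Raw M) = .evar (i + 1) := by
  simp [Raw.shift]

/-- The resources of the images when one more term variable is substituted. -/
def pushRes (Γ : Env M) (T : ℕ → Env M) : ℕ → Env M
  | 0 => Γ
  | i + 1 => T i

theorem uses_push {Θ₀ : Env M} {T : ℕ → Env M} {a} {Γ : Env M} {i p} :
    Uses (a :: Θ₀) (pushRes Γ T) (i + 1) p ↔ Uses Θ₀ T i p := by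
  simp [Uses, pushRes]

section

variable [Preorder M] {S : ModeSpec M} {N d : ℕ} {s : ASub M} {Θ₀ Θ : Env M} {φ₀ φ : SEnv M}
  {T : ℕ → Env M}

/-- The equation `[s][τ]K = [[s]τ][s]K` in the form needed to rebuild a rule whose conclusion
mentions `[τ]K`. Two sub-environments occur because a split may separate `τ` from `K`. -/
theorem GoodTy.comp_kind (h : GoodTy S N s d Θ₀ Θ φ₀ φ) {Γ₁ Γ₂ : Env M} (l₁ : Γ₁.Le Θ₀)
    (l₂ : Γ₂.Le Θ₀) {Ψ : Ctx M} {τ τ' : Sbst M} {K K' K'' K₁ : Kind M} {t : Srt M}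
    {o₁ o₂ o₃ : Option (SKind M)} (hτ : SK Γ₁.er τ.enc (.sb Ψ.erase))
    (hK : SK (Γ₂.ext Ψ).er K.enc t)
    (hsub : SubKind Ψ.erase τ 0 K K') (rτ : RSub s d τ.enc τ'.enc o₁)
    (r₂ : RSub s d K'.enc K''.enc o₂) (r₃ : RSub s (d + Ψ.len) K.enc K₁.enc o₃) :
    ∃ s', Zip Ψ.erase τ'.enc s' ∧ (∃ o, RSub s' 0 K₁.enc K''.enc o) ∧
      SubKind Ψ.erase τ' 0 K₁ K'' := by
  have hτ₀ := hτ.mono fun i v hv => h.er i v (l₁.er i v hv)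
  rw [Env.er_ext] at hK
  have hK₀ := hK.mono (SEnv.Le.ext (fun i v hv => h.er i v (l₂.er i v hv)) Ψ.erase)
  obtain ⟨s₁, hz, hs⟩ := hτ₀.exists_zip rfl
  obtain ⟨_, r₁⟩ := hsub.rsub hz hK₀ hs
  rw [← Ctx.len_erase] at r₃
  obtain ⟨s', hz', o, r⟩ := SK.comp_zip h.bnd h.ok hτ₀ hK₀ hz rτ r₁ r₂ r₃
  obtain ⟨X, h1, h2⟩ := (r.reflects hz').kind _ rfl
  exact ⟨s', hz', ⟨o, r⟩, Kind.enc_inj h1 ▸ h2⟩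

theorem GoodTy.comp_ty (h : GoodTy S N s d Θ₀ Θ φ₀ φ) {Γ₁ Γ₂ : Env M} (l₁ : Γ₁.Le Θ₀)
    (l₂ : Γ₂.Le Θ₀) {Ψ : Ctx M} {τ τ' : Sbst M} {A A' A'' A₁ : Ty M} {t : Srt M}
    {o₁ o₂ o₃ : Option (SKind M)} (hτ : SK Γ₁.er τ.enc (.sb Ψ.erase))
    (hA : SK (Γ₂.ext Ψ).er A.enc t)
    (hsub : SubTy Ψ.erase τ 0 A A') (rτ : RSub s d τ.enc τ'.enc o₁)
    (r₂ : RSub s d A'.enc A''.enc o₂) (r₃ : RSub s (d + Ψ.len) A.enc A₁.enc o₃) :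
    SubTy Ψ.erase τ' 0 A₁ A'' := by
  have hτ₀ := hτ.mono fun i v hv => h.er i v (l₁.er i v hv)
  rw [Env.er_ext] at hA
  have hA₀ := hA.mono (SEnv.Le.ext (fun i v hv => h.er i v (l₂.er i v hv)) Ψ.erase)
  obtain ⟨s₁, hz, hs⟩ := hτ₀.exists_zip rfl
  obtain ⟨_, r₁⟩ := hsub.rsub hz hA₀ hs
  rw [← Ctx.len_erase] at r₃
  obtain ⟨s', hz', o, r⟩ := SK.comp_zip h.bnd h.ok hτ₀ hA₀ hz rτ r₁ r₂ r₃
  obtain ⟨X, h1, h2⟩ := (r.reflects hz').ty _ rfl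
  exact Ty.enc_inj h1 ▸ h2

theorem Ctx.Between.rsub {k l : M} {Ψ Ψ' : Ctx M} {o} (h : Ctx.Between k Ψ l)
    (hr : RSub s d Ψ.enc Ψ'.enc o) : Ctx.Between k Ψ' l :=
  ⟨h.1, fun _ hE => let ⟨E', h1, h2⟩ := Ctx.mem_ext_rsub hr hE; h2 ▸ h.2 E' h1⟩

/-! ## Typed substitutions act on environments -/

/-- The empty substitution acts as the identity; this is the base case of `HasSbst.img`. -/
theorem WfEnv.tyImg_nil (h : WfEnv S Θ₀) (hl : Θ₀.Le Θ) : TyImg S [] 0 Θ₀ Θ := fun _ _ hi =>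
  have hv := h.hasKind_var hi
  ⟨_, _, _, Option.none, Option.none, Raw.rsub_nil hv.sk, Raw.rsub_nil hv.wfKind.sk,
    (Env.geq_le _ _ |>.trans hl).tyPart, hv⟩

theorem WfEnv.exists_tmImg_nil {Γ : Env M} (h : WfEnv S Θ₀) (hs : Split S Θ Θ₀ Γ)
    (hw : Γ.Weak S) : ∃ T, TmImg S [] 0 Θ₀ Θ T := by
  -- `Env.own` requires the mode of variable `i`, which only its declaration supplies. At positions
  -- without a term variable the value is irrelevant, and `[]` is taken.
  have hT : ∀ i, ∃ Γ' : Env M, ∀ k A, Θ₀.Has i (.tm k A) → Γ' = Θ₀.own i k := by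
    intro i
    by_cases hi : ∃ k A, Θ₀.Has i (.tm k A)
    · obtain ⟨k, A, hi⟩ := hi
      refine ⟨Θ₀.own i k, fun k' A' hi' => ?_⟩
      cases hi.unique hi'
      rfl
    · exact ⟨[], fun k A h => absurd ⟨k, A, h⟩ hi⟩
  choose T hT using hT
  have hu : ∀ {i p}, Uses Θ₀ T i p → i = p := by
    rintro i p ⟨⟨k, A, hi⟩, k', A', hp⟩
    rw [hT i k A hi] at hp
    rcases (Env.has_own.mp hp).2 with ⟨K, hK⟩ | hK
    · cases hK
    · exact hK.symm
  refine ⟨T, ⟨fun i k A hi => ?_, fun p k A _ i j hi hj hij => ?_, fun p k A hp hn => ?_⟩⟩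
  · have hv := h.hasTy_var hi
    rw [hT i k A hi]
    exact ⟨_, _, Option.none, Option.none, Raw.rsub_nil hv.sk, Raw.rsub_nil hv.hasKind.sk,
      (Env.own_le _ _ _).trans hs.le_left, hv⟩
  · exact absurd ((hu hi).trans (hu hj).symm) hij
  · rcases (split_iff.mp hs).2.2.1 p _ hp with hp | hp
    · refine absurd ⟨⟨k, A, hp⟩, k, A, ?_⟩ (hn p)
      rw [hT p k A hp]
      exact Env.has_own.mpr ⟨⟨hp, le_rfl⟩, .inr rfl⟩
    · exact Env.weak_iff.mp hw p k A hp

/-- Regroups `Γ₀ ⋈ (Γ₁ ⋈ Γ₂)` as `(Γ₀ ⋈ Γ₂) ⋈ Γ₁`, so that `Γ₁` can be reserved for the last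
component of a substitution while the others are treated together with `Γ₀`. -/
theorem Split.assoc {Γ Γ₀ Γ₁ Γ₂ Γ' : Env M} (h : Split S Γ Γ₀ Γ') (h' : Split S Γ' Γ₁ Γ₂) :
    ∃ Γ'', Split S Γ Γ'' Γ₁ ∧ Split S Γ'' Γ₀ Γ₂ := by
  obtain ⟨h1, h2, h3, h4⟩ := split_iff.mp h
  obtain ⟨g1, g2, g3, g4⟩ := split_iff.mp h'
  refine ⟨Γ.filt fun i E => Γ₀.Has i E ∨ Γ₂.Has i E, split_iff.mpr
    ⟨Env.filt_le _ _, g1.trans h2, fun i E hi => ?_, fun i k A hi hi' => ?_⟩, split_iff.mpr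
    ⟨⟨by rw [Env.length_filt, h1.1], fun i E hi => Env.has_filt.mpr ⟨h1.2 _ _ hi, .inl hi⟩⟩,
      ⟨by rw [Env.length_filt, g2.1, h2.1], fun i E hi =>
        Env.has_filt.mpr ⟨h2.2 _ _ (g2.2 _ _ hi), .inr hi⟩⟩,
      fun i E hi => (Env.has_filt.mp hi).2, fun i k A hi hi' => h4 i k A hi (g2.2 _ _ hi')⟩⟩
  · rcases h3 i E hi with h | h
    · exact .inl (Env.has_filt.mpr ⟨hi, .inl h⟩)
    · rcases g3 i E h with h | h
      · exact .inr h
      · exact .inl (Env.has_filt.mpr ⟨hi, .inr h⟩)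
  · rcases (Env.has_filt.mp hi).2 with h | h
    · exact h4 i k A h (g1.2 _ _ hi')
    · exact g4 i k A hi' h

theorem TyImg.push (h : TyImg S s 0 Θ₀ Θ) (x : Raw M × Option (SKind M)) {i K}
    (hi : Θ₀.Has i (.ty K)) : ∃ A K' Θ₁ o o', RSub (x :: s) 0 (.tvar (i + 1)) (Ty.enc A) o ∧
    RSub (x :: s) 0 (Kind.shift (i + 1 + 1) 0 K).enc (Kind.enc K') o' ∧
    Env.Le Θ₁ Θ.tyPart ∧ HasKind S Θ₁ A K' := by
  obtain ⟨A, K', Θ₁, o, o', h1, h2, h3, h4⟩ := h i K hi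
  refine ⟨A, K', Θ₁, o, o', ?_, ?_, h3, h4⟩
  · have := h1.cons x
    rwa [Raw.shift_tvar_succ] at this
  · rw [Kind.enc_shift_succ]; exact h2.cons x

theorem TmImg.push (h : TmImg S s 0 Θ₀ Θ T) (x : Raw M × Option (SKind M)) {i k A}
    (hi : Θ₀.Has i (.tm k A)) : ∃ e A' o o', RSub (x :: s) 0 (.evar (i + 1)) (Tm.enc e) o ∧
    RSub (x :: s) 0 (Ty.shift (i + 1 + 1) 0 A).enc (Ty.enc A') o' ∧
    (T i).Le Θ ∧ HasTy S (T i) e k A' := by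
  obtain ⟨e, A', o, o', h1, h2, h3, h4⟩ := h.tm i k A hi
  refine ⟨e, A', o, o', ?_, ?_, h3, h4⟩
  · have := h1.cons x
    rwa [Raw.shift_evar_succ] at this
  · rw [Ty.enc_shift_succ]; exact h2.cons x

/-- A syntactically typed substitution, extended by the identity on `Γ₀`, meets the pointwise
conditions on images and resources. -/
theorem HasSbst.img {Γσ : Env M} {τ : Sbst M} {Ψ : Ctx M} : HasSbst S Γσ τ Ψ →
    ∀ {Γ Γ₀ : Env M} {s}, Split S Γ Γ₀ Γσ → WfEnv S Γ₀ → Zip Ψ.erase τ.enc s →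
    ∃ T, TyImg S s 0 (Γ₀.ext Ψ) Γ ∧ TmImg S s 0 (Γ₀.ext Ψ) Γ T
  | .nil _ hw, Γ, Γ₀, _, hs, h₀, hz => by
    cases hz
    obtain ⟨T, hT⟩ := h₀.exists_tmImg_nil hs hw
    exact ⟨T, h₀.tyImg_nil hs.le_left, hT⟩
  | .consTy (Γ₁ := Γ₁) (σ := σ) (A := A) (Ψ := Ψ) (K := K) hΨ hs₁ _ hσ _ hsub _ hA,
      Γ, Γ₀, _, hs, h₀, hz => by
    obtain ⟨s', hz', hok⟩ := hσ.sk.exists_zip rfl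
    have hK := hΨ.sk_last_ty
    rw [Env.er_ext] at hK
    obtain ⟨o, hr⟩ := hsub.rsub hz' hK hok
    obtain rfl := hz.det (.consTy hz')
    obtain ⟨T, h1, h2⟩ := hσ.img hs h₀ hz'
    refine ⟨pushRes [] T, fun i L hi => ?_, ⟨fun i k B hi => ?_, fun p k B hp => ?_,
      fun p k B hp hn => h2.weak p k B hp fun i hi => hn _ (uses_push.mpr hi)⟩⟩
    · cases i with
      | zero =>
        rw [Env.ext, Env.has_zero] at hi
        cases hi
        refine ⟨A, _, Γ₁.tyPart, some K.erase, o, ?_, ?_, (hs₁.le_left.trans hs.le_right).tyPart,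
          hA.drop (.tyPart _)⟩
        · have := RSub.thit (s := (A.enc, some K.erase) :: s') (d := 0) (i := 0) le_rfl rfl
          rwa [Raw.shift_zero] at this
        · rw [Kind.enc_shift]; exact hr.cons _
      | succ i => exact h1.push _ (Env.has_succ.mp hi)
    · cases i with
      | zero => simp [Env.ext] at hi
      | succ i => exact h2.push _ (Env.has_succ.mp hi)
    · rintro (_ | i) (_ | j) hi hj hij
      · exact absurd rfl hij
      · simp [Uses, Env.ext] at hi
      · simp [Uses, Env.ext] at hj
      · exact h2.contr p k B hp i j (uses_push.mp hi) (uses_push.mp hj)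
          fun e => hij (congrArg _ e)
  | .consTm (Γ₁ := Γ₁) (σ := σ) (k := k₀) (e := e) (Ψ := Ψ) (A := A) hΨ hs₁ _ _ hσ _ hsub hA he,
      Γ, Γ₀, _, hs, h₀, hz => by
    obtain ⟨Γ', hs', hs₀⟩ := hs.assoc hs₁
    obtain ⟨s', hz', hok⟩ := (hσ.sk.weaken hs₁.le_right).exists_zip rfl
    obtain ⟨t, hK⟩ := hΨ.sk_last_tm
    rw [Env.er_ext] at hK
    obtain ⟨o, hr⟩ := hsub.rsub hz' hK hok
    obtain rfl := hz.det (.consTm hz')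
    obtain ⟨T, h1, h2⟩ := hσ.img hs₀ h₀ hz'
    -- Older images spend only declarations of `Γ'` and the new one only those of `Γ₁`. A
    -- declaration spent by both lies in both parts of the split and hence admits contraction.
    have key : ∀ {i p k B}, Uses (Γ₀.ext Ψ) T i p → Γ.Has p (.tm k B) → Γ'.Has p (.tm k B) := by
      rintro i p k B ⟨⟨k₁, B₁, hi⟩, k₂, B₂, hp⟩ hp'
      obtain ⟨_, _, _, _, _, _, hl, _⟩ := h2.tm i _ _ hi
      have hp₁ := hl.2 _ _ hp
      cases (hs'.le_left.2 _ _ hp₁).unique hp'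
      exact hp₁
    have key₀ : ∀ {p k B}, Uses ((Γ₀.ext Ψ).ext (.consTm .nil k₀ A)) (pushRes Γ₁ T) 0 p →
        Γ.Has p (.tm k B) → Γ₁.Has p (.tm k B) := by
      rintro p k B ⟨-, k₂, B₂, hp⟩ hp'
      cases (hs'.le_right.2 _ _ hp).unique hp'
      exact hp
    have hC := (split_iff.mp hs').2.2.2
    refine ⟨pushRes Γ₁ T, fun i L hi => ?_, ⟨fun i k B hi => ?_, fun p k B hp => ?_,
      fun p k B hp hn => ?_⟩⟩
    · cases i with
      | zero => simp [Env.ext] at hi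
      | succ i =>
        exact (h1.le (Env.Le.refl _) ((Env.tyPart_le _).trans hs'.le_left)).push _
          (Env.has_succ.mp hi)
    · cases i with
      | zero =>
        rw [Env.ext, Env.has_zero] at hi
        cases hi
        refine ⟨e, _, none, o, ?_, ?_, hs'.le_right, he⟩
        · have := RSub.ehit (s := (e.enc, none) :: s') (d := 0) (i := 0) le_rfl rfl
          rwa [Raw.shift_zero] at this
        · rw [Ty.enc_shift]; exact hr.cons _
      | succ i =>
        obtain ⟨e', A', o₁, o₂, r1, r2, r3, r4⟩ := h2.push (e.enc, none) (Env.has_succ.mp hi)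
        exact ⟨e', A', o₁, o₂, r1, r2, r3.trans hs'.le_left, r4⟩
    · rintro (_ | i) (_ | j) hi hj hij
      · exact absurd rfl hij
      · exact hC p k B (key (uses_push.mp hj) hp) (key₀ hi hp)
      · exact hC p k B (key (uses_push.mp hi) hp) (key₀ hj hp)
      · exact h2.contr p k B (key (uses_push.mp hi) hp) i j (uses_push.mp hi) (uses_push.mp hj)
          fun e => hij (congrArg _ e)
    · rcases (split_iff.mp hs').2.2.1 p _ hp with hp' | hp'
      · exact h2.weak p k B hp' fun i hi => hn _ (uses_push.mpr hi)
      · exact absurd ⟨⟨k₀, A, Env.has_zero.mpr rfl⟩, k, B, hp'⟩ (hn 0)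
termination_by structural h => h

theorem HasSbst.good {Γ Γ₀ Γσ : Env M} {τ : Sbst M} {Ψ : Ctx M} (h : HasSbst S Γσ τ Ψ)
    (hs : Split S Γ Γ₀ Γσ) (h₀ : WfEnv S Γ₀) (hz : Zip Ψ.erase τ.enc s) :
    ∃ T, Good S (sizeOf Ψ.erase) s 0 (Γ₀.ext Ψ) Γ (Γ.er.ext Ψ.erase) Γ.er T := by
  obtain ⟨T, h1, h2⟩ := h.img hs h₀ hz
  obtain ⟨s', hz', hok⟩ := (h.sk.weaken hs.le_right).exists_zip rfl
  obtain rfl := hz.det hz'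
  exact ⟨T, ⟨⟨_, _, hz⟩, hz.bnd, by rw [Env.er_ext]; exact hs.le_left.er.ext _, hok, h1⟩, h2⟩

end

section

variable [Preorder M] {S : ModeSpec M}

/-! ## The substitution theorem -/

/-- Substitutions whose kind annotations have size at most `N` preserve kinding. -/
def TySubst (S : ModeSpec M) (N : ℕ) : Prop :=
  ∀ {s d} {Θ₀ Θ : Env M} {φ₀ φ} {A A' : Ty M} {K K' : Kind M} {o o'},
    GoodTy S N s d Θ₀ Θ φ₀ φ → HasKind S Θ₀ A K → WfEnv S Θ → Θ.Ge K.mode →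
    RSub s d A.enc A'.enc o → RSub s d K.enc K'.enc o' → HasKind S Θ A' K'

theorem GoodTy.sk_mono {N d} {s : ASub M} {Θ₀ Θ Γ : Env M} {φ₀ φ : SEnv M} {X t}
    (h : GoodTy S N s d Θ₀ Θ φ₀ φ) (hX : SK Γ.er X t) (hl : Γ.Le Θ₀) : SK φ₀ X t :=
  hX.mono fun i v hv => h.er i v (hl.er i v hv)

theorem TmImg.var_wk {d} {s : ASub M} {Θ₀ Θ Γ ΓW : Env M} {T} (h : TmImg S s d Θ₀ Θ T) {i k A}
    (hs : Split S Θ₀ Γ ΓW) (hi : Γ.Single i (.tm k A)) (hw : ΓW.Weak S) :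
    Env.Wk S (T i) Θ := by
  obtain ⟨_, _, _, _, _, _, hl, _⟩ := h.tm i k A (hs.le_left.2 _ _ hi.1)
  refine ⟨hl, fun p k' B hp hn => ?_⟩
  by_cases hu : ∃ j, Uses Θ₀ T j p
  · obtain ⟨j, hu⟩ := hu
    obtain ⟨⟨k₁, A₁, hj⟩, k₂, A₂, hj'⟩ := id hu
    have hij : j ≠ i := by
      rintro rfl
      cases (hl.2 _ _ hj').unique hp
      exact hn hj'
    rcases (split_iff.mp hs).2.2.1 j _ hj with h1 | h1
    · exact absurd (hi.2 _ _ h1) hij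
    · exact S.mono (h.uses_mode_le hj hu hp) (Env.weak_iff.mp hw _ _ _ h1)
  · exact h.weak p k' B hp fun j hj => hu ⟨j, hj⟩

theorem HasKind.up_inv {Γ : Env M} {k l Ψ A K} (h : HasKind S Γ (.up k l Ψ A) K) :
    Ctx.Between k Ψ l ∧ WfEnv S (Γ.ext Ψ) := by
  cases h with
  | up _ _ _ hb hΨ _ => exact ⟨hb, hΨ⟩

theorem HasKind.all_inv {Γ : Env M} {A K K'} (h : HasKind S Γ (.all K A) K') :
    WfEnv S (some (.ty K) :: Γ) := by
  cases h with
  | all _ _ _ _ _ _ _ _ h => exact h.wf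

theorem HasKind.arr_inv {Γ : Env M} {A B k} (h : HasKind S Γ (.arr A B) (.type k)) :
    HasKind S Γ A (.type k) ∧ HasKind S Γ B (.type k) := by
  cases h with
  | arr _ _ _ hA hB => exact ⟨hA, hB⟩

theorem HasKind.cons_tm_wf {Γ : Env M} {A k} (h : HasKind S Γ A (.type k)) :
    WfEnv S (some (.tm k A) :: Γ) := by
  obtain ⟨Γ₂, hs⟩ := (Env.Le.refl Γ).exists_split (S := S)
  exact .consTm hs h.ge h.wf h.wf h

theorem HasKind.thunk_inv {Γ : Env M} {b k l A Ψ K}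
    (h : HasKind S Γ (.thunk b A) (.up k l Ψ K)) : b = Ψ.len ∧ HasKind S (Γ.ext Ψ) A K := by
  cases h with
  | thunk _ _ _ hA => exact ⟨rfl, hA⟩

/-- Reduction of a neutral type whose head became a template. -/
theorem TySubst.splice {N} (IH : ∀ N' < N, TySubst S N') {s : ASub M} {Γ Γ₁ : Env M}
    {A A' : Ty M} {m k : M} {Ψ : Ctx M} {τ : Sbst M} {K K' : Kind M} {o o'}
    (hN : sizeOf Ψ.erase < N) (hl : Γ₁.Le Γ)
    (hA : HasKind S Γ₁ (.thunk Ψ.len A) (.up m k Ψ K)) (hτ : HasSbst S Γ.tyPart τ Ψ)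
    (h : WfEnv S Γ) (hg : Γ.Ge K.mode) (hz : Zip Ψ.erase τ.enc s)
    (r : RSub s 0 A.enc A'.enc o) (r' : RSub s 0 K.enc K'.enc o') : HasKind S Γ A' K' := by
  -- Everything is moved to type variables, where the required split exists for free; the result is
  -- enlarged to `Γ` at the end.
  have hA₁ := hA.thunk_inv.2.drop ((Env.Drop.tyPart Γ₁).ext Ψ)
  have hs : Split S Γ.tyPart Γ₁.tyPart Γ.tyPart := split_iff.mpr
    ⟨hl.tyPart, .refl _, fun _ _ h => .inr h, fun i k A h => by simp at h⟩
  obtain ⟨T, hgood⟩ := hτ.good hs (hA.wf.drop (.tyPart _)) hz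
  have h1 := IH _ hN hgood.toGoodTy hA₁ (h.drop (.tyPart _)) hg.tyPart r r'
  exact h1.mono (Env.tyPart_le _ |>.trans (Env.tyPart_le _)) h (by rwa [r'.kind_mode])

-- For fixed `N` this is a structural induction on derivations; only a splice appeals to `IH`.
-- `WfEnv.subst` treats every cut `Θ₀.ext Ψ`, because a context `Ψ` inside a type is checked in that
-- form. Types distribute resources by mode alone (`GoodTy.geq`), terms by `Good.exists_split`.
mutual
theorem WfEnv.subst {N} (IH : ∀ N' < N, TySubst S N') {Γ : Env M} : WfEnv S Γ →
    ∀ {s d} {Θ₀ Θ : Env M} {φ₀ φ} {Ψ Ψ' : Ctx M} {o}, Γ = Θ₀.ext Ψ →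
    GoodTy S N s d Θ₀ Θ φ₀ φ → WfEnv S Θ → RSub s d Ψ.enc Ψ'.enc o → WfEnv S (Θ.ext Ψ')
  | .nil, _, _, _, _, _, _, Ψ, Ψ', _, h, _, hΘ, hr => by
    cases Ψ <;> simp only [Env.ext, List.nil_eq, reduceCtorEq] at h
    rwa [hr.ctx_nil]
  | .none _, _, _, _, _, _, _, Ψ, Ψ', _, h, _, hΘ, hr => by
    cases Ψ <;> simp only [Env.ext, List.cons.injEq, reduceCtorEq, false_and] at h
    rwa [hr.ctx_nil]
  | .consTy (K := K) hs hg h₁ h₂ hK, _, _, _, Θ, _, _, Ψ, Ψ', _, h, hgood, hΘ, hr => by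
    cases Ψ with
    | nil => rwa [hr.ctx_nil]
    | consTy Ψ L =>
      obtain ⟨Ψ₁, L', _, _, rfl, -, r1, r2⟩ := hr.ctx_ty
      simp only [Env.ext, List.cons.injEq, Option.some.injEq, Entry.ty.injEq] at h
      have ih := h₂.subst IH h.2 hgood hΘ r1
      obtain ⟨rfl, h⟩ := h
      have ih' := hK.subst IH ((hgood.ext r1 ih).geq (h ▸ hs.le_left) hg) (ih.geq _)
        (Env.geq_ge _ _) r2
      obtain ⟨Γ₂, hs'⟩ := (Env.geq_le K.mode (Θ.ext Ψ₁)).exists_split (S := S)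
      exact .consTy hs' (by rw [r2.kind_mode]; exact Env.geq_ge _ _) (ih.geq _) ih ih'
    | consTm Ψ k A => simp [Env.ext] at h
  | .consTm (k := k) hs hg h₁ h₂ hA, _, _, _, Θ, _, _, Ψ, Ψ', _, h, hgood, hΘ, hr => by
    cases Ψ with
    | nil => rwa [hr.ctx_nil]
    | consTy Ψ L => simp [Env.ext] at h
    | consTm Ψ _ A =>
      obtain ⟨Ψ₁, L', _, _, rfl, -, r1, r2⟩ := hr.ctx_tm
      simp only [Env.ext, List.cons.injEq, Option.some.injEq, Entry.tm.injEq] at h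
      have ih := h₂.subst IH h.2 hgood hΘ r1
      obtain ⟨⟨rfl, rfl⟩, h⟩ := h
      have ih' := hA.subst IH ((hgood.ext r1 ih).geq (h ▸ hs.le_left) hg) (ih.geq _)
        (Env.geq_ge _ _) r2 (K' := .type _) .leaf
      obtain ⟨Γ₂, hs'⟩ := (Env.geq_le k (Θ.ext Ψ₁)).exists_split (S := S)
      exact .consTm hs' (Env.geq_ge _ _) (ih.geq _) ih ih'
termination_by structural h => h
theorem WfKind.subst {N} (IH : ∀ N' < N, TySubst S N') {Θ₀ : Env M} {K : Kind M} : WfKind S Θ₀ K →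
    ∀ {s d} {Θ : Env M} {φ₀ φ} {K' : Kind M} {o},
    GoodTy S N s d Θ₀ Θ φ₀ φ → WfEnv S Θ → Θ.Ge K.mode → RSub s d K.enc K'.enc o → WfKind S Θ K'
  | .type _ _, _, _, _, _, _, _, _, _, hΘ, hge, hr => by
    rw [hr.kind_type]; exact .type hΘ hge
  | .up _ _ hb hm hΨ hK, _, _, _, _, _, _, _, hgood, hΘ, hge, hr => by
    obtain ⟨Ψ', K', _, _, rfl, -, r1, r2⟩ := hr.kind_up
    have h1 := hΨ.subst IH rfl hgood hΘ r1
    have hb' := hb.rsub r1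
    exact .up hΘ hge hb' (r2.kind_mode.trans hm) h1
      (hK.subst IH (hgood.ext r1 h1) h1 (hm ▸ hb'.ge_ext hge) r2)
termination_by structural h => h
theorem HasKind.subst {N} (IH : ∀ N' < N, TySubst S N') {Θ₀ : Env M} {A : Ty M} {K : Kind M} :
    HasKind S Θ₀ A K → ∀ {s d} {Θ : Env M} {φ₀ φ} {A' : Ty M} {K' : Kind M} {o o'},
    GoodTy S N s d Θ₀ Θ φ₀ φ → WfEnv S Θ → Θ.Ge K.mode →
    RSub s d A.enc A'.enc o → RSub s d K.enc K'.enc o' → HasKind S Θ A' K'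
  | .var _ _ _ hi, _, _, _, _, _, _, _, _, _, hgood, hΘ, hge, hr, hr' => by
    obtain ⟨B, L, Θ₁, o₁, o₂, h1, h2, h3, h4⟩ := hgood.ty _ _ hi
    rw [hr.ty_det h1, hr'.kind_det h2]
    exact h4.weaken (h3.trans (Env.tyPart_le _)) hΘ (by rwa [h2.kind_mode])
  | .thunk _ _ hK hA, _, _, _, _, _, _, _, _, _, hgood, hΘ, hge, hr, hr' => by
    obtain ⟨A₁, _, rfl, r1⟩ := hr.ty_thunk
    have hK' := hK.subst IH hgood hΘ hge hr'
    obtain ⟨Ψ', K₁, _, _, rfl, hlen, r2, r3⟩ := hr'.kind_up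
    rw [← hlen]
    cases id hK' with
    | up _ _ hb hm hΨ _ =>
      exact .thunk hΘ hge hK' (hA.subst IH (hgood.ext r2 hΨ) hΨ
        (by rw [← r3.kind_mode, hm]; exact hb.ge_ext hge) r1 r3)
  | .force (P := P) (m := m) (k := k) (Ψ := Ψ) (K := K) _ _ hK' hs hg₁ _ hΨ hK₁ hP hσ hsub,
      s, d, Θ, _, _, A', K'', _, _, hgood, hΘ, hge, hr, hr' => by
    have hge' : Θ.Ge K''.mode := by rwa [hr'.kind_mode]
    have hK'' := hK'.subst IH hgood hΘ hge hr'
    have hgood₁ := hgood.geq hs.le_left hg₁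
    obtain ⟨X, _, rX⟩ := hgood.exists_kind (hgood.sk_mono hK₁.sk hs.le_left)
    obtain ⟨Ψ', K₁, _, _, rfl, hlen, r2, r3⟩ := rX.kind_up
    have hPsk := hgood.sk_mono hP.sk hs.le_left
    obtain ⟨B, oB, rB⟩ := hgood.exists_ty hPsk
    have hΘ₁ := hΘ.geq m
    have hK₁' := hK₁.subst IH hgood₁ hΘ₁ (Env.geq_ge _ _) rX
    have hB := hP.subst IH hgood₁ hΘ₁ (Env.geq_ge _ _) rB rX
    have hσsk := hgood.sk_mono hσ.sk (Env.tyPart_le _)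
    obtain ⟨τ', _, rτ⟩ := hgood.exists_sbst hσsk
    have hτ' := hσ.subst IH (hgood.tyPart (T := fun _ => [])) (hΘ.drop (.tyPart _)) rτ r2
    -- The expected kind `[s][τ]K` is also `[τ']K₁`, the kind that the substituted premises produce.
    obtain ⟨s', hz', ⟨o₁, rK⟩, hsub'⟩ := hgood.comp_kind (Env.tyPart_le _) hs.le_left hσ.sk
      hK₁.body_sk hsub rτ hr' r3
    rw [← hgood.ctx_erase r2] at hz' hsub'
    generalize hY : A'.enc = Y at hr
    cases hr with
    | @splice _ _ _ C m' l' ψ κ _ τ'' _ s'' _ _ rP rτ'' hz'' rC =>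
      obtain ⟨-, hann, -⟩ := rP.sound hPsk hgood.bnd hgood.ok
      obtain ⟨he, hsize⟩ := hann _ rfl
      simp only [Kind.erase, Srt.kd.injEq, SKind.up.injEq] at he
      obtain ⟨rfl, rfl, rfl, rfl⟩ := he
      obtain rfl := (rτ.det rτ'').1
      rw [← hgood.ctx_erase r2] at hz'' hsize
      obtain rfl := hz'.det hz''
      obtain ⟨C', rfl, hC⟩ := Ty.enc_eq_thunk (rB.det rP).1
      rw [hz'.length, Ctx.len_erase] at hB
      subst hY
      rw [← hC] at rC
      -- The head has become a template that is already typed with kind `up m k Ψ' K₁`. Substituting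
      -- `τ'` in its body is not structural, but the annotation of the head has size at most `N`, so
      -- `Ψ'.erase` is strictly smaller.
      refine TySubst.splice IH ?_ (Env.geq_le m Θ) hB hτ' hΘ (by rwa [← rK.kind_mode]) hz' rC rK
      simp only [SKind.up.sizeOf_spec] at hsize
      omega
    | stuck rP hn rτ'' =>
      obtain ⟨P', rfl⟩ := Ty.isNeu_enc.mp ((rB.det rP).1.symm ▸ hn : B.enc.IsNeu)
      obtain rfl := (rτ.det rτ'').1
      obtain rfl := (rB.det rP).1
      obtain ⟨Γ₂, hs'⟩ := (Env.geq_le m Θ).exists_split (S := S)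
      rw [show A' = .neu (.force P' τ') from Ty.enc_inj hY]
      exact .force hΘ hge' hK'' hs' (Env.geq_ge _ _) hΘ₁ (hΨ.subst IH rfl hgood hΘ r2) hK₁' hB
        hτ' hsub'
  | .up _ _ _ hb hΨ hA, _, _, _, _, _, _, _, _, _, hgood, hΘ, hge, hr, hr' => by
    rw [hr'.kind_type]
    obtain ⟨Ψ', A', _, _, rfl, -, r1, r2⟩ := hr.ty_up
    have h1 := hΨ.subst IH rfl hgood hΘ r1
    have hb' := hb.rsub r1
    exact .up hΘ hge (.type hΘ hge) hb' h1
      (hA.subst IH (hgood.ext r1 h1) h1 (hb'.ge_ext hge) r2 (K' := .type _) .leaf)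
  | .down (m := m) _ _ _ hs hg₁ hm _ hA, _, _, Θ, _, _, _, _, _, _, hgood, hΘ, hge, hr, hr' => by
    rw [hr'.kind_type]
    obtain ⟨A', _, rfl, r1⟩ := hr.ty_down
    obtain ⟨Γ₂, hs'⟩ := (Env.geq_le m Θ).exists_split (S := S)
    exact .down hΘ hge (.type hΘ hge) hs' (Env.geq_ge _ _) hm (hΘ.geq m)
      (hA.subst IH (hgood.geq hs.le_left hg₁) (hΘ.geq m) (Env.geq_ge _ _) r1 (K' := .type _) .leaf)
  | .all (K := K) _ _ _ hs hg₁ hm _ hK hA, _, _, Θ, _, _, _, _, _, _, hgood, hΘ, hge, hr, hr' => by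
    rw [hr'.kind_type]
    obtain ⟨K', A', _, _, rfl, r1, r2⟩ := hr.ty_all
    obtain ⟨Γ₂, hs'⟩ := (Env.geq_le K.mode Θ).exists_split (S := S)
    have hK' := hK.subst IH (hgood.geq hs.le_left hg₁) (hΘ.geq _) (Env.geq_ge _ _) r1
    have hg' : (Θ.geq K.mode).Ge K'.mode := by rw [r1.kind_mode]; exact Env.geq_ge _ _
    have hm' := hm
    rw [← r1.kind_mode] at hm'
    have hw : WfEnv S (some (.ty K') :: Θ) := .consTy hs' hg' (hΘ.geq _) hΘ hK'
    exact .all hΘ hge (.type hΘ hge) hs' hg' hm' (hΘ.geq _) hK'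
      (hA.subst IH (hgood.cons_ty r1 hw) hw (hge.cons hm') r2 (K' := .type _) .leaf)
  | .arr _ _ _ hA hB, _, _, _, _, _, _, _, _, _, hgood, hΘ, hge, hr, hr' => by
    rw [hr'.kind_type]
    obtain ⟨A', B', _, _, rfl, r1, r2⟩ := hr.ty_arr
    exact .arr hΘ hge (.type hΘ hge) (hA.subst IH hgood hΘ hge r1 (K' := .type _) .leaf)
      (hB.subst IH hgood hΘ hge r2 (K' := .type _) .leaf)
  | .one _ _ _, _, _, _, _, _, _, _, _, _, hgood, hΘ, hge, hr, hr' => by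
    rw [hr'.kind_type, hr.ty_one]
    exact .one hΘ hge (.type hΘ hge)
termination_by structural h => h
theorem HasTy.subst {N} (IH : ∀ N' < N, TySubst S N') {Θ₀ : Env M} {e : Tm M} {k : M} {A : Ty M} :
    HasTy S Θ₀ e k A → ∀ {s d} {Θ : Env M} {φ₀ φ T} {e' : Tm M} {A' : Ty M} {o o'},
    Good S N s d Θ₀ Θ φ₀ φ T → WfEnv S Θ → Θ.Ge k →
    RSub s d e.enc e'.enc o → RSub s d A.enc A'.enc o' → HasTy S Θ e' k A'
  | .var _ _ _ hs hi hw, _, _, _, _, _, _, _, _, _, _, hgood, hΘ, hge, hr, hr' => by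
    obtain ⟨f, B, o₁, o₂, h1, h2, h3, h4⟩ := hgood.tm _ _ _ (hs.le_left.2 _ _ hi.1)
    rw [hr.tm_det h1, hr'.ty_det h2]
    exact h4.weaken (hgood.var_wk hs hi hw) hΘ hge
  | .susp _ _ hA he, _, _, _, _, _, _, _, _, _, _, hgood, hΘ, hge, hr, hr' => by
    obtain ⟨e', _, rfl, r1⟩ := hr.tm_susp
    have hA' := hA.subst IH hgood.toGoodTy hΘ hge hr' (K' := .type _) .leaf
    obtain ⟨Ψ', A', _, _, rfl, hlen, r2, r3⟩ := hr'.ty_up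
    obtain ⟨hb, hΨ⟩ := hA'.up_inv
    obtain ⟨T', hgood'⟩ := hgood.ext r2 hΨ
    rw [← hlen]
    exact .susp hΘ hge hA' (he.subst IH hgood' hΨ (hb.ge_ext hge) r1 r3)
  | .store _ _ hA hs hw hg₁ _ he, _, _, _, _, _, _, _, _, _, _, hgood, hΘ, hge, hr, hr' => by
    obtain ⟨e', _, rfl, r1⟩ := hr.tm_store
    have hA' := hA.subst IH hgood.toGoodTy hΘ hge hr' (K' := .type _) .leaf
    obtain ⟨A', _, rfl, r2⟩ := hr'.ty_down
    obtain ⟨Θ₁, Θ₂, hs', hg', hΘ₁, -, hgood₁, hgood₂⟩ := hgood.exists_split hΘ hs hg₁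
    exact .store hΘ hge hA' hs' (hgood₂.weak_of_weak hw) hg' hΘ₁
      (he.subst IH hgood₁ hΘ₁ hg' r1 r2)
  | .tlam _ _ hA he, _, _, _, _, _, _, _, _, _, _, hgood, hΘ, hge, hr, hr' => by
    obtain ⟨K', e', _, _, rfl, r1, r2⟩ := hr.tm_tlam
    have hA' := hA.subst IH hgood.toGoodTy hΘ hge hr' (K' := .type _) .leaf
    obtain ⟨K'', A', _, _, rfl, r3, r4⟩ := hr'.ty_all
    obtain rfl := r1.kind_det r3
    have hw := hA'.all_inv
    refine .tlam hΘ hge hA' (he.subst IH (hgood.cons_ty r1 hw) hw (hge.cons ?_) r2 r4)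
    have := he.ge.head
    rwa [Entry.mode, ← r1.kind_mode] at this
  | .lam _ _ hA he, _, _, _, _, _, _, _, _, _, _, hgood, hΘ, hge, hr, hr' => by
    obtain ⟨B, e', _, _, rfl, r1, r2⟩ := hr.tm_lam
    have hA' := hA.subst IH hgood.toGoodTy hΘ hge hr' (K' := .type _) .leaf
    obtain ⟨B', A', _, _, rfl, r3, r4⟩ := hr'.ty_arr
    obtain rfl := r1.ty_det r3
    have hw := hA'.arr_inv.1.cons_tm_wf
    -- Under the binder the codomain appears shifted, and substituting one level deeper in the
    -- shifted type gives the shifted result.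
    have r5 := r4.shift_le 1 0 (Nat.zero_le _)
    rw [← Ty.enc_shift, ← Ty.enc_shift] at r5
    exact .lam hΘ hge hA' (he.subst IH (hgood.cons_tm r1 hw) hw (hge.cons le_rfl) r2 r5)
  | .one _ _ _ hw, _, _, _, _, _, _, _, _, _, _, hgood, hΘ, hge, hr, hr' => by
    rw [hr.tm_one, hr'.ty_one]
    exact .one hΘ hge (.one hΘ hge (.type hΘ hge)) (hgood.weak_of_weak hw)
  | .force _ _ hA' hs _ hg₁ hΨ hA₁ he hσ hsub, _, _, Θ, _, _, _, _, A'', _, _, hgood, hΘ, hge,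
      hr, hr' => by
    obtain ⟨e', τ', _, _, rfl, r1, r2⟩ := hr.tm_force
    obtain ⟨Θ₁, Θ₂, hs', hg', hΘ₁, hΘ₂, hgood₁, hgood₂⟩ := hgood.exists_split hΘ hs hg₁
    have hA'' := hA'.subst IH hgood.toGoodTy hΘ hge hr' (K' := .type _) .leaf
    obtain ⟨X, _, rX⟩ := hgood.exists_ty (hgood.sk_mono hA₁.sk hs.le_left)
    have hX := hA₁.subst IH hgood₁.toGoodTy hΘ₁ hg' rX (K' := .type _) .leaf
    have he' := he.subst IH hgood₁ hΘ₁ hg' r1 rX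
    obtain ⟨Ψ', B, _, _, rfl, hlen, r3, r4⟩ := rX.ty_up
    have hσ' := hσ.subst IH hgood₂ hΘ₂ r2 r3
    obtain ⟨t, hB⟩ := hA₁.up_body_sk
    have hsub' := hgood.comp_ty hs.le_right hs.le_left hσ.sk hB hsub r2 hr' r4
    rw [← hgood.ctx_erase r3] at hsub' ⊢
    exact .force hΘ hge hA'' hs' hΘ₁ hg' (hΨ.subst IH rfl hgood₂.toGoodTy hΘ₂ r3) hX he' hσ' hsub'
  | .load (m := m) (A := A) _ _ hB hs _ hg₁ hm hx hA he hf, _, _, Θ, _, _, _, _, B', _, _, hgood,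
      hΘ, hge, hr, hr' => by
    obtain ⟨e', f', _, _, rfl, r1, r2⟩ := hr.tm_load
    obtain ⟨Θ₁, Θ₂, hs', hg', hΘ₁, hΘ₂, hgood₁, hgood₂⟩ := hgood.exists_split hΘ hs hg₁
    obtain ⟨X, _, rX⟩ := hgood.exists_ty (hgood.sk_mono hA.sk hs.le_left)
    have hB' := hB.subst IH hgood.toGoodTy hΘ hge hr' (K' := .type _) .leaf
    have hX := hA.subst IH hgood₁.toGoodTy hΘ₁ hg' rX (K' := .type _) .leaf
    have he' := he.subst IH hgood₁ hΘ₁ hg' r1 rX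
    obtain ⟨A', _, rfl, r3⟩ := rX.ty_down
    have hx' := hx.subst IH (Ψ := .consTm .nil m A) (Ψ' := .consTm .nil m A') rfl hgood₂.toGoodTy
      hΘ₂ (.node .leaf r3)
    have r5 := hr'.shift_le 1 0 (Nat.zero_le _)
    rw [← Ty.enc_shift, ← Ty.enc_shift] at r5
    exact .load hΘ hge hB' hs' hΘ₁ hg' hm hx' hX he' (hf.subst IH (hgood₂.cons_tm r3 hx') hx'
      ((hge.le hs'.le_right).cons hf.ge.head) r2 r5)
  | .tapp (K := K) _ _ hB' hs _ hg₁ hm hA₀ he hK hA hsub, _, _, Θ, _, _, _, _, B'', _, _, hgood,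
      hΘ, hge, hr, hr' => by
    obtain ⟨e', A', _, _, rfl, r1, r2⟩ := hr.tm_tapp
    have hB'' := hB'.subst IH hgood.toGoodTy hΘ hge hr' (K' := .type _) .leaf
    obtain ⟨X, _, rX⟩ := hgood.exists_ty (hgood.sk_mono hA₀.sk (.refl _))
    have hX := hA₀.subst IH hgood.toGoodTy hΘ hge rX (K' := .type _) .leaf
    have he' := he.subst IH hgood hΘ hge r1 rX
    obtain ⟨K', B₁, _, _, rfl, r3, r4⟩ := rX.ty_all
    obtain ⟨Γ₂, hs'⟩ := (Env.geq_le K.mode Θ).exists_split (S := S)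
    -- The type argument spends no resources: the term `e` keeps all of `Θ`, and the argument is
    -- typed in the declarations of sufficient mode.
    have hgood₁ := hgood.toGoodTy.geq hs.le_left hg₁
    have hK' := hK.subst IH hgood₁ (hΘ.geq _) (Env.geq_ge _ _) r3
    have hA' := hA.subst IH hgood₁ (hΘ.geq _) (Env.geq_ge _ _) r2 r3
    obtain ⟨t, hB⟩ := hA₀.all_body_sk
    have hsub' := hgood.comp_ty hs.le_left (.refl _) (Ψ := .consTy .nil K)
      (τ := .consTy .nil _) (.sbTy .sbNil hA.sk) hB
      hsub (τ' := .consTy .nil A') (.node .leaf r2) hr' r4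
    have hmode := r3.kind_mode
    refine .tapp hΘ hge hB'' hs' (hΘ.geq _) (hmode ▸ Env.geq_ge _ _) (hmode ▸ hm) hX he' hK' hA' ?_
    rw [hgood.kind_erase r3]
    exact hsub'
  | .app (k := k) _ _ hB hs h₁ _ hA₀ he hA hf, _, _, Θ, _, _, _, _, B', _, _, hgood,
      hΘ, hge, hr, hr' => by
    obtain ⟨e', f', _, _, rfl, r1, r2⟩ := hr.tm_app
    have hB' := hB.subst IH hgood.toGoodTy hΘ hge hr' (K' := .type _) .leaf
    -- The rule has no mode premise for the left part; the bound is the presupposition of the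
    -- function's typing.
    obtain ⟨Θ₁, Θ₂, hs', hg', hΘ₁, hΘ₂, hgood₁, hgood₂⟩ := hgood.exists_split hΘ hs he.ge
    obtain ⟨A', _, r3⟩ := hgood.exists_ty (hgood.sk_mono hA.sk hs.le_right)
    -- The domain is absent from the result type, so its instance comes from totality. The arrow is
    -- assembled from it so that function and argument agree on the same `A'`.
    have rX := RSub.node (l := .arr) r3 (show RSub _ (_ + 0) _ _ _ from hr')
    have hX := hA₀.subst IH hgood₁.toGoodTy hΘ₁ hg' (A' := .arr A' B') rX (K' := .type _) .leaf
    have he' := he.subst IH hgood₁ hΘ₁ hg' r1 (A' := .arr A' B') rX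
    have hg₂ := hge.le hs'.le_right
    exact .app hΘ hge hB' hs' hΘ₁ hΘ₂ hX he'
      (hA.subst IH hgood₂.toGoodTy hΘ₂ hg₂ r3 (K' := .type _) .leaf)
      (hf.subst IH hgood₂ hΘ₂ hg₂ r2 r3)
termination_by structural h => h
theorem HasSbst.subst {N} (IH : ∀ N' < N, TySubst S N') {Θ₀ : Env M} {τ : Sbst M} {Ψ : Ctx M} :
    HasSbst S Θ₀ τ Ψ → ∀ {s d} {Θ : Env M} {φ₀ φ T} {τ' : Sbst M} {Ψ' : Ctx M} {o o'},
    Good S N s d Θ₀ Θ φ₀ φ T → WfEnv S Θ →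
    RSub s d τ.enc τ'.enc o → RSub s d Ψ.enc Ψ'.enc o' → HasSbst S Θ τ' Ψ'
  | .nil _ hw, _, _, _, _, _, _, _, _, _, _, hgood, hΘ, hr, hr' => by
    rw [hr.sbst_nil, hr'.ctx_nil]
    exact .nil hΘ (hgood.weak_of_weak hw)
  | .consTy (K := K) hΨ hs hg hσ _ hsub hK hA, _, _, Θ, _, _, _, _, _, _, _, hgood, hΘ, hr,
      hr' => by
    obtain ⟨τ', A', _, _, rfl, r1, r2⟩ := hr.sbst_ty
    have hΨ' := hΨ.subst IH rfl hgood.toGoodTy hΘ hr'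
    have hKsk := hΨ.sk_last_ty
    obtain ⟨Ψ', K₁, _, _, rfl, hlen, r3, r4⟩ := hr'.ctx_ty
    obtain ⟨L, _, rL⟩ := hgood.exists_kind (hgood.sk_mono hK.sk hs.le_left)
    obtain ⟨s', hz', -, hsub'⟩ := hgood.comp_kind (.refl _) (.refl _) hσ.sk hKsk hsub r1 rL r4
    rw [← hgood.ctx_erase r3] at hsub'
    have hmode : L.mode = K.mode := by rw [rL.kind_mode, hsub.mode_eq]
    have hgood₁ := hgood.toGoodTy.geq hs.le_left hg
    obtain ⟨Γ₂, hs'⟩ := (Env.geq_le K.mode Θ).exists_split (S := S)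
    have hg' := Env.geq_ge K.mode Θ
    have hgm : ∀ m, m = K.mode → (Θ.geq K.mode).Ge m := by rintro _ rfl; exact hg'
    exact .consTy hΨ' hs' (by rwa [r4.kind_mode]) (hσ.subst IH hgood hΘ r1 r3) (hΘ.geq _) hsub'
      (hK.subst IH hgood₁ (hΘ.geq _) (hgm _ hsub.mode_eq) rL)
      (hA.subst IH hgood₁ (hΘ.geq _) (hgm _ hsub.mode_eq) r2 rL)
  | .consTm hΨ hs hg _ hσ _ hsub hA he, _, _, Θ, _, _, _, _, _, _, _, hgood, hΘ, hr, hr' => by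
    obtain ⟨τ', e', _, _, rfl, r1, r2⟩ := hr.sbst_tm
    have hΨ' := hΨ.subst IH rfl hgood.toGoodTy hΘ hr'
    obtain ⟨t, hAsk⟩ := hΨ.sk_last_tm
    obtain ⟨Ψ', A₁, _, _, rfl, hlen, r3, r4⟩ := hr'.ctx_tm
    obtain ⟨L, _, rL⟩ := hgood.exists_ty (hgood.sk_mono hA.sk hs.le_left)
    have hsub' := hgood.comp_ty hs.le_right (.refl _) hσ.sk hAsk hsub r1 rL r4
    rw [← hgood.ctx_erase r3] at hsub'
    obtain ⟨Θ₁, Θ₂, hs', hg', hΘ₁, hΘ₂, hgood₁, hgood₂⟩ := hgood.exists_split hΘ hs hg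
    exact .consTm hΨ' hs' hg' hΘ₂ (hσ.subst IH hgood₂ hΘ₂ r1 r3) hΘ₁ hsub'
      (hA.subst IH hgood₁.toGoodTy hΘ₁ hg' rL (K' := .type _) .leaf)
      (he.subst IH hgood₁ hΘ₁ hg' r2 rL)
termination_by structural h => h
end

theorem tySubst (S : ModeSpec M) (N : ℕ) : TySubst S N := by
  induction N using Nat.strong_induction_on with
  | _ N IH => exact fun h hA hΘ hg hr hr' => hA.subst IH h hΘ hg hr hr'

end

theorem Ty.sub_nil {φ : SEnv M} {A : Ty M} {t} (h : SK φ A.enc t) : SubTy .nil .nil 0 A A := by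
  obtain ⟨A', h1, h2⟩ := ((Raw.rsub_nil h).reflects (σ := .nil) .nil).ty _ rfl
  rwa [← Ty.enc_inj h1] at h2

theorem Kind.sub_nil {φ : SEnv M} {K : Kind M} {t} (h : SK φ K.enc t) :
    SubKind .nil .nil 0 K K := by
  obtain ⟨K', h1, h2⟩ := ((Raw.rsub_nil h).reflects (σ := .nil) .nil).kind _ rfl
  rwa [← Kind.enc_inj h1] at h2

section

variable [Preorder M] {S : ModeSpec M}

/-! ## Preservation -/

theorem Split.symm {Γ Γ₁ Γ₂ : Env M} (h : Split S Γ Γ₁ Γ₂) : Split S Γ Γ₂ Γ₁ := by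
  obtain ⟨h1, h2, h3, h4⟩ := split_iff.mp h
  exact split_iff.mpr ⟨h2, h1, fun i E hi => (h3 i E hi).symm, fun i k A h h' => h4 i k A h' h⟩

/-- The hypothesis on the type is phrased on trees to cover both uses: a genuine substitution
instance, and a type in which the substituted variable does not occur. -/
theorem HasTy.sub {Γ Γ₀ Γσ : Env M} {a a' : Tm M} {k : M} {A A' : Ty M} {Ψ : Ctx M} {σ : Sbst M}
    (ha : HasTy S (Γ₀.ext Ψ) a k A) (hσ : HasSbst S Γσ σ Ψ) (hs : Split S Γ Γ₀ Γσ)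
    (h₀ : WfEnv S Γ₀) (h : WfEnv S Γ) (hg : Γ.Ge k) (hsub : SubTm Ψ.erase σ 0 a a')
    (hA : ∀ s, Zip Ψ.erase σ.enc s → ∃ o, RSub s 0 A.enc A'.enc o) : HasTy S Γ a' k A' := by
  obtain ⟨s, hz, -⟩ := hσ.sk.exists_zip rfl
  obtain ⟨T, hgood⟩ := hσ.good hs h₀ hz
  obtain ⟨o, hr⟩ := hsub.rsub hz (hgood.sk_mono ha.sk (.refl _)) hgood.ok
  obtain ⟨o', hr'⟩ := hA s hz
  exact ha.subst (fun N _ => tySubst S N) hgood h hg hr hr'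

theorem HasTy.sub_ty {Γ Γ₀ Γσ : Env M} {a a' : Tm M} {k : M} {A A' : Ty M} {Ψ : Ctx M}
    {σ : Sbst M} (ha : HasTy S (Γ₀.ext Ψ) a k A) (hσ : HasSbst S Γσ σ Ψ) (hs : Split S Γ Γ₀ Γσ)
    (h₀ : WfEnv S Γ₀) (h : WfEnv S Γ) (hg : Γ.Ge k) (hsub : SubTm Ψ.erase σ 0 a a')
    (hA : SubTy Ψ.erase σ 0 A A') : HasTy S Γ a' k A' := by
  refine ha.sub hσ hs h₀ h hg hsub fun s hz => ?_
  obtain ⟨T, hgood⟩ := hσ.good hs h₀ hz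
  exact hA.rsub hz (hgood.sk_mono ha.hasKind.sk (.refl _)) hgood.ok

/-- Substituting a term of type `A` for the last variable. -/
theorem HasTy.sub_tm {Γ Γ₀ Γ' Γ₁ ΓW : Env M} {a a' v : Tm M} {k m : M} {A B : Ty M}
    (ha : HasTy S (some (.tm m A) :: Γ₀) a k (B.shift 1 0)) (hB : HasKind S Γ B (.type k))
    (hv : HasTy S Γ₁ v m A) (hs' : Split S Γ' Γ₁ ΓW) (hw : ΓW.Weak S) (h' : WfEnv S Γ')
    (hs : Split S Γ Γ₀ Γ') (hsub : SubTm (.consTm .nil) (.consTm .nil m v) 0 a a') :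
    HasTy S Γ a' k B := by
  -- `ΓW` may lack type variables and need not be well formed by itself. It is enlarged to a right
  -- part that contains all type variables of `Γ'` and still has only weakenable term variables.
  obtain ⟨ΓW', h1, h2, h3⟩ := Env.Wk.exists_split (S := S) (Γ' := Γ')
    ⟨.refl _, fun _ _ _ h hn => absurd h hn⟩ hs'
  have hW := h'.drop h3
  have hσ : HasSbst S Γ' (.consTm .nil m v) (.consTm .nil m A) :=
    .consTm (hv.hasKind.cons_tm_wf.cons_tm_mono hs'.le_left h') h1 hv.ge hW
      (.nil hW (h2.weak hw)) hv.wf (Ty.sub_nil hv.hasKind.sk) hv.hasKind hv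
  refine HasTy.sub (Ψ := .consTm .nil m A) ha hσ hs ha.wf.tail hB.wf hB.ge hsub fun s hz => ?_
  -- The type of the body is `B` shifted past the variable, so the substitution returns `B`.
  have hr := hB.sk.rsub_shift s 0
  rw [hz.length, ← Ty.enc_shift] at hr
  exact ⟨_, hr⟩

theorem HasTy.force_susp {Γ : Env M} {m k k' : M} {n : ℕ} {a e' : Tm M} {δ : SCtx M} {σ : Sbst M}
    {A : Ty M} (h : HasTy S Γ (.force m k (.susp m k n a) δ σ) k' A) (hsub : SubTm δ σ 0 a e') :
    HasTy S Γ e' k' A := by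
  cases h with
  | force h hg _ hs h₁ _ _ _ he hσ hA =>
    cases he with
    | susp _ _ _ ha => exact ha.sub_ty hσ hs h₁ h hg hsub hA

theorem HasTy.tapp_tlam {Γ : Env M} {k : M} {K : Kind M} {e e' : Tm M} {A B : Ty M}
    (h : HasTy S Γ (.tapp (.tlam K e) A) k B)
    (hsub : SubTm (.consTy .nil K.erase) (.consTy .nil A) 0 e e') : HasTy S Γ e' k B := by
  cases h with
  | @tapp _ Γ₁ _ _ _ _ _ _ _ h hg _ hs h₁ hg₁ _ _ he hK hA hB =>
    cases he with
    | tlam _ _ _ he =>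
      -- The argument is typed in type variables only. Then `Γ` splits as itself and its type
      -- variables, and no term variable is left over that would need weakening.
      have h₁' := h₁.drop (.tyPart _)
      have h' := h.drop (.tyPart _)
      obtain ⟨Γ₂', hs'⟩ := hs.le_left.tyPart.exists_split (S := S)
      obtain ⟨Γ₃, hs₃⟩ := (Env.Le.refl Γ₁.tyPart).exists_split (S := S)
      have hK' := hK.drop (.tyPart _)
      have hw : WfEnv S (some (.ty K) :: Γ₁.tyPart) := .consTy hs₃ hg₁.tyPart h₁' h₁' hK'
      have hσ : HasSbst S Γ.tyPart (.consTy .nil A) (.consTy .nil K) :=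
        .consTy (hw.cons_ty_mono hs.le_left.tyPart h') hs' hg₁.tyPart (.nil h' (Env.weak_tyPart _))
          h₁' (Kind.sub_nil hK.sk) hK' (hA.drop (.tyPart _))
      exact HasTy.sub_ty (Ψ := .consTy .nil K) he hσ (Env.Le.refl Γ).split_tyPart h h hg hsub hB

-- The redex cases are the substitution lemmas above; in the others no remaining premise mentions
-- the reduced subterm. Reduction below a binder is covered because the induction hypothesis holds
-- in every environment.
mutual
theorem Step.preserves {e e' : Tm M} : Step e e' → ∀ {Γ k A}, HasTy S Γ e k A → HasTy S Γ e' k A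
  | .forceSusp _ hsub, _, _, _, h => h.force_susp hsub
  -- The value uses one part of the environment of the `store`, and the rest is weakenable by the
  -- `store` rule. The split is reversed because the body is typed in the right part.
  | .loadStore _ hsub, _, _, _, .load _ _ hB hs h₁ _ _ _ _ (.store _ _ _ hs' hw _ _ hv) hf =>
    hf.sub_tm hB hv hs' hw h₁ hs.symm hsub
  | .tbeta hsub, _, _, _, h => h.tapp_tlam hsub
  -- The argument may use its whole environment, so the leftover part is chosen as the type
  -- variables, which is weakenable at every mode.
  | .beta _ hsub, _, _, _, .app _ _ hB hs _ h₂ _ (.lam _ _ _ he) _ hu =>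
    he.sub_tm hB hu (Env.Le.refl _).split_tyPart (Env.weak_tyPart _) h₂ hs hsub
  | .susp hr, _, _, _, .susp h hg hA he => .susp h hg hA (hr.preserves he)
  | .force hr, _, _, _, .force h hg hA hs h₁ hg₁ hΨ hA₁ he hσ hsub =>
    .force h hg hA hs h₁ hg₁ hΨ hA₁ (hr.preserves he) hσ hsub
  | .store hr, _, _, _, .store h hg hA hs hw hg₁ h₁ he =>
    .store h hg hA hs hw hg₁ h₁ (hr.preserves he)
  | .load hr, _, _, _, .load h hg hB hs h₁ hg₁ hm hx hA he hf =>
    .load h hg hB hs h₁ hg₁ hm hx hA (hr.preserves he) hf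
  | .tapp hr, _, _, _, .tapp h hg hB hs h₁ hg₁ hm hA₀ he hK hA hsub =>
    .tapp h hg hB hs h₁ hg₁ hm hA₀ (hr.preserves he) hK hA hsub
  | .appL hr, _, _, _, .app h hg hB hs h₁ h₂ hA₀ he hA hf =>
    .app h hg hB hs h₁ h₂ hA₀ (hr.preserves he) hA hf
  | .appR _ hr, _, _, _, .app h hg hB hs h₁ h₂ hA₀ he hA hf =>
    .app h hg hB hs h₁ h₂ hA₀ he hA (hr.preserves hf)
termination_by structural h => h
theorem TStep.preserves {m : M} {e e' : Tm M} : TStep m e e' → ∀ {Γ k A}, HasTy S Γ e k A →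
    HasTy S Γ e' k A
  | .susp hr, _, _, _, .susp h hg hA he => .susp h hg hA (hr.preserves he)
  | .forceT _ hr, _, _, _, .force h hg hA hs h₁ hg₁ hΨ hA₁ he hσ hsub =>
    .force h hg hA hs h₁ hg₁ hΨ hA₁ (hr.preserves he) hσ hsub
  | .forceE _ hr, _, _, _, .force h hg hA hs h₁ hg₁ hΨ hA₁ he hσ hsub =>
    .force h hg hA hs h₁ hg₁ hΨ hA₁ (hr.preserves he) hσ hsub
  | .forceSusp _ _ hsub, _, _, _, h => h.force_susp hsub
  | .storeT _ hr, _, _, _, .store h hg hA hs hw hg₁ h₁ he =>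
    .store h hg hA hs hw hg₁ h₁ (hr.preserves he)
  | .storeE _ hr, _, _, _, .store h hg hA hs hw hg₁ h₁ he =>
    .store h hg hA hs hw hg₁ h₁ (hr.preserves he)
  | .loadT _ hr, _, _, _, .load h hg hB hs h₁ hg₁ hm hx hA he hf =>
    .load h hg hB hs h₁ hg₁ hm hx hA (hr.preserves he) hf
  | .loadE _ hr, _, _, _, .load h hg hB hs h₁ hg₁ hm hx hA he hf =>
    .load h hg hB hs h₁ hg₁ hm hx hA (hr.preserves he) hf
  | .loadBodyT _ _ hr, _, _, _, .load h hg hB hs h₁ hg₁ hm hx hA he hf =>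
    .load h hg hB hs h₁ hg₁ hm hx hA he (hr.preserves hf)
  | .loadBodyE _ _ hr, _, _, _, .load h hg hB hs h₁ hg₁ hm hx hA he hf =>
    .load h hg hB hs h₁ hg₁ hm hx hA he (hr.preserves hf)
  | .tlam hr, _, _, _, .tlam h hg hA he => .tlam h hg hA (hr.preserves he)
  | .tapp hr, _, _, _, .tapp h hg hB hs h₁ hg₁ hm hA₀ he hK hA hsub =>
    .tapp h hg hB hs h₁ hg₁ hm hA₀ (hr.preserves he) hK hA hsub
  | .lam hr, _, _, _, .lam h hg hA he => .lam h hg hA (hr.preserves he)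
  | .appL hr, _, _, _, .app h hg hB hs h₁ h₂ hA₀ he hA hf =>
    .app h hg hB hs h₁ h₂ hA₀ (hr.preserves he) hA hf
  | .appR _ hr, _, _, _, .app h hg hB hs h₁ h₂ hA₀ he hA hf =>
    .app h hg hB hs h₁ h₂ hA₀ he hA (hr.preserves hf)
termination_by structural h => h
end

end

end Elevator

theorem mainTheorem2 {M : Type*} [Preorder M] (S : Elevator.ModeSpec M)
    (Γ : Elevator.Env M) (e : Elevator.Tm M) (k : M) (A : Elevator.Ty M)
    (he : Elevator.HasTy S Γ e k A) :
    (∀ e' : Elevator.Tm M, Elevator.Step e e' → Elevator.HasTy S Γ e' k A) ∧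
    (∀ (m : M) (e' : Elevator.Tm M), Elevator.TStep m e e' → Elevator.HasTy S Γ e' k A) :=
  ⟨fun _ h => h.preserves he, fun _ _ h => h.preserves he⟩
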